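/- Let $n\ge 2$ and let $(M^n,g)$ be a compact, connected and oriented smooth $n$-dimensional Riemannian manifold without boundary, isometrically immersed by a smooth map $\phi$ either into $\mathbb{R}^{n+1}$ (put $\delta=0$) or, for some $\delta>0$, into an open hemisphere (an open geodesic ball of radius $\frac{\pi}{2\sqrt\delta}$) of the sphere $\mathbb{S}^{n+1}(\delta)$ of constant sectional curvature $\delta$. Write $X$ for $\mathbb{R}^{n+1}$, respectively $\mathbb{S}^{n+1}(\delta)$, with its geodesic distance $d$, and let $R=\inf\{r>0 : \exists x\in X,\ \phi(M)\subset B(x,r)\}$, where $B(x,r)$ is the open ball of $X$, be the extrinsic radius of $M$. Let $\nu$ be the unit normal field of $\phi$ given by the orientation, let $B(u,v)=\langle\overline\nabla_u\nu,v\rangle$ be the second fundamental form, where $\overline\nabla$ is the Riemannian connection of $X$, and let $H=\frac1n\operatorname{tr}_g B$ be the mean curvature. Put $\|H\|_p=\left(\int_M|H|^p\,dv_g\right)^{1/p}$, and let $V(M)$ be the Riemannian volume of $(M,g)$. Let $t_0(r)=r$ and $t_\delta(r)=\frac{1}{\sqrt\delta}\tan(\sqrt\delta\,r)$ for $\delta>0$.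 Then for every real $p\ge1$ one has $V(M)>0$, $\|H\|_p>0$ and $$t_\delta(R)\ \ge\ \frac{V(M)^{1/p}}{\|H\|_p}.$$ Moreover, for every such $p$, equality holds if and only if $M$ is a geodesic hypersphere of radius $R$, that is, $\phi$ is injective and its image is a sphere $\{y\in X : d(x,y)=R\}$ for some $x\in X$. -/

import Mathlib

open scoped Manifold ContDiff
open MeasureTheory

noncomputable section

/-- The function `s_δ`. -/
def sDelta (δ t : ℝ) : ℝ :=
  if 0 < δ then Real.sin (√δ * t) / √δ
  else if δ = 0 then t
  else Real.sinh (√(-δ) * t) / √(-δ)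

/-- The function `c_δ`. -/
def cDelta (δ t : ℝ) : ℝ :=
  if 0 < δ then Real.cos (√δ * t)
  else if δ = 0 then 1
  else Real.cosh (√(-δ) * t)

/-- The function `t_δ = s_δ / c_δ`. -/
def tDelta (δ t : ℝ) : ℝ := sDelta δ t / cDelta δ t

/-- The sphere `𝕊^{n+1}(δ)` of sectional curvature `δ > 0`: the round sphere of radius `1 / √δ`
centred at the origin of `ℝ^{n+2}`. -/
def curvatureSphere (n : ℕ) (δ : ℝ) : Set (EuclideanSpace ℝ (Fin (n + 2))) :=
  Metric.sphere 0 (1 / √δ)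

/-- The geodesic distance of `𝕊^{n+1}(δ)`: radius times angle. -/
def curvatureSphereDist {n : ℕ} (δ : ℝ) (x y : EuclideanSpace ℝ (Fin (n + 2))) : ℝ :=
  InnerProductGeometry.angle x y / √δ

/-- The extrinsic radius of a map into the metric space with point set `X` and distance `d`:
the infimum of the radii of the open balls of `X` that contain the image. -/
def extrinsicRadius {M V : Type*} (X : Set V) (d : V → V → ℝ) (φ : M → V) : ℝ :=
  sInf {r : ℝ | 0 < r ∧ ∃ x ∈ X, ∀ y : M, d x (φ y) < r}

/-- The immersed hypersurface `φ : M → X` is a geodesic hypersphere of radius `r`: `φ` is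
one-to-one onto a sphere `S(x, r)` of `X`.  (When `φ` is an immersion of a compact manifold this
makes `φ` a diffeomorphism from `M` onto `S(x, r)`.) -/
def IsGeodesicHypersphere {M V : Type*} (X : Set V) (d : V → V → ℝ) (φ : M → V) (r : ℝ) : Prop :=
  Function.Injective φ ∧ ∃ x ∈ X, Set.range φ = {y | y ∈ X ∧ d x y = r}

/-- The `L^p` norm of a real function. -/
def realLpNorm {M : Type*} [MeasurableSpace M] (μ : Measure M) (p : ℝ) (f : M → ℝ) : ℝ :=
  (∫ x, |f x| ^ p ∂μ) ^ (1 / p)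

/-- The vector product of `m` vectors of `ℝ^{m+1}`: the vector `N` with
`⟪v, N⟫ = det (v, w₁, …, w_m)` for all `v`. -/
def vectorProduct {m : ℕ} (w : Fin m → EuclideanSpace ℝ (Fin (m + 1))) :
    EuclideanSpace ℝ (Fin (m + 1)) :=
  WithLp.toLp 2 fun i => Matrix.det (Matrix.of fun j k : Fin (m + 1) =>
    (Fin.cons (EuclideanSpace.single i (1 : ℝ)) w :
      Fin (m + 1) → EuclideanSpace ℝ (Fin (m + 1))) j k)

section Manifold

variable {n : ℕ} {M : Type*} [TopologicalSpace M] [ChartedSpace (EuclideanSpace ℝ (Fin n)) M]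

/-- The tangent vector `∂_i` at `x`, in the preferred chart at `x`; these form a basis of
the tangent space at `x`. -/
def coordVector (x : M) (i : Fin n) : TangentSpace (𝓡 n) x :=
  (EuclideanSpace.single i (1 : ℝ) : EuclideanSpace ℝ (Fin n))

/-- The differential of a map from `M` to a normed space, with values in that space. -/
def pushforward {V : Type*} [NormedAddCommGroup V] [NormedSpace ℝ V] (φ : M → V) (x : M)
    (u : TangentSpace (𝓡 n) x) : V :=
  mfderiv (𝓡 n) 𝓘(ℝ, V) φ x u

variable (n M) in
/-- An orientation of `M`, given by smooth charts around all points such that all changes of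
charts have positive Jacobian determinant. -/
structure OrientationAtlas [IsManifold (𝓡 n) ∞ M] where
  /-- A positively oriented chart around each point. -/
  chart : M → OpenPartialHomeomorph M (EuclideanSpace ℝ (Fin n))
  chart_mem : ∀ x, chart x ∈ IsManifold.maximalAtlas (𝓡 n) ∞ M
  mem_source : ∀ x, x ∈ (chart x).source
  det_pos : ∀ x y z, z ∈ (chart x).source → z ∈ (chart y).source →
    0 < (fderiv ℝ (chart y ∘ (chart x).symm) (chart x z)).det

/-- The image under the differential of `φ` of the coordinate frame at `x` of the positively
oriented chart around `x`. -/
def OrientationAtlas.frameImage [IsManifold (𝓡 n) ∞ M] (o : OrientationAtlas n M)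
    {V : Type*} [NormedAddCommGroup V] [NormedSpace ℝ V] (φ : M → V) (x : M) (i : Fin n) : V :=
  fderiv ℝ (φ ∘ (o.chart x).symm) (o.chart x x) (EuclideanSpace.single i (1 : ℝ))

/-- The unit normal field of an oriented hypersurface of `ℝ^{n+1}`. -/
def euclideanUnitNormal [IsManifold (𝓡 n) ∞ M] (o : OrientationAtlas n M)
    (φ : M → EuclideanSpace ℝ (Fin (n + 1))) (x : M) : EuclideanSpace ℝ (Fin (n + 1)) :=
  ‖vectorProduct (o.frameImage φ x)‖⁻¹ • vectorProduct (o.frameImage φ x)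

/-- The unit normal field of an oriented hypersurface of `𝕊^{n+1}(δ) ⊆ ℝ^{n+2}`: at each point it
is tangent to the sphere and normal to the hypersurface. -/
def sphericalUnitNormal [IsManifold (𝓡 n) ∞ M] (o : OrientationAtlas n M)
    (φ : M → EuclideanSpace ℝ (Fin (n + 2))) (x : M) : EuclideanSpace ℝ (Fin (n + 2)) :=
  ‖vectorProduct (Fin.cons (φ x) (o.frameImage φ x))‖⁻¹ •
    vectorProduct (Fin.cons (φ x) (o.frameImage φ x))

/-- The second fundamental form `B(u, v) = ⟪∇_u ν, v⟫` with respect to the unit normal field `ν`.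
For a hypersurface of the sphere, the derivative of `ν` in the sphere is the projection of its
derivative in the surrounding vector space to the tangent space of the sphere, which contains
the image of `v`, so that the same formula holds. -/
def secondFundForm {V : Type*} [NormedAddCommGroup V] [InnerProductSpace ℝ V]
    (φ ν : M → V) (x : M) (u v : TangentSpace (𝓡 n) x) : ℝ :=
  inner ℝ (pushforward ν x u) (pushforward φ x v)

variable [IsManifold (𝓡 n) ∞ M]

/-- `φ` is a smooth isometric immersion of the Riemannian manifold `(M, g)`. -/
structure IsIsometricImmersion
    (g : Bundle.ContMDiffRiemannianMetric (𝓡 n) ∞ (EuclideanSpace ℝ (Fin n))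
      (TangentSpace (𝓡 n) : M → Type _))
    {V : Type*} [NormedAddCommGroup V] [InnerProductSpace ℝ V] (φ : M → V) : Prop where
  contMDiff : ContMDiff (𝓡 n) 𝓘(ℝ, V) ∞ φ
  inner_eq : ∀ (x : M) (u v : TangentSpace (𝓡 n) x),
    inner ℝ (pushforward φ x u) (pushforward φ x v) = g.inner x u v

/-- The mean curvature `H = (1/n) tr B`.  The trace is taken with respect to `g`: it is
`tr (G⁻¹ B)` for the matrices `G` and `B` of `g` and of the second fundamental form in a basis of
the tangent space. -/
def meanCurvature
    (g : Bundle.ContMDiffRiemannianMetric (𝓡 n) ∞ (EuclideanSpace ℝ (Fin n))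
      (TangentSpace (𝓡 n) : M → Type _))
    {V : Type*} [NormedAddCommGroup V] [InnerProductSpace ℝ V] (φ ν : M → V) (x : M) : ℝ :=
  (1 / (n : ℝ)) * Matrix.trace
    ((Matrix.of fun i j : Fin n => g.inner x (coordVector x i) (coordVector x j))⁻¹ *
      Matrix.of fun i j : Fin n => secondFundForm φ ν x (coordVector x i) (coordVector x j))

/-- The Riemannian density `√(det (g_ij))` in the chart `e`, at the point `y` of its target. -/
def riemannianDensity
    (g : Bundle.ContMDiffRiemannianMetric (𝓡 n) ∞ (EuclideanSpace ℝ (Fin n))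
      (TangentSpace (𝓡 n) : M → Type _))
    (e : OpenPartialHomeomorph M (EuclideanSpace ℝ (Fin n))) (y : EuclideanSpace ℝ (Fin n)) : ℝ :=
  √(Matrix.det (Matrix.of fun i j : Fin n => g.inner (e.symm y)
    (mfderiv 𝓘(ℝ, EuclideanSpace ℝ (Fin n)) (𝓡 n) e.symm y (EuclideanSpace.single i (1 : ℝ)))
    (mfderiv 𝓘(ℝ, EuclideanSpace ℝ (Fin n)) (𝓡 n) e.symm y (EuclideanSpace.single j (1 : ℝ)))))

/-- The Riemannian volume on the domain of the chart `e`, extended by zero to `M`: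
the image under `e⁻¹` of the measure `√(det (g_ij)) dy` on the target of `e`. -/
def chartVolume [MeasurableSpace M]
    (g : Bundle.ContMDiffRiemannianMetric (𝓡 n) ∞ (EuclideanSpace ℝ (Fin n))
      (TangentSpace (𝓡 n) : M → Type _))
    (e : OpenPartialHomeomorph M (EuclideanSpace ℝ (Fin n))) : Measure M :=
  Measure.map e.symm ((volume.restrict e.target).withDensity
    fun y => ENNReal.ofReal (riemannianDensity g e y))

/-- The Riemannian volume measure of `(M, g)`: the least measure that dominates the Riemannian
volume of every chart.  (The chart volumes agree on overlaps, so that this is the measure that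
restricts to the chart volume on the domain of each chart.) -/
def riemannianVolume [MeasurableSpace M]
    (g : Bundle.ContMDiffRiemannianMetric (𝓡 n) ∞ (EuclideanSpace ℝ (Fin n))
      (TangentSpace (𝓡 n) : M → Type _)) : Measure M :=
  ⨆ x : M, chartVolume g (chartAt (EuclideanSpace ℝ (Fin n)) x)

end Manifold

end

/-! Both cases rest on one Minkowski formula. Realise the space form of curvature δ as a vector
space (δ = 0) or as the sphere of radius 1/√δ in a vector space (δ > 0). Along an immersed
hypersurface Δφ = -nHν - nδφ, so the tangential part of X = φ - x₀ has divergence n(1 - δ⟨φ, X⟩ -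
H⟨ν, X⟩), and the integral of this over the closed manifold M vanishes
(`IsUnitNormal.integral_minkowskiIntegrand`).

Let x₀ be the centre of a closed ball of radius R containing the image; one exists by compactness.
For δ = 0 the formula gives V = ∫ H⟨ν, φ - x₀⟩ ≤ R ∫ |H|. For δ > 0 it reads ∫ δ⟨φ, x₀⟩ = -∫ H⟨ν,
x₀⟩. Put c = cos(√δ R) and s = sin(√δ R). Since √δ R < π/2, δ⟨φ, x₀⟩ ≥ c > 0, and since ν is
orthogonal to φ, |⟨ν, x₀⟩| ≤ s/√δ. Hence cV ≤ (s/√δ) ∫ |H|. In both cases V ≤ t_δ(R) ∫ |H|, and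
Hölder's inequality gives the bound for every p (`realLpNorm_bound`).

Equality for some p forces V = t_δ(R) ∫ |H|, and then the image lies on the distance sphere of
radius R about x₀ (`IsUnitNormal.norm_sub_eq_of_volume_eq`, `IsUnitNormal.inner_eq_of_volume_eq`).
An immersion of a compact M into a round sphere of the same dimension n ≥ 2 is a covering, and it is
injective and onto (`injective_and_range_eq_sphere`). Conversely, on a distance sphere the
tangential part of X is zero, so the Minkowski integrand vanishes pointwise; this says t_δ(R)|H| = 1
and yields equality. -/

section VectorProduct

/-! ### The vector product: orthogonality, change of frame, smoothness. -/

variable {m : ℕ}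

theorem vectorProduct_apply (w : Fin m → EuclideanSpace ℝ (Fin (m + 1))) (i : Fin (m + 1)) :
    vectorProduct w i =
      (-1) ^ (i : ℕ) * Matrix.det (Matrix.of fun j k : Fin m => w j (i.succAbove k)) := by
  have h : vectorProduct w i = Matrix.det (Matrix.of fun j k : Fin (m + 1) =>
    (Fin.cons (EuclideanSpace.single i (1 : ℝ)) w :
      Fin (m + 1) → EuclideanSpace ℝ (Fin (m + 1))) j k) := rfl
  rw [h, Matrix.det_succ_row_zero, Finset.sum_eq_single i]
  · simp only [Matrix.of_apply, Fin.cons_zero, PiLp.single_apply, if_true, mul_one]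
    rfl
  · intro b _ hb
    simp [hb]
  · simp

theorem inner_vectorProduct (v : EuclideanSpace ℝ (Fin (m + 1)))
    (w : Fin m → EuclideanSpace ℝ (Fin (m + 1))) :
    inner ℝ v (vectorProduct w) = Matrix.det (Matrix.of fun j k : Fin (m + 1) =>
      (Fin.cons v w : Fin (m + 1) → EuclideanSpace ℝ (Fin (m + 1))) j k) := by
  rw [Matrix.det_succ_row_zero, PiLp.inner_apply]
  refine Finset.sum_congr rfl fun i _ => ?_
  rw [vectorProduct_apply]
  simp only [Matrix.of_apply, Fin.cons_zero, RCLike.inner_apply, conj_trivial]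
  have : ((Matrix.of fun j k : Fin (m + 1) =>
      (Fin.cons v w : Fin (m + 1) → EuclideanSpace ℝ (Fin (m + 1))) j k).submatrix Fin.succ
        i.succAbove) = Matrix.of fun j k : Fin m => w j (i.succAbove k) := rfl
  rw [this]
  ring

theorem inner_vectorProduct_self (w : Fin m → EuclideanSpace ℝ (Fin (m + 1))) (i : Fin m) :
    inner ℝ (w i) (vectorProduct w) = 0 := by
  rw [inner_vectorProduct]
  refine Matrix.det_zero_of_row_eq (i := 0) (j := i.succ) (Fin.succ_ne_zero i).symm ?_
  ext k
  simp

/-- If `v` were outside the span, `v` and `w` would be `m + 1` independent rows, and the determinant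
`⟪v, N⟫` could not vanish. -/
theorem mem_span_of_inner_vectorProduct_eq_zero {w : Fin m → EuclideanSpace ℝ (Fin (m + 1))}
    (hw : LinearIndependent ℝ w) {v : EuclideanSpace ℝ (Fin (m + 1))}
    (hv : inner ℝ v (vectorProduct w) = 0) : v ∈ Submodule.span ℝ (Set.range w) := by
  by_contra hmem
  have hli : LinearIndependent ℝ
      (Fin.cons v w : Fin (m + 1) → EuclideanSpace ℝ (Fin (m + 1))) :=
    linearIndependent_finCons.2 ⟨hw, hmem⟩
  rw [inner_vectorProduct] at hv
  have hu : LinearIndependent ℝ (Matrix.of fun j k : Fin (m + 1) =>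
      (Fin.cons v w : Fin (m + 1) → EuclideanSpace ℝ (Fin (m + 1))) j k).row := by
    exact hli.map' (WithLp.linearEquiv 2 ℝ (Fin (m + 1) → ℝ)).toLinearMap (by simp)
  rw [Matrix.linearIndependent_rows_iff_isUnit, Matrix.isUnit_iff_isUnit_det, hv] at hu
  exact not_isUnit_zero hu

theorem vectorProduct_ne_zero {w : Fin m → EuclideanSpace ℝ (Fin (m + 1))}
    (hw : LinearIndependent ℝ w) : vectorProduct w ≠ 0 := by
  intro h
  have htop : Submodule.span ℝ (Set.range w) = ⊤ :=
    Submodule.eq_top_iff'.2 fun v => mem_span_of_inner_vectorProduct_eq_zero hw (by simp [h])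
  have := finrank_span_eq_card hw
  rw [htop, finrank_top, finrank_euclideanSpace_fin, Fintype.card_fin] at this
  omega

theorem eq_zero_of_inner_vectorProduct_eq_zero {w : Fin m → EuclideanSpace ℝ (Fin (m + 1))}
    (hw : LinearIndependent ℝ w) {v : EuclideanSpace ℝ (Fin (m + 1))}
    (hv : inner ℝ v (vectorProduct w) = 0) (hvw : ∀ i, inner ℝ v (w i) = 0) : v = 0 := by
  have hmem := mem_span_of_inner_vectorProduct_eq_zero hw hv
  have hle : Submodule.span ℝ (Set.range w) ≤ (Submodule.span ℝ {v})ᗮ := by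
    rw [Submodule.span_le]
    rintro _ ⟨i, rfl⟩
    exact Submodule.mem_orthogonal_singleton_iff_inner_right.2 (hvw i)
  exact inner_self_eq_zero.1 (Submodule.mem_orthogonal_singleton_iff_inner_right.1 (hle hmem))

/-- After normalisation only the sign of `A.det` matters; this makes the unit normal independent of
the choice of oriented chart. -/
theorem vectorProduct_sum_smul (A : Matrix (Fin m) (Fin m) ℝ)
    (w : Fin m → EuclideanSpace ℝ (Fin (m + 1))) :
    vectorProduct (fun i => ∑ j, A i j • w j) = A.det • vectorProduct w := by
  ext i
  rw [PiLp.smul_apply, vectorProduct_apply, vectorProduct_apply, smul_eq_mul, mul_left_comm,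
    ← Matrix.det_mul]
  congr 2
  ext j k
  simp [Matrix.mul_apply]

theorem vectorProduct_cons_sum_smul {m : ℕ} (A : Matrix (Fin m) (Fin m) ℝ)
    (v : EuclideanSpace ℝ (Fin (m + 2))) (w : Fin m → EuclideanSpace ℝ (Fin (m + 2))) :
    vectorProduct (Fin.cons v fun i => ∑ j, A i j • w j) =
      A.det • vectorProduct (Fin.cons v w) := by
  -- `B` is the block matrix diag(1, A): it keeps `v` and recombines `w`.
  let B : Matrix (Fin (m + 1)) (Fin (m + 1)) ℝ := Matrix.of
    (Fin.cons (Fin.cons 1 0) fun i => Fin.cons 0 (A i) : Fin (m + 1) → Fin (m + 1) → ℝ)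
  have hB : B.det = A.det := by
    rw [Matrix.det_succ_column_zero, Fin.sum_univ_succ]
    simp [B]
    rfl
  rw [← hB, ← vectorProduct_sum_smul]
  congr 1
  ext i : 1
  refine Fin.cases ?_ (fun i => ?_) i
  · simp [B, Fin.sum_univ_succ]
  · simp [B, Fin.sum_univ_succ]

theorem ContDiffAt.matrix_det {ι E : Type*} [Fintype ι] [DecidableEq ι] [NormedAddCommGroup E]
    [NormedSpace ℝ E] {k : WithTop ℕ∞} {A : E → Matrix ι ι ℝ} {y : E}
    (hA : ∀ i j, ContDiffAt ℝ k (fun z => A z i j) y) :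
    ContDiffAt ℝ k (fun z => (A z).det) y := by
  simp only [Matrix.det_apply]
  exact ContDiffAt.sum fun σ _ => (contDiffAt_prod fun i _ => hA _ _).const_smul _

theorem ContDiffAt.matrix_adjugate {ι E : Type*} [Fintype ι] [DecidableEq ι]
    [NormedAddCommGroup E] [NormedSpace ℝ E] {k : WithTop ℕ∞} {A : E → Matrix ι ι ℝ} {y : E}
    (hA : ∀ i j, ContDiffAt ℝ k (fun z => A z i j) y) (i j : ι) :
    ContDiffAt ℝ k (fun z => (A z).adjugate i j) y := by
  simp only [Matrix.adjugate_apply]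
  refine ContDiffAt.matrix_det fun a b => ?_
  by_cases h : a = j
  · subst h
    simpa using contDiffAt_const
  · simpa [Matrix.updateRow_ne h] using hA a b

theorem ContDiffAt.vectorProduct {E : Type*} [NormedAddCommGroup E] [NormedSpace ℝ E]
    {k : WithTop ℕ∞} {w : E → Fin m → EuclideanSpace ℝ (Fin (m + 1))} {y : E}
    (hw : ∀ i, ContDiffAt ℝ k (fun z => w z i) y) :
    ContDiffAt ℝ k (fun z => vectorProduct (w z)) y := by
  rw [contDiffAt_euclidean]
  intro i
  simp only [vectorProduct_apply]
  exact contDiffAt_const.mul (ContDiffAt.matrix_det fun a b => contDiffAt_euclidean.1 (hw a) _)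

end VectorProduct

/-! ### Derivative of a determinant. -/

section Jacobi

variable {ι E : Type*} [Fintype ι] [DecidableEq ι] [NormedAddCommGroup E] [NormedSpace ℝ E]

/-- Jacobi's formula for the derivative of a determinant. -/
theorem hasFDerivAt_matrix_det {A : E → Matrix ι ι ℝ} {A' : ι → ι → E →L[ℝ] ℝ} {y : E}
    (hA : ∀ i j, HasFDerivAt (fun z => A z i j) (A' i j) y) :
    HasFDerivAt (fun z => (A z).det) (∑ i, ∑ j, (A y).adjugate j i • A' i j) y := by
  -- The determinant is multilinear in the rows, so its derivative replaces one row at a time;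
  -- Cramer's rule evaluates each of these determinants through the adjugate.
  let D : ContinuousMultilinearMap ℝ (fun _ : ι => ι → ℝ) ℝ :=
    ⟨Matrix.detRowAlternating.toMultilinearMap, by
      change Continuous fun B : ι → ι → ℝ => Matrix.det (Matrix.of B)
      exact Continuous.matrix_det continuous_id⟩
  have hpi : HasFDerivAt (fun z => (fun i j => A z i j : ι → ι → ℝ))
      (ContinuousLinearMap.pi fun i => ContinuousLinearMap.pi fun j => A' i j) y :=
    hasFDerivAt_pi.2 fun i => hasFDerivAt_pi.2 fun j => hA i j
  have h := (D.hasFDerivAt (fun i j => A y i j)).comp y hpi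
  refine h.congr_fderiv ?_
  ext u
  simp only [ContinuousLinearMap.comp_apply, ContinuousMultilinearMap.linearDeriv_apply,
    sum_apply, smul_apply, ContinuousLinearMap.pi_apply,
    smul_eq_mul]
  refine Finset.sum_congr rfl fun i _ => ?_
  change ((A y).updateRow i fun j => A' i j u).det = _
  rw [← Matrix.cramer_transpose_apply, Matrix.cramer_eq_adjugate_mulVec,
    ← Matrix.adjugate_transpose]
  rfl

end Jacobi

/-! ### The divergence of the tangential part of the position vector, in coordinates. -/

noncomputable section

variable {n : ℕ} {V : Type*} [NormedAddCommGroup V] [InnerProductSpace ℝ V]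

/-- The partial derivative `∂_i ψ`. -/
def partialDeriv (ψ : EuclideanSpace ℝ (Fin n) → V) (y : EuclideanSpace ℝ (Fin n))
    (i : Fin n) : V :=
  fderiv ℝ ψ y (EuclideanSpace.single i (1 : ℝ))

/-- The matrix of the inner products `⟪∂_i χ, ∂_j ψ⟫`. -/
def pairingMatrix (ψ χ : EuclideanSpace ℝ (Fin n) → V) (y : EuclideanSpace ℝ (Fin n)) :
    Matrix (Fin n) (Fin n) ℝ :=
  Matrix.of fun i j => inner ℝ (partialDeriv χ y i) (partialDeriv ψ y j)

theorem pairingMatrix_self_isSymm (ψ : EuclideanSpace ℝ (Fin n) → V)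
    (y : EuclideanSpace ℝ (Fin n)) : (pairingMatrix ψ ψ y).IsSymm := by
  ext i j
  exact real_inner_comm _ _

theorem pairingMatrix_self_det_pos {ψ : EuclideanSpace ℝ (Fin n) → V}
    {y : EuclideanSpace ℝ (Fin n)} (h : LinearIndependent ℝ (partialDeriv ψ y)) :
    0 < (pairingMatrix ψ ψ y).det :=
  (Matrix.posDef_gram_iff_linearIndependent.2 h).det_pos

theorem contDiffAt_partialDeriv {ψ : EuclideanSpace ℝ (Fin n) → V}
    {y : EuclideanSpace ℝ (Fin n)} (h : ContDiffAt ℝ ∞ ψ y) (i : Fin n) :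
    ContDiffAt ℝ ∞ (fun z => partialDeriv ψ z i) y :=
  (h.fderiv_right (m := ∞) (by simp)).clm_apply contDiffAt_const

theorem contDiffAt_pairingMatrix {ψ χ : EuclideanSpace ℝ (Fin n) → V}
    {y : EuclideanSpace ℝ (Fin n)} (hψ : ContDiffAt ℝ ∞ ψ y) (hχ : ContDiffAt ℝ ∞ χ y)
    (i j : Fin n) : ContDiffAt ℝ ∞ (fun z => pairingMatrix ψ χ z i j) y :=
  (contDiffAt_partialDeriv hχ i).inner ℝ (contDiffAt_partialDeriv hψ j)

theorem ContDiffAt.matrix_inv {ι E : Type*} [Fintype ι] [DecidableEq ι] [NormedAddCommGroup E]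
    [NormedSpace ℝ E] {k : WithTop ℕ∞} {A : E → Matrix ι ι ℝ} {y : E}
    (hA : ∀ i j, ContDiffAt ℝ k (fun z => A z i j) y) (h : (A y).det ≠ 0) (i j : ι) :
    ContDiffAt ℝ k (fun z => (A z)⁻¹ i j) y := by
  have : (fun z => (A z)⁻¹ i j) = fun z => (A z).det⁻¹ * (A z).adjugate i j := by
    ext z
    simp [Matrix.inv_def]
  rw [this]
  exact ((ContDiffAt.matrix_det hA).inv h).mul (ContDiffAt.matrix_adjugate hA i j)

/-- The density `√(det ⟪∂_i ψ, ∂_j ψ⟫)` of the metric induced by `ψ`. -/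
def gramDensity (ψ : EuclideanSpace ℝ (Fin n) → V) (y : EuclideanSpace ℝ (Fin n)) : ℝ :=
  √(pairingMatrix ψ ψ y).det

theorem gramDensity_nonneg (ψ : EuclideanSpace ℝ (Fin n) → V)
    (y : EuclideanSpace ℝ (Fin n)) : 0 ≤ gramDensity ψ y :=
  Real.sqrt_nonneg _

theorem gramDensity_pos {ψ : EuclideanSpace ℝ (Fin n) → V}
    {y : EuclideanSpace ℝ (Fin n)} (h : LinearIndependent ℝ (partialDeriv ψ y)) :
    0 < gramDensity ψ y :=
  Real.sqrt_pos.2 (pairingMatrix_self_det_pos h)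

theorem contDiffAt_gramDensity {ψ : EuclideanSpace ℝ (Fin n) → V}
    {y : EuclideanSpace ℝ (Fin n)} (hψ : ContDiffAt ℝ ∞ ψ y)
    (h : LinearIndependent ℝ (partialDeriv ψ y)) : ContDiffAt ℝ ∞ (gramDensity ψ) y :=
  (ContDiffAt.matrix_det (contDiffAt_pairingMatrix hψ hψ)).sqrt (pairingMatrix_self_det_pos h).ne'

/-- The coefficients, in the frame `∂_i ψ`, of the tangential component of `X`. -/
def tangentialCoeff (ψ : EuclideanSpace ℝ (Fin n) → V) (X : V) (y : EuclideanSpace ℝ (Fin n))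
    (i : Fin n) : ℝ :=
  ∑ j, (pairingMatrix ψ ψ y)⁻¹ i j * inner ℝ (partialDeriv ψ y j) X

theorem contDiffAt_tangentialCoeff {ψ X : EuclideanSpace ℝ (Fin n) → V}
    {y : EuclideanSpace ℝ (Fin n)} (hψ : ContDiffAt ℝ ∞ ψ y) (hX : ContDiffAt ℝ ∞ X y)
    (h : LinearIndependent ℝ (partialDeriv ψ y)) (i : Fin n) :
    ContDiffAt ℝ ∞ (fun z => tangentialCoeff ψ (X z) z i) y :=
  ContDiffAt.sum fun j _ => (ContDiffAt.matrix_inv (contDiffAt_pairingMatrix hψ hψ)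
    (pairingMatrix_self_det_pos h).ne' i j).mul ((contDiffAt_partialDeriv hψ j).inner ℝ hX)

/-- The algebraic part of the computation of the divergence of the tangential component of the
position vector. -/
theorem tangential_divergence_algebra {G P : Matrix (Fin n) (Fin n) ℝ} {W δ : ℝ}
    {A : Fin n → V} {dA : Fin n → Fin n → V} {ν ψ X : V} {dν : Fin n → V}
    {dP : Fin n → Fin n → Fin n → ℝ} {dW : Fin n → ℝ}
    (hG : ∀ i j, G i j = inner ℝ (A i) (A j)) (hPG : P * G = 1) (hPs : P.IsSymm)
    (hsym : ∀ i j, dA i j = dA j i)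
    (hdP : ∀ i k l, ∑ j, (dP i j l * G j k +
      W * P i j * (inner ℝ (A j) (dA k l) + inner ℝ (dA j l) (A k))) = if i = k then dW l else 0)
    (hdW : ∀ k, dW k = W / 2 * ∑ i, ∑ j, P j i *
      (inner ℝ (A i) (dA j k) + inner ℝ (dA i k) (A j)))
    (hνA : ∀ i, inner ℝ ν (A i) = 0) (hν : ‖ν‖ = 1)
    (hdν : ∀ i j, inner ℝ ν (dA j i) + inner ℝ (dν i) (A j) = 0)
    (hδ : δ ≠ 0 → δ * inner ℝ ψ ψ = 1 ∧ inner ℝ ψ ν = 0 ∧ (∀ i, inner ℝ ψ (A i) = 0) ∧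
      ∀ i j, inner ℝ ψ (dA j i) + inner ℝ (A i) (A j) = 0)
    (hspan : ∀ z, (∀ i, inner ℝ z (A i) = 0) → inner ℝ z ν = 0 →
      (δ ≠ 0 → inner ℝ z ψ = 0) → z = 0) :
    ∑ i, ∑ j, (dP i j i * inner ℝ (A j) X + W * P i j * (inner ℝ (A j) (A i) +
        inner ℝ (dA j i) X)) =
      n * W * (1 - δ * inner ℝ ψ X) -
        W * (P * Matrix.of fun i j => inner ℝ (dν i) (A j)).trace * inner ℝ ν X := by
  set t := (P * Matrix.of fun i j => inner ℝ (dν i) (A j)).trace with ht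
  have ht' : t = ∑ i, ∑ j, P i j * inner ℝ (dν i) (A j) := by
    simp only [ht, Matrix.trace, Matrix.diag, Matrix.mul_apply, Matrix.of_apply]
    rw [Finset.sum_comm]
    exact Finset.sum_congr rfl fun i _ => Finset.sum_congr rfl fun j _ => by rw [hPs.apply]
  have htrace : ∑ i, ∑ j, P i j * inner ℝ (A j) (A i) = n := by
    have := congrArg Matrix.trace hPG
    simpa [Matrix.trace, Matrix.mul_apply, hG] using this
  -- `A j` stands for ∂_jψ, `dA i j` for ∂_j∂_iψ, and `dP i j l` for ∂_l(W P_ij), with the density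
  -- included. So `Z` is ∑ ∂_i(W P_ij ∂_jψ) = W Δψ, and it is determined by its products with the `A
  -- k`, `ν` and, if δ ≠ 0, `ψ`.
  set Z : V := ∑ i, ∑ j, (dP i j i • A j + (W * P i j) • dA j i) with hZ
  have hZin : ∀ x, inner ℝ Z x =
      ∑ i, ∑ j, (dP i j i * inner ℝ (A j) x + W * P i j * inner ℝ (dA j i) x) := fun x => by
    simp [hZ, sum_inner, inner_add_left, inner_smul_left]
  -- Taking `l = i` in `hdP` and summing over `i` gives a formula for ∂_kW; comparing it with
  -- Jacobi's formula `hdW` leaves exactly ⟪Z, A k⟫ = 0.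
  have hZA : ∀ k, inner ℝ Z (A k) = 0 := fun k => by
    have h1 : ∑ i, ∑ j, (dP i j i * G j k +
      W * P i j * (inner ℝ (A j) (dA k i) + inner ℝ (dA j i) (A k))) = dW k := by
      simp [hdP]
    have h2 : dW k = ∑ i, ∑ j, W * P i j * inner ℝ (A j) (dA k i) := by
      have e1 : ∑ i, ∑ j, P j i * inner ℝ (dA i k) (A j) =
          ∑ i, ∑ j, P i j * inner ℝ (A j) (dA k i) :=
        Finset.sum_congr rfl fun i _ => Finset.sum_congr rfl fun j _ => by
          rw [hPs.apply, real_inner_comm, hsym]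
      have e2 : ∑ i, ∑ j, P j i * inner ℝ (A i) (dA j k) =
          ∑ i, ∑ j, P i j * inner ℝ (A j) (dA k i) := by
        rw [Finset.sum_comm]
        exact Finset.sum_congr rfl fun i _ => Finset.sum_congr rfl fun j _ => by
          rw [hPs.apply, hsym, hPs.apply]
      rw [hdW]
      simp only [mul_add, Finset.sum_add_distrib, e1, e2, mul_assoc, ← Finset.mul_sum]
      ring
    rw [h2] at h1
    rw [hZin]
    simp only [mul_add, Finset.sum_add_distrib, hG] at h1 ⊢
    linarith
  have hZν : inner ℝ Z ν = -(W * t) := by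
    rw [hZin, ht', Finset.mul_sum, ← Finset.sum_neg_distrib]
    refine Finset.sum_congr rfl fun i _ => ?_
    rw [Finset.mul_sum, ← Finset.sum_neg_distrib]
    refine Finset.sum_congr rfl fun j _ => ?_
    rw [real_inner_comm, hνA, real_inner_comm]
    linear_combination (W * P i j) * hdν i j
  have hZψ : δ ≠ 0 → inner ℝ Z ψ = -(W * n) := fun h => by
    obtain ⟨-, -, h3, h4⟩ := hδ h
    rw [hZin, ← htrace, Finset.mul_sum, ← Finset.sum_neg_distrib]
    refine Finset.sum_congr rfl fun i _ => ?_
    rw [Finset.mul_sum, ← Finset.sum_neg_distrib]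
    refine Finset.sum_congr rfl fun j _ => ?_
    rw [real_inner_comm, h3, real_inner_comm, real_inner_comm (A i) (A j)]
    linear_combination (W * P i j) * h4 i j
  -- This is Δψ = -tν - nδψ.
  have hZ0 : Z + (W * t) • ν + (δ * (W * n)) • ψ = 0 := by
    apply hspan
    · intro i
      by_cases h : δ = 0
      · simp [inner_add_left, inner_smul_left, hZA, hνA, h]
      · simp [inner_add_left, inner_smul_left, hZA, hνA, (hδ h).2.2.1]
    · by_cases h : δ = 0
      · simp [inner_add_left, inner_smul_left, hZν, h, hν]
      · simp [inner_add_left, inner_smul_left, hZν, (hδ h).2.1, hν]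
    · intro h
      have := (hδ h).1
      rw [inner_add_left, inner_add_left, hZψ h, inner_smul_left, inner_smul_left,
        real_inner_comm, (hδ h).2.1]
      simp only [conj_trivial]
      linear_combination (W * n) * this
  have hZX : inner ℝ Z X = -(W * t) * inner ℝ ν X - δ * (W * n) * inner ℝ ψ X := by
    have := congrArg (fun z => inner ℝ z X) hZ0
    simp only [inner_add_left, inner_smul_left, inner_zero_left, conj_trivial] at this
    linarith
  have : ∑ i, ∑ j, (dP i j i * inner ℝ (A j) X + W * P i j * (inner ℝ (A j) (A i) +
        inner ℝ (dA j i) X)) = inner ℝ Z X + W * ∑ i, ∑ j, P i j * inner ℝ (A j) (A i) := by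
    rw [hZin, Finset.mul_sum, ← Finset.sum_add_distrib]
    refine Finset.sum_congr rfl fun i _ => ?_
    rw [Finset.mul_sum, ← Finset.sum_add_distrib]
    refine Finset.sum_congr rfl fun j _ => ?_
    ring
  rw [this, hZX, htrace]
  ring

theorem hasFDerivAt_pairingMatrix {ψ χ : EuclideanSpace ℝ (Fin n) → V}
    {y : EuclideanSpace ℝ (Fin n)} (hψ : ContDiffAt ℝ ∞ ψ y) (hχ : ContDiffAt ℝ ∞ χ y)
    (i j l : Fin n) :
    fderiv ℝ (fun z => pairingMatrix ψ χ z i j) y (EuclideanSpace.single l (1 : ℝ)) =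
      inner ℝ (partialDeriv χ y i) (partialDeriv (fun z => partialDeriv ψ z j) y l) +
        inner ℝ (partialDeriv (fun z => partialDeriv χ z i) y l) (partialDeriv ψ y j) :=
  fderiv_inner_apply ℝ ((contDiffAt_partialDeriv hχ i).differentiableAt (by simp))
    ((contDiffAt_partialDeriv hψ j).differentiableAt (by simp)) _

theorem partialDeriv_partialDeriv_comm {ψ : EuclideanSpace ℝ (Fin n) → V}
    {y : EuclideanSpace ℝ (Fin n)} (hψ : ContDiffAt ℝ ∞ ψ y) (i j : Fin n) :
    partialDeriv (fun z => partialDeriv ψ z i) y j =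
      partialDeriv (fun z => partialDeriv ψ z j) y i := by
  have hd : DifferentiableAt ℝ (fderiv ℝ ψ) y :=
    (hψ.fderiv_right (m := ∞) (by simp)).differentiableAt (by simp)
  have h : ∀ i j, partialDeriv (fun z => partialDeriv ψ z i) y j =
      fderiv ℝ (fderiv ℝ ψ) y (EuclideanSpace.single j 1) (EuclideanSpace.single i 1) := by
    intro i j
    simp only [partialDeriv]
    rw [fderiv_clm_apply hd (differentiableAt_const _)]
    simp
  rw [h, h]
  exact hψ.isSymmSndFDerivAt (by simp; exact WithTop.coe_le_coe.2 le_top) _ _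

/-- The divergence of the tangential component of the position vector `ψ - x₀` of a hypersurface
`ψ` with unit normal `ν`, in local coordinates. -/
theorem divergence_tangentialCoeff {ψ ν : EuclideanSpace ℝ (Fin n) → V} {δ : ℝ} (x₀ : V)
    {y : EuclideanSpace ℝ (Fin n)} (hψ : ContDiffAt ℝ ∞ ψ y) (hν : ContDiffAt ℝ ∞ ν y)
    (hli : LinearIndependent ℝ (partialDeriv ψ y)) (hν1 : ‖ν y‖ = 1)
    (hνψ : ∀ᶠ z in nhds y, ∀ i, inner ℝ (ν z) (partialDeriv ψ z i) = 0)
    (hδ : δ ≠ 0 → δ * inner ℝ (ψ y) (ψ y) = 1 ∧ inner ℝ (ψ y) (ν y) = 0 ∧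
      ∀ᶠ z in nhds y, ∀ i, inner ℝ (ψ z) (partialDeriv ψ z i) = 0)
    (hspan : ∀ z, (∀ i, inner ℝ z (partialDeriv ψ y i) = 0) → inner ℝ z (ν y) = 0 →
      (δ ≠ 0 → inner ℝ z (ψ y) = 0) → z = 0) :
    ∑ i, fderiv ℝ (fun z => gramDensity ψ z * tangentialCoeff ψ (ψ z - x₀) z i) y
        (EuclideanSpace.single i (1 : ℝ)) =
      n * gramDensity ψ y * (1 - δ * inner ℝ (ψ y) (ψ y - x₀)) -
        gramDensity ψ y * ((pairingMatrix ψ ψ y)⁻¹ * pairingMatrix ψ ν y).trace *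
          inner ℝ (ν y) (ψ y - x₀) := by
  have hdet := pairingMatrix_self_det_pos hli
  have hψd : DifferentiableAt ℝ ψ y := hψ.differentiableAt (by simp)
  have hνd : DifferentiableAt ℝ ν y := hν.differentiableAt (by simp)
  have hAd : ∀ j, DifferentiableAt ℝ (fun z => partialDeriv ψ z j) y := fun j =>
    (contDiffAt_partialDeriv hψ j).differentiableAt (by simp)
  have hGd : ∀ i j, DifferentiableAt ℝ (fun z => pairingMatrix ψ ψ z i j) y := fun i j =>
    (contDiffAt_pairingMatrix hψ hψ i j).differentiableAt (by simp)
  have hWd : DifferentiableAt ℝ (gramDensity ψ) y :=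
    (contDiffAt_gramDensity hψ hli).differentiableAt (by simp)
  have hPd : ∀ i j, DifferentiableAt ℝ (fun z => (pairingMatrix ψ ψ z)⁻¹ i j) y := fun i j =>
    (ContDiffAt.matrix_inv (contDiffAt_pairingMatrix hψ hψ) hdet.ne' i j).differentiableAt
      (by simp)
  have hWPd : ∀ i j,
      DifferentiableAt ℝ (fun z => gramDensity ψ z * (pairingMatrix ψ ψ z)⁻¹ i j) y :=
    fun i j => hWd.mul (hPd i j)
  have hunit : ∀ᶠ z in nhds y, (pairingMatrix ψ ψ z)⁻¹ * pairingMatrix ψ ψ z = 1 := by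
    have hc : ContinuousAt (fun z => (pairingMatrix ψ ψ z).det) y :=
      (ContDiffAt.matrix_det (contDiffAt_pairingMatrix hψ hψ)).continuousAt
    filter_upwards [hc.eventually_ne hdet.ne'] with z hz
    exact Matrix.nonsing_inv_mul _ (isUnit_iff_ne_zero.2 hz)
  have hmain := tangential_divergence_algebra (G := pairingMatrix ψ ψ y)
    (P := (pairingMatrix ψ ψ y)⁻¹) (W := gramDensity ψ y) (δ := δ) (A := partialDeriv ψ y)
    (dA := fun i j => partialDeriv (fun z => partialDeriv ψ z i) y j)
    (ν := ν y) (ψ := ψ y) (X := ψ y - x₀) (dν := partialDeriv ν y)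
    (dP := fun i j l => fderiv ℝ (fun z => gramDensity ψ z * (pairingMatrix ψ ψ z)⁻¹ i j) y
      (EuclideanSpace.single l (1 : ℝ)))
    (dW := fun l => fderiv ℝ (gramDensity ψ) y (EuclideanSpace.single l (1 : ℝ)))
    (fun i j => rfl) (hunit.self_of_nhds)
    (by
      rw [Matrix.IsSymm, Matrix.transpose_nonsing_inv, pairingMatrix_self_isSymm])
    (fun i j => partialDeriv_partialDeriv_comm hψ i j) ?_ ?_ (hνψ.self_of_nhds) hν1 ?_ ?_ hspan
  · rw [show pairingMatrix ψ ν y =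
      Matrix.of fun i j => inner ℝ (partialDeriv ν y i) (partialDeriv ψ y j) from rfl, ← hmain]
    refine Finset.sum_congr rfl fun i _ => ?_
    have : (fun z => gramDensity ψ z * tangentialCoeff ψ (ψ z - x₀) z i) = fun z =>
        ∑ j, (gramDensity ψ z * (pairingMatrix ψ ψ z)⁻¹ i j) *
          inner ℝ (partialDeriv ψ z j) (ψ z - x₀) := by
      ext z
      simp only [tangentialCoeff, Finset.mul_sum, mul_assoc]
    rw [this, fderiv_fun_sum fun j _ => (hWPd i j).fun_mul ((hAd j).inner ℝ (hψd.sub_const x₀)),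
      sum_apply]
    refine Finset.sum_congr rfl fun j _ => ?_
    rw [fderiv_fun_mul (hWPd i j) ((hAd j).inner ℝ (hψd.sub_const x₀)), add_apply, smul_apply,
      smul_apply, fderiv_inner_apply ℝ (hAd j) (hψd.sub_const x₀), fderiv_sub_const]
    simp only [smul_eq_mul, partialDeriv]
    ring
  · intro i k l
    -- The identity W P G = W holds near `y` and is differentiated in direction `l`.
    have h : (fun z => ∑ j, (gramDensity ψ z * (pairingMatrix ψ ψ z)⁻¹ i j) *
        pairingMatrix ψ ψ z j k) =ᶠ[nhds y] fun z => if i = k then gramDensity ψ z else 0 := by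
      filter_upwards [hunit] with z hz
      have := congrFun (congrFun hz i) k
      rw [Matrix.mul_apply, Matrix.one_apply] at this
      simp only [mul_assoc, ← Finset.mul_sum, this]
      simp
    have h' := DFunLike.congr_fun (h.fderiv_eq (𝕜 := ℝ)) (EuclideanSpace.single l (1 : ℝ))
    rw [fderiv_fun_sum fun j _ => (hWPd i j).fun_mul (hGd j k), sum_apply] at h'
    convert h' using 1
    · refine Finset.sum_congr rfl fun j _ => ?_
      rw [fderiv_fun_mul (hWPd i j) (hGd j k), add_apply, smul_apply,
        smul_apply, hasFDerivAt_pairingMatrix hψ hψ]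
      simp only [smul_eq_mul]
      ring
    · by_cases hik : i = k <;> simp [hik]
  · intro k
    have h := ((hasFDerivAt_matrix_det fun i j => (hGd i j).hasFDerivAt).sqrt hdet.ne').fderiv
    change fderiv ℝ (gramDensity ψ) y = _ at h
    rw [h]
    simp only [smul_apply, sum_apply, smul_eq_mul, hasFDerivAt_pairingMatrix hψ hψ,
      Matrix.inv_def, Matrix.smul_apply, Ring.inverse_eq_inv', Finset.mul_sum]
    refine Finset.sum_congr rfl fun i _ => Finset.sum_congr rfl fun j _ => ?_
    have hs : gramDensity ψ y / 2 * (pairingMatrix ψ ψ y).det⁻¹ =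
        1 / (2 * √(pairingMatrix ψ ψ y).det) := by
      have h0 := Real.sqrt_pos.2 hdet
      rw [gramDensity]
      nth_rewrite 2 [← Real.sq_sqrt hdet.le]
      field_simp
    rw [← hs]
    ring
  · intro i j
    -- Differentiating ⟪ν, ∂_jψ⟫ = 0 trades derivatives of ν for second derivatives of ψ; this needs
    -- the orthogonality in a whole neighbourhood.
    have h : (fun z => inner ℝ (ν z) (partialDeriv ψ z j)) =ᶠ[nhds y] fun _ => (0 : ℝ) :=
      hνψ.mono fun z hz => hz j
    have h' := DFunLike.congr_fun (h.fderiv_eq (𝕜 := ℝ)) (EuclideanSpace.single i (1 : ℝ))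
    simp only [fderiv_inner_apply ℝ hνd (hAd j)] at h'
    exact h'.trans (by simp)
  · intro h0
    obtain ⟨h1, h2, h3⟩ := hδ h0
    refine ⟨h1, h2, h3.self_of_nhds, fun i j => ?_⟩
    have h : (fun z => inner ℝ (ψ z) (partialDeriv ψ z j)) =ᶠ[nhds y] fun _ => (0 : ℝ) :=
      h3.mono fun z hz => hz j
    have h' := DFunLike.congr_fun (h.fderiv_eq (𝕜 := ℝ)) (EuclideanSpace.single i (1 : ℝ))
    simp only [fderiv_inner_apply ℝ hψd (hAd j)] at h'
    exact h'.trans (by simp)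

theorem inner_fderiv_eq_zero_of_norm_eq {E : Type*} [NormedAddCommGroup E] [NormedSpace ℝ E]
    {ψ : E → V} {y : E} (hψ : DifferentiableAt ℝ ψ y) {c : V} {r : ℝ}
    (hr : ∀ᶠ z in nhds y, ‖ψ z - c‖ = r) (v : E) :
    inner ℝ (fderiv ℝ ψ y v) (ψ y - c) = 0 := by
  have hd : DifferentiableAt ℝ (fun w => ψ w - c) y := hψ.sub_const c
  have hc : (fun w => inner ℝ (ψ w - c) (ψ w - c)) =ᶠ[nhds y] fun _ => r ^ 2 := by
    filter_upwards [hr] with w hw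
    rw [real_inner_self_eq_norm_sq, hw]
  have h1 := DFunLike.congr_fun (hc.fderiv_eq (𝕜 := ℝ)) v
  rw [fderiv_inner_apply ℝ hd hd, fderiv_fun_const, fderiv_sub_const, real_inner_comm] at h1
  simp only [Pi.zero_apply, zero_apply] at h1
  linarith

/-! ### Behaviour of Gram matrices under a change of coordinates. -/

section ChangeOfCoordinates

variable {n : ℕ} {V : Type*} [NormedAddCommGroup V] [InnerProductSpace ℝ V]

/-- The matrix of an endomorphism of `ℝⁿ` in the standard basis. -/
def standardMatrix (T : EuclideanSpace ℝ (Fin n) →L[ℝ] EuclideanSpace ℝ (Fin n)) :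
    Matrix (Fin n) (Fin n) ℝ :=
  Matrix.of fun i j => T (EuclideanSpace.single j (1 : ℝ)) i

theorem standardMatrix_det (T : EuclideanSpace ℝ (Fin n) →L[ℝ] EuclideanSpace ℝ (Fin n)) :
    (standardMatrix T).det = T.det := by
  have : standardMatrix T = LinearMap.toMatrix (PiLp.basisFun 2 ℝ (Fin n))
      (PiLp.basisFun 2 ℝ (Fin n)) (T : EuclideanSpace ℝ (Fin n) →ₗ[ℝ] EuclideanSpace ℝ (Fin n)) := by
    ext i j
    simp [standardMatrix, LinearMap.toMatrix_apply, PiLp.basisFun_apply]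
  rw [this, LinearMap.det_toMatrix]

theorem EuclideanSpace.eq_sum_smul_single (v : EuclideanSpace ℝ (Fin n)) :
    v = ∑ j, v j • EuclideanSpace.single j (1 : ℝ) := by
  ext i
  simp [Pi.single_apply]

theorem map_standardMatrix {F : Type*} [NormedAddCommGroup F] [NormedSpace ℝ F]
    (L : EuclideanSpace ℝ (Fin n) →L[ℝ] F)
    (T : EuclideanSpace ℝ (Fin n) →L[ℝ] EuclideanSpace ℝ (Fin n)) (i : Fin n) :
    L (T (EuclideanSpace.single i (1 : ℝ))) =
      ∑ j, (standardMatrix T).transpose i j • L (EuclideanSpace.single j (1 : ℝ)) := by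
  conv_lhs => rw [EuclideanSpace.eq_sum_smul_single (T (EuclideanSpace.single i (1 : ℝ)))]
  simp [standardMatrix]

theorem inner_matrix_comp (L K : EuclideanSpace ℝ (Fin n) →L[ℝ] V)
    (T : EuclideanSpace ℝ (Fin n) →L[ℝ] EuclideanSpace ℝ (Fin n)) :
    (Matrix.of fun i j : Fin n => (inner ℝ (L (T (EuclideanSpace.single i (1 : ℝ))))
      (K (T (EuclideanSpace.single j (1 : ℝ)))) : ℝ)) =
      (standardMatrix T).transpose * (Matrix.of fun i j : Fin n =>
        (inner ℝ (L (EuclideanSpace.single i (1 : ℝ))) (K (EuclideanSpace.single j (1 : ℝ))) : ℝ)) *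
        standardMatrix T := by
  ext i j
  rw [Matrix.of_apply, map_standardMatrix L, map_standardMatrix K, Matrix.mul_apply]
  simp only [sum_inner, inner_sum, inner_smul_left, inner_smul_right, Matrix.mul_apply,
    Matrix.of_apply, conj_trivial, Finset.sum_mul]
  refine Finset.sum_congr rfl fun k _ => ?_
  rw [Finset.mul_sum]
  refine Finset.sum_congr rfl fun l _ => ?_
  rw [Matrix.transpose_apply (standardMatrix T) j k]
  ring

/-- The trace of one bilinear form with respect to another does not depend on the basis, so the mean
curvature may be computed in any chart. -/
theorem trace_inv_mul_conj {Q G B : Matrix (Fin n) (Fin n) ℝ} (hQ : Q.det ≠ 0) :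
    ((Q.transpose * G * Q)⁻¹ * (Q.transpose * B * Q)).trace = (G⁻¹ * B).trace := by
  have hu : IsUnit Q.det := isUnit_iff_ne_zero.2 hQ
  have hu' : IsUnit Q.transpose.det := by rwa [Matrix.det_transpose]
  rw [Matrix.mul_inv_rev, Matrix.mul_inv_rev, Matrix.trace_mul_comm]
  calc (Q.transpose * B * Q * (Q⁻¹ * (G⁻¹ * Q.transpose⁻¹))).trace
      = (Q.transpose * (B * (Q * Q⁻¹) * G⁻¹ * Q.transpose⁻¹)).trace := by
        simp only [Matrix.mul_assoc]
    _ = (B * G⁻¹ * (Q.transpose⁻¹ * Q.transpose)).trace := by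
        rw [Matrix.mul_nonsing_inv _ hu, Matrix.trace_mul_comm, Matrix.mul_one, Matrix.mul_assoc]
    _ = (G⁻¹ * B).trace := by
        rw [Matrix.nonsing_inv_mul _ hu', Matrix.mul_one, Matrix.trace_mul_comm]

theorem pairingMatrix_comp {ψ χ : EuclideanSpace ℝ (Fin n) → V}
    {τ : EuclideanSpace ℝ (Fin n) → EuclideanSpace ℝ (Fin n)} {y : EuclideanSpace ℝ (Fin n)}
    (hψ : DifferentiableAt ℝ ψ (τ y)) (hχ : DifferentiableAt ℝ χ (τ y))
    (hτ : DifferentiableAt ℝ τ y) :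
    pairingMatrix (ψ ∘ τ) (χ ∘ τ) y = (standardMatrix (fderiv ℝ τ y)).transpose *
      pairingMatrix ψ χ (τ y) * standardMatrix (fderiv ℝ τ y) := by
  have h := inner_matrix_comp (fderiv ℝ χ (τ y)) (fderiv ℝ ψ (τ y)) (fderiv ℝ τ y)
  simp only [pairingMatrix, partialDeriv]
  rw [fderiv_comp y hψ hτ, fderiv_comp y hχ hτ]
  exact h

/-- This Jacobian factor makes the volumes of two charts agree on the overlap. -/
theorem gramDensity_comp {ψ : EuclideanSpace ℝ (Fin n) → V}
    {τ : EuclideanSpace ℝ (Fin n) → EuclideanSpace ℝ (Fin n)} {y : EuclideanSpace ℝ (Fin n)}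
    (hψ : DifferentiableAt ℝ ψ (τ y)) (hτ : DifferentiableAt ℝ τ y) :
    gramDensity (ψ ∘ τ) y = |(fderiv ℝ τ y).det| * gramDensity ψ (τ y) := by
  rw [gramDensity, pairingMatrix_comp hψ hψ hτ, Matrix.det_mul, Matrix.det_mul,
    Matrix.det_transpose, standardMatrix_det, mul_comm, ← mul_assoc, ← sq,
    Real.sqrt_mul (sq_nonneg _), Real.sqrt_sq_eq_abs]
  rfl

theorem gramDensity_congr {ψ χ : EuclideanSpace ℝ (Fin n) → V} {y : EuclideanSpace ℝ (Fin n)}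
    (h : ψ =ᶠ[nhds y] χ) : gramDensity ψ y = gramDensity χ y := by
  simp only [gramDensity, pairingMatrix, partialDeriv, h.fderiv_eq]

end ChangeOfCoordinates

/-! ### Metric, density and mean curvature read in a chart. -/

section Charts

variable {n : ℕ} {M : Type*} [TopologicalSpace M] [ChartedSpace (EuclideanSpace ℝ (Fin n)) M]
  [IsManifold (𝓡 n) ∞ M]
  {V : Type*} [NormedAddCommGroup V] [InnerProductSpace ℝ V]
  {e e' : OpenPartialHomeomorph M (EuclideanSpace ℝ (Fin n))}

theorem mdifferentiableAt_chart (he : e ∈ IsManifold.maximalAtlas (𝓡 n) ∞ M) {x : M}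
    (hx : x ∈ e.source) : MDifferentiableAt (𝓡 n) (𝓡 n) e x :=
  ((contMDiffOn_of_mem_maximalAtlas he).contMDiffAt (e.open_source.mem_nhds hx)).mdifferentiableAt
    (by simp)

theorem contMDiffAt_chart_symm (he : e ∈ IsManifold.maximalAtlas (𝓡 n) ∞ M)
    {y : EuclideanSpace ℝ (Fin n)} (hy : y ∈ e.target) :
    ContMDiffAt (𝓡 n) (𝓡 n) ∞ e.symm y :=
  (contMDiffOn_symm_of_mem_maximalAtlas he).contMDiffAt (e.open_target.mem_nhds hy)

theorem mdifferentiableAt_chart_symm (he : e ∈ IsManifold.maximalAtlas (𝓡 n) ∞ M)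
    {y : EuclideanSpace ℝ (Fin n)} (hy : y ∈ e.target) :
    MDifferentiableAt (𝓡 n) (𝓡 n) e.symm y :=
  (contMDiffAt_chart_symm he hy).mdifferentiableAt (by simp)

theorem contDiffAt_comp_chart_symm {F : Type*} [NormedAddCommGroup F] [NormedSpace ℝ F]
    {φ : M → F} (he : e ∈ IsManifold.maximalAtlas (𝓡 n) ∞ M)
    {y : EuclideanSpace ℝ (Fin n)} (hy : y ∈ e.target)
    (hφ : ContMDiffAt (𝓡 n) 𝓘(ℝ, F) ∞ φ (e.symm y)) : ContDiffAt ℝ ∞ (φ ∘ e.symm) y :=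
  contMDiffAt_iff_contDiffAt.1 (hφ.comp y (contMDiffAt_chart_symm he hy))

theorem contDiffAt_chart_transition (he : e ∈ IsManifold.maximalAtlas (𝓡 n) ∞ M)
    (he' : e' ∈ IsManifold.maximalAtlas (𝓡 n) ∞ M)
    {y : EuclideanSpace ℝ (Fin n)} (hy : y ∈ e'.target) (hy' : e'.symm y ∈ e.source) :
    ContDiffAt ℝ ∞ (e ∘ e'.symm) y :=
  contDiffAt_comp_chart_symm he' hy
    ((contMDiffOn_of_mem_maximalAtlas he).contMDiffAt (e.open_source.mem_nhds hy'))

/-- The differential of the inverse of a chart, as an endomorphism of the model space. -/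
def chartSymmDeriv (e : OpenPartialHomeomorph M (EuclideanSpace ℝ (Fin n)))
    (y : EuclideanSpace ℝ (Fin n)) : EuclideanSpace ℝ (Fin n) →L[ℝ] EuclideanSpace ℝ (Fin n) :=
  mfderiv (𝓡 n) (𝓡 n) e.symm y

theorem pushforward_chartSymmDeriv {F : Type*} [NormedAddCommGroup F] [NormedSpace ℝ F]
    {φ : M → F} (he : e ∈ IsManifold.maximalAtlas (𝓡 n) ∞ M)
    {y : EuclideanSpace ℝ (Fin n)} (hy : y ∈ e.target)
    (hφ : MDifferentiableAt (𝓡 n) 𝓘(ℝ, F) φ (e.symm y)) (u : EuclideanSpace ℝ (Fin n)) :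
    pushforward φ (e.symm y) (chartSymmDeriv e y u) = fderiv ℝ (φ ∘ e.symm) y u := by
  have h := mfderiv_comp y hφ (mdifferentiableAt_chart_symm he hy)
  rw [mfderiv_eq_fderiv] at h
  rw [h]
  rfl

/-- `e ∘ e.symm` is the identity near `y`, so the differential of `e` is a left inverse. -/
theorem chartSymmDeriv_injective (he : e ∈ IsManifold.maximalAtlas (𝓡 n) ∞ M)
    {y : EuclideanSpace ℝ (Fin n)} (hy : y ∈ e.target) :
    Function.Injective (chartSymmDeriv e y) := by
  intro u v huv
  have h := pushforward_chartSymmDeriv he hy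
    (mdifferentiableAt_chart he (e.map_target hy))
  have hid : (e ∘ e.symm) =ᶠ[nhds y] id := by
    filter_upwards [e.open_target.mem_nhds hy] with z hz using e.right_inv hz
  have h2 : ∀ u, pushforward e (e.symm y) (chartSymmDeriv e y u) = u := fun u => by
    rw [h u, hid.fderiv_eq, fderiv_id]
    rfl
  rw [← h2 u, ← h2 v, huv]

theorem chartSymmDeriv_surjective (he : e ∈ IsManifold.maximalAtlas (𝓡 n) ∞ M)
    {y : EuclideanSpace ℝ (Fin n)} (hy : y ∈ e.target) :
    Function.Surjective (chartSymmDeriv e y) :=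
  LinearMap.surjective_of_injective
    (f := (chartSymmDeriv e y : EuclideanSpace ℝ (Fin n) →ₗ[ℝ] EuclideanSpace ℝ (Fin n)))
    (chartSymmDeriv_injective he hy)

theorem chartSymmDeriv_det_ne_zero (he : e ∈ IsManifold.maximalAtlas (𝓡 n) ∞ M)
    {y : EuclideanSpace ℝ (Fin n)} (hy : y ∈ e.target) :
    (standardMatrix (chartSymmDeriv e y)).det ≠ 0 := by
  rw [standardMatrix_det]
  have := LinearEquiv.isUnit_det' (LinearEquiv.ofBijective
    (chartSymmDeriv e y : EuclideanSpace ℝ (Fin n) →ₗ[ℝ] EuclideanSpace ℝ (Fin n))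
    ⟨chartSymmDeriv_injective he hy, chartSymmDeriv_surjective he hy⟩)
  exact this.ne_zero

variable {g : Bundle.ContMDiffRiemannianMetric (𝓡 n) ∞ (EuclideanSpace ℝ (Fin n))
      (TangentSpace (𝓡 n) : M → Type _)} {φ : M → V}

theorem IsIsometricImmersion.mdifferentiableAt (h : IsIsometricImmersion g φ) (x : M) :
    MDifferentiableAt (𝓡 n) 𝓘(ℝ, V) φ x :=
  (h.contMDiff x).mdifferentiableAt (by simp)

theorem IsIsometricImmersion.pushforward_injective (h : IsIsometricImmersion g φ) (x : M)
    {u : TangentSpace (𝓡 n) x} (hu : pushforward φ x u = 0) : u = 0 := by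
  by_contra hne
  have h1 := g.pos x u hne
  rw [← h.inner_eq, hu, inner_zero_left] at h1
  exact lt_irrefl _ h1

theorem IsIsometricImmersion.contDiffAt (h : IsIsometricImmersion g φ)
    (he : e ∈ IsManifold.maximalAtlas (𝓡 n) ∞ M)
    {y : EuclideanSpace ℝ (Fin n)} (hy : y ∈ e.target) : ContDiffAt ℝ ∞ (φ ∘ e.symm) y :=
  contDiffAt_comp_chart_symm he hy (h.contMDiff _)

theorem IsIsometricImmersion.fderiv_injective (h : IsIsometricImmersion g φ)
    (he : e ∈ IsManifold.maximalAtlas (𝓡 n) ∞ M)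
    {y : EuclideanSpace ℝ (Fin n)} (hy : y ∈ e.target) {u : EuclideanSpace ℝ (Fin n)}
    (hu : fderiv ℝ (φ ∘ e.symm) y u = 0) : u = 0 := by
  rw [← pushforward_chartSymmDeriv he hy (h.mdifferentiableAt _)] at hu
  refine chartSymmDeriv_injective he hy ?_
  rw [map_zero]
  exact h.pushforward_injective _ hu

theorem IsIsometricImmersion.linearIndependent (h : IsIsometricImmersion g φ)
    (he : e ∈ IsManifold.maximalAtlas (𝓡 n) ∞ M)
    {y : EuclideanSpace ℝ (Fin n)} (hy : y ∈ e.target) :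
    LinearIndependent ℝ (partialDeriv (φ ∘ e.symm) y) := by
  have hb : LinearIndependent ℝ fun i : Fin n => EuclideanSpace.single i (1 : ℝ) := by
    convert! (PiLp.basisFun 2 ℝ (Fin n)).linearIndependent with i
    simp [PiLp.basisFun_apply]
  exact hb.map' (fderiv ℝ (φ ∘ e.symm) y : EuclideanSpace ℝ (Fin n) →ₗ[ℝ] V)
    (LinearMap.ker_eq_bot'.2 fun u hu => h.fderiv_injective he hy hu)

/-- Through `φ` the abstract metric becomes a Gram matrix of partial derivatives, which moves the
computations to maps between vector spaces. -/
theorem IsIsometricImmersion.riemannianDensity_eq (h : IsIsometricImmersion g φ)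
    (he : e ∈ IsManifold.maximalAtlas (𝓡 n) ∞ M)
    {y : EuclideanSpace ℝ (Fin n)} (hy : y ∈ e.target) :
    riemannianDensity g e y = gramDensity (φ ∘ e.symm) y := by
  unfold riemannianDensity gramDensity
  congr 2
  ext i j
  rw [Matrix.of_apply, ← h.inner_eq]
  change inner ℝ (pushforward φ (e.symm y) (chartSymmDeriv e y _))
    (pushforward φ (e.symm y) (chartSymmDeriv e y _)) = _
  rw [pushforward_chartSymmDeriv he hy (h.mdifferentiableAt _),
    pushforward_chartSymmDeriv he hy (h.mdifferentiableAt _)]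
  rfl

/-- `meanCurvature` uses the preferred chart at each point. The frame of one fixed chart gives an
expression that depends visibly smoothly on the point. -/
theorem IsIsometricImmersion.meanCurvature_eq (h : IsIsometricImmersion g φ) {ν : M → V}
    (he : e ∈ IsManifold.maximalAtlas (𝓡 n) ∞ M)
    {y : EuclideanSpace ℝ (Fin n)} (hy : y ∈ e.target)
    (hν : MDifferentiableAt (𝓡 n) 𝓘(ℝ, V) ν (e.symm y)) :
    meanCurvature g φ ν (e.symm y) = (1 / (n : ℝ)) *
      ((pairingMatrix (φ ∘ e.symm) (φ ∘ e.symm) y)⁻¹ *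
        pairingMatrix (φ ∘ e.symm) (ν ∘ e.symm) y).trace := by
  let L : EuclideanSpace ℝ (Fin n) →L[ℝ] V := mfderiv (𝓡 n) 𝓘(ℝ, V) φ (e.symm y)
  let K : EuclideanSpace ℝ (Fin n) →L[ℝ] V := mfderiv (𝓡 n) 𝓘(ℝ, V) ν (e.symm y)
  have hL : ∀ u, L (chartSymmDeriv e y u) = fderiv ℝ (φ ∘ e.symm) y u :=
    pushforward_chartSymmDeriv he hy (h.mdifferentiableAt _)
  have hK : ∀ u, K (chartSymmDeriv e y u) = fderiv ℝ (ν ∘ e.symm) y u :=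
    pushforward_chartSymmDeriv he hy hν
  have h1 := inner_matrix_comp L L (chartSymmDeriv e y)
  have h2 := inner_matrix_comp K L (chartSymmDeriv e y)
  simp only [hL, hK] at h1 h2
  have h3 : pairingMatrix (φ ∘ e.symm) (φ ∘ e.symm) y = _ := h1
  have h4 : pairingMatrix (φ ∘ e.symm) (ν ∘ e.symm) y = _ := h2
  rw [h3, h4, trace_inv_mul_conj (chartSymmDeriv_det_ne_zero he hy)]
  unfold meanCurvature
  congr 4
  ext i j
  exact (h.inner_eq _ _ _).symm

theorem IsIsometricImmersion.continuousOn_gramDensity (h : IsIsometricImmersion g φ)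
    (he : e ∈ IsManifold.maximalAtlas (𝓡 n) ∞ M) :
    ContinuousOn (gramDensity (φ ∘ e.symm)) e.target := fun _ hy =>
  (contDiffAt_gramDensity (h.contDiffAt he hy)
    (h.linearIndependent he hy)).continuousAt.continuousWithinAt

end Charts

/-! ### The Riemannian volume measure. -/

section Volume

theorem ContinuousOn.measurableSet_inter_preimage {X Y : Type*} [TopologicalSpace X]
    [MeasurableSpace X] [OpensMeasurableSpace X] [TopologicalSpace Y] [MeasurableSpace Y]
    [BorelSpace Y] {f : X → Y} {s : Set X} (hf : ContinuousOn f s) (hs : MeasurableSet s)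
    {t : Set Y} (ht : MeasurableSet t) : MeasurableSet (s ∩ f ⁻¹' t) := by
  have h : MeasurableSet (s.domRestrict f ⁻¹' t) :=
    (continuousOn_iff_continuous_domRestrict.1 hf).measurable ht
  have := hs.subtype_image h
  rwa [show Subtype.val '' (s.domRestrict f ⁻¹' t) = s ∩ f ⁻¹' t by
    ext; simp [and_comm]] at this

variable {n : ℕ} {M : Type*} [TopologicalSpace M] [ChartedSpace (EuclideanSpace ℝ (Fin n)) M]
  [IsManifold (𝓡 n) ∞ M] [MeasurableSpace M] [BorelSpace M]
  {V : Type*} [NormedAddCommGroup V] [InnerProductSpace ℝ V]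
  {e e' : OpenPartialHomeomorph M (EuclideanSpace ℝ (Fin n))}
  {g : Bundle.ContMDiffRiemannianMetric (𝓡 n) ∞ (EuclideanSpace ℝ (Fin n))
      (TangentSpace (𝓡 n) : M → Type _)} {φ : M → V}

theorem aemeasurable_chart_symm
    (e : OpenPartialHomeomorph M (EuclideanSpace ℝ (Fin n))) :
    AEMeasurable e.symm ((volume.restrict e.target).withDensity
      fun y => ENNReal.ofReal (riemannianDensity g e y)) :=
  (e.continuousOn_symm.aemeasurable e.open_target.measurableSet).mono_ac
    (withDensity_absolutelyContinuous _ _)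

theorem IsIsometricImmersion.chartVolume_apply (h : IsIsometricImmersion g φ)
    (he : e ∈ IsManifold.maximalAtlas (𝓡 n) ∞ M) {A : Set M} (hA : MeasurableSet A) :
    chartVolume g e A =
      ∫⁻ y in e.target ∩ e.symm ⁻¹' A, ENNReal.ofReal (gramDensity (φ ∘ e.symm) y) := by
  rw [chartVolume, Measure.map_apply_of_aemeasurable (aemeasurable_chart_symm e) hA,
    withDensity_apply', Measure.restrict_restrict' e.open_target.measurableSet, Set.inter_comm]
  exact setLIntegral_congr_fun
    (e.continuousOn_symm.measurableSet_inter_preimage e.open_target.measurableSet hA)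
    fun y hy => by simp only [h.riemannianDensity_eq he hy.1]

/-- Change of variables along the transition map `e ∘ e'.symm`. -/
theorem IsIsometricImmersion.chartVolume_eq (h : IsIsometricImmersion g φ)
    (he : e ∈ IsManifold.maximalAtlas (𝓡 n) ∞ M) (he' : e' ∈ IsManifold.maximalAtlas (𝓡 n) ∞ M)
    {A : Set M} (hA : MeasurableSet A) (hAe : A ⊆ e.source) (hAe' : A ⊆ e'.source) :
    chartVolume g e A = chartVolume g e' A := by
  rw [h.chartVolume_apply he hA, h.chartVolume_apply he' hA]
  have himg : e.target ∩ e.symm ⁻¹' A = (e ∘ e'.symm) '' (e'.target ∩ e'.symm ⁻¹' A) := by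
    ext y
    constructor
    · rintro ⟨hy, hyA⟩
      refine ⟨e' (e.symm y), ⟨e'.map_source (hAe' hyA), ?_⟩, ?_⟩
      · rw [Set.mem_preimage, e'.left_inv (hAe' hyA)]
        exact hyA
      · rw [Function.comp_apply, e'.left_inv (hAe' hyA), e.right_inv hy]
    · rintro ⟨z, ⟨hz, hzA⟩, rfl⟩
      refine ⟨e.map_source (hAe hzA), ?_⟩
      rw [Set.mem_preimage, Function.comp_apply, e.left_inv (hAe hzA)]
      exact hzA
  have hs : MeasurableSet (e'.target ∩ e'.symm ⁻¹' A) :=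
    e'.continuousOn_symm.measurableSet_inter_preimage e'.open_target.measurableSet hA
  have hd : ∀ z ∈ e'.target ∩ e'.symm ⁻¹' A, DifferentiableAt ℝ (e ∘ e'.symm) z := fun z hz =>
    (contDiffAt_chart_transition he he' hz.1 (hAe hz.2)).differentiableAt (by simp)
  rw [himg, lintegral_image_eq_lintegral_abs_det_fderiv_mul volume hs
    (fun z hz => (hd z hz).hasFDerivAt.hasFDerivWithinAt)
    (fun z hz w hw hzw => e'.symm.injOn hz.1 hw.1 (e.injOn (hAe hz.2) (hAe hw.2) hzw))]
  refine setLIntegral_congr_fun hs fun z hz => ?_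
  have hez : e.symm ((e ∘ e'.symm) z) = e'.symm z := by
    rw [Function.comp_apply, e.left_inv (hAe hz.2)]
  have hψ : DifferentiableAt ℝ (φ ∘ e.symm) ((e ∘ e'.symm) z) :=
    (h.contDiffAt he (e.map_source (hAe hz.2))).differentiableAt (by simp)
  have hc : φ ∘ e'.symm =ᶠ[nhds z] (φ ∘ e.symm) ∘ (e ∘ e'.symm) := by
    have hcont : ContinuousAt e'.symm z := e'.continuousAt_symm hz.1
    filter_upwards [hcont.preimage_mem_nhds (e.open_source.mem_nhds (hAe hz.2))] with w hw
    simp only [Function.comp_apply]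
    rw [e.left_inv hw]
  rw [gramDensity_congr hc, gramDensity_comp hψ (hd z hz), ← ENNReal.ofReal_mul (abs_nonneg _)]

theorem IsIsometricImmersion.chartVolume_compl_source (h : IsIsometricImmersion g φ)
    (he : e ∈ IsManifold.maximalAtlas (𝓡 n) ∞ M) : chartVolume g e e.sourceᶜ = 0 := by
  rw [h.chartVolume_apply he e.open_source.measurableSet.compl]
  have : e.target ∩ e.symm ⁻¹' e.sourceᶜ = ∅ := by
    ext y
    simpa using fun hy => e.map_target hy
  rw [this, Measure.restrict_empty, lintegral_zero_measure]

theorem IsIsometricImmersion.riemannianVolume_restrict (h : IsIsometricImmersion g φ) (x : M) :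
    (riemannianVolume g).restrict (chartAt (EuclideanSpace ℝ (Fin n)) x).source =
      chartVolume g (chartAt (EuclideanSpace ℝ (Fin n)) x) := by
  set e := chartAt (EuclideanSpace ℝ (Fin n)) x with hedef
  have hmem : ∀ y : M, chartAt (EuclideanSpace ℝ (Fin n)) y ∈ IsManifold.maximalAtlas (𝓡 n) ∞ M :=
    fun y => IsManifold.chart_mem_maximalAtlas y
  have hS : MeasurableSet e.source := e.open_source.measurableSet
  have hself : (chartVolume g e).restrict e.source = chartVolume g e :=
    Measure.restrict_eq_self_of_ae_mem (h.chartVolume_compl_source (hmem x))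
  apply le_antisymm
  -- The comparison measure is as large as possible outside the domain of `e`, so each chart volume
  -- has to be bounded only inside it, and there the chart volumes agree on the overlap.
  · have hle : riemannianVolume g ≤ chartVolume g e + (⊤ : Measure M).restrict e.sourceᶜ := by
      refine iSup_le fun y => Measure.le_iff.2 fun A hA => ?_
      set f := chartAt (EuclideanSpace ℝ (Fin n)) y
      have hf : MeasurableSet f.source := f.open_source.measurableSet
      rw [← measure_inter_add_sdiff A hS, Measure.add_apply]
      refine add_le_add ?_ ?_
      · have h1 : chartVolume g f (A ∩ e.source) = chartVolume g f (A ∩ e.source ∩ f.source) := by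
          rw [← measure_inter_add_sdiff (A ∩ e.source) hf]
          have h0 : chartVolume g f ((A ∩ e.source) \ f.source) = 0 :=
            measure_mono_null (fun z hz => hz.2) (h.chartVolume_compl_source (hmem y))
          rw [h0, add_zero]
        rw [h1, h.chartVolume_eq (hmem y) (hmem x) ((hA.inter hS).inter hf)
          Set.inter_subset_right (fun z hz => hz.1.2)]
        exact measure_mono fun z hz => hz.1.1
      · rw [Measure.restrict_apply hA, ← Set.sdiff_eq]
        exact (le_top : chartVolume g f ≤ ⊤) _
    refine (Measure.restrict_mono subset_rfl hle).trans ?_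
    rw [Measure.restrict_add, hself, Measure.restrict_restrict hS, Set.inter_compl_self,
      Measure.restrict_empty, add_zero]
  · conv_lhs => rw [← hself]
    exact Measure.restrict_mono subset_rfl
      (le_iSup (fun y => chartVolume g (chartAt (EuclideanSpace ℝ (Fin n)) y)) x)

theorem IsIsometricImmersion.riemannianVolume_apply (h : IsIsometricImmersion g φ) (x : M)
    {A : Set M} (hA : MeasurableSet A)
    (hAx : A ⊆ (chartAt (EuclideanSpace ℝ (Fin n)) x).source) :
    riemannianVolume g A = ∫⁻ y in (chartAt (EuclideanSpace ℝ (Fin n)) x).target ∩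
      (chartAt (EuclideanSpace ℝ (Fin n)) x).symm ⁻¹' A,
        ENNReal.ofReal (gramDensity (φ ∘ (chartAt (EuclideanSpace ℝ (Fin n)) x).symm) y) := by
  rw [← h.chartVolume_apply (IsManifold.chart_mem_maximalAtlas x) hA,
    ← h.riemannianVolume_restrict, Measure.restrict_apply hA, Set.inter_eq_left.2 hAx]

/-- The density is continuous on a closed ball in a chart, so the volume is locally finite, and `M`
is compact. -/
theorem IsIsometricImmersion.isFiniteMeasure [CompactSpace M] (h : IsIsometricImmersion g φ) :
    IsFiniteMeasure (riemannianVolume g) := by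
  have : IsLocallyFiniteMeasure (riemannianVolume g) := by
    refine ⟨fun x => ?_⟩
    set e := chartAt (EuclideanSpace ℝ (Fin n)) x with he
    have hx : x ∈ e.source := mem_chart_source _ x
    obtain ⟨r, hr, hball⟩ := Metric.nhds_basis_closedBall.mem_iff.1
      (e.open_target.mem_nhds (e.map_source hx))
    have hopen : IsOpen (e.source ∩ e ⁻¹' Metric.ball (e x) r) :=
      e.isOpen_inter_preimage Metric.isOpen_ball
    refine ⟨e.source ∩ e ⁻¹' Metric.ball (e x) r,
      hopen.mem_nhds ⟨hx, Metric.mem_ball_self hr⟩, ?_⟩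
    rw [h.riemannianVolume_apply x hopen.measurableSet Set.inter_subset_left]
    have hcont : ContinuousOn (gramDensity (φ ∘ e.symm)) (Metric.closedBall (e x) r) :=
      (h.continuousOn_gramDensity (IsManifold.chart_mem_maximalAtlas x)).mono hball
    have hint := (hcont.integrableOn_compact (μ := volume) (isCompact_closedBall _ _)).lintegral_lt_top
    refine lt_of_le_of_lt (lintegral_mono_set fun y hy => ?_) hint
    have := hy.2.2
    rw [Set.mem_preimage, e.right_inv hy.1] at this
    exact Metric.ball_subset_closedBall this
  exact CompactSpace.isFiniteMeasure

theorem IsIsometricImmersion.isOpenPosMeasure (h : IsIsometricImmersion g φ) :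
    (riemannianVolume g).IsOpenPosMeasure := by
  refine ⟨fun U hU ⟨x, hxU⟩ h0 => ?_⟩
  set e := chartAt (EuclideanSpace ℝ (Fin n)) x with he
  have hx : x ∈ e.source := mem_chart_source _ x
  have hUe : IsOpen (U ∩ e.source) := hU.inter e.open_source
  have h1 : riemannianVolume g (U ∩ e.source) = 0 :=
    measure_mono_null Set.inter_subset_left h0
  rw [h.riemannianVolume_apply x hUe.measurableSet Set.inter_subset_right] at h1
  have hT : IsOpen (e.target ∩ e.symm ⁻¹' (U ∩ e.source)) :=
    e.isOpen_inter_preimage_symm hUe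
  have hne : (e.target ∩ e.symm ⁻¹' (U ∩ e.source)).Nonempty :=
    ⟨e x, e.map_source hx, by simp [e.left_inv hx, hxU, hx]⟩
  have hpos : ∀ y ∈ e.target ∩ e.symm ⁻¹' (U ∩ e.source),
      0 < ENNReal.ofReal (gramDensity (φ ∘ e.symm) y) := fun y hy =>
    ENNReal.ofReal_pos.2 (gramDensity_pos
      (h.linearIndependent (IsManifold.chart_mem_maximalAtlas x) hy.1))
  have hmeas : AEMeasurable (fun y => ENNReal.ofReal (gramDensity (φ ∘ e.symm) y))
      (volume.restrict (e.target ∩ e.symm ⁻¹' (U ∩ e.source))) :=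
    (((h.continuousOn_gramDensity (IsManifold.chart_mem_maximalAtlas x)).mono
      Set.inter_subset_left).aemeasurable hT.measurableSet).ennreal_ofReal
  rw [lintegral_eq_zero_iff' hmeas] at h1
  have h2 := (ae_restrict_iff' hT.measurableSet).1 h1
  refine (hT.measure_pos volume hne).ne' (measure_mono_null (fun y hy => ?_) h2)
  exact fun hcon => (hpos y hy).ne' (hcon hy)

theorem IsIsometricImmersion.integral_eq (h : IsIsometricImmersion g φ) (x : M) {f : M → ℝ}
    (hf : AEStronglyMeasurable f (riemannianVolume g))
    (hfx : ∀ y ∉ (chartAt (EuclideanSpace ℝ (Fin n)) x).source, f y = 0) :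
    ∫ y, f y ∂(riemannianVolume g) = ∫ y in (chartAt (EuclideanSpace ℝ (Fin n)) x).target,
      gramDensity (φ ∘ (chartAt (EuclideanSpace ℝ (Fin n)) x).symm) y *
        f ((chartAt (EuclideanSpace ℝ (Fin n)) x).symm y) := by
  set e := chartAt (EuclideanSpace ℝ (Fin n)) x with he
  have hmem : e ∈ IsManifold.maximalAtlas (𝓡 n) ∞ M := IsManifold.chart_mem_maximalAtlas x
  rw [← setIntegral_eq_integral_of_forall_compl_eq_zero hfx, h.riemannianVolume_restrict]
  have hf' : AEStronglyMeasurable f (chartVolume g e) := by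
    rw [← h.riemannianVolume_restrict]
    exact hf.restrict
  have hden : (volume.restrict e.target).withDensity
      (fun y => ENNReal.ofReal (riemannianDensity g e y)) =
      (volume.restrict e.target).withDensity
        fun y => ENNReal.ofReal (gramDensity (φ ∘ e.symm) y) :=
    withDensity_congr_ae ((ae_restrict_iff' e.open_target.measurableSet).2
      (Filter.Eventually.of_forall fun y hy => by simp only [h.riemannianDensity_eq hmem hy]))
  have hmeas : AEMeasurable (fun y => ENNReal.ofReal (gramDensity (φ ∘ e.symm) y))
      (volume.restrict e.target) :=
    ((h.continuousOn_gramDensity hmem).aemeasurable e.open_target.measurableSet).ennreal_ofReal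
  have hmap := integral_map (aemeasurable_chart_symm (g := g) e) hf'
  rw [chartVolume, hmap, hden, integral_withDensity_eq_integral_toReal_smul₀ hmeas
    (Filter.Eventually.of_forall fun _ => ENNReal.ofReal_lt_top)]
  refine integral_congr_ae (Filter.Eventually.of_forall fun y => ?_)
  simp only [smul_eq_mul]
  rw [ENNReal.toReal_ofReal (gramDensity_nonneg _ _)]

end Volume

/-! ### Unit normal fields, the Minkowski integrand and the tangential field. -/

section UnitNormal

variable {n : ℕ} {M : Type*} [TopologicalSpace M] [ChartedSpace (EuclideanSpace ℝ (Fin n)) M]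
  [IsManifold (𝓡 n) ∞ M]
  {V : Type*} [NormedAddCommGroup V] [InnerProductSpace ℝ V]

variable (n) in
/-- `ν` is a smooth unit normal field of the immersed hypersurface `φ` of the space form of
curvature `δ ≥ 0`, realised as the vector space `V` for `δ = 0` and as the sphere of radius
`1 / √δ` of `V` for `δ > 0`. -/
structure IsUnitNormal (δ : ℝ) (φ ν : M → V) : Prop where
  contMDiff : ContMDiff (𝓡 n) 𝓘(ℝ, V) ∞ ν
  norm_eq_one : ∀ x, ‖ν x‖ = 1
  inner_pushforward : ∀ (x : M) (u : TangentSpace (𝓡 n) x), inner ℝ (ν x) (pushforward φ x u) = 0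
  sphere : δ ≠ 0 → ∀ x, δ * inner ℝ (φ x) (φ x) = 1 ∧ inner ℝ (φ x) (ν x) = 0
  eq_zero : ∀ (x : M) (z : V), (∀ u : TangentSpace (𝓡 n) x, inner ℝ z (pushforward φ x u) = 0) →
    inner ℝ z (ν x) = 0 → (δ ≠ 0 → inner ℝ z (φ x) = 0) → z = 0

variable {e : OpenPartialHomeomorph M (EuclideanSpace ℝ (Fin n))}
  {g : Bundle.ContMDiffRiemannianMetric (𝓡 n) ∞ (EuclideanSpace ℝ (Fin n))
      (TangentSpace (𝓡 n) : M → Type _)} {φ ν : M → V} {δ : ℝ}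

/-- The integrand of the Minkowski formula for hypersurfaces with respect to the point `x₀`. -/
def minkowskiIntegrand (g : Bundle.ContMDiffRiemannianMetric (𝓡 n) ∞ (EuclideanSpace ℝ (Fin n))
      (TangentSpace (𝓡 n) : M → Type _)) (δ : ℝ) (φ ν : M → V) (x₀ : V) (x : M) : ℝ :=
  1 - δ * inner ℝ (φ x) (φ x - x₀) - meanCurvature g φ ν x * inner ℝ (ν x) (φ x - x₀)

theorem continuousAt_of_comp_chart_symm {F : Type*} [TopologicalSpace F] {f : M → F} {x : M}
    (hx : x ∈ e.source) (h : ContinuousAt (f ∘ e.symm) (e x)) : ContinuousAt f x := by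
  have h1 : ContinuousAt ((f ∘ e.symm) ∘ e) x := h.comp (e.continuousAt hx)
  refine h1.congr ?_
  filter_upwards [e.open_source.mem_nhds hx] with z hz
  simp only [Function.comp_apply, e.left_inv hz]

/-- The coordinate formula with the trace rewritten as nH; `n ≠ 0` cancels the factor 1/n in
`meanCurvature`. -/
theorem IsUnitNormal.divergence (hν : IsUnitNormal n δ φ ν) (h : IsIsometricImmersion g φ)
    (hn : n ≠ 0) (he : e ∈ IsManifold.maximalAtlas (𝓡 n) ∞ M) {y : EuclideanSpace ℝ (Fin n)}
    (hy : y ∈ e.target) (x₀ : V) :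
    ∑ i, fderiv ℝ (fun z => gramDensity (φ ∘ e.symm) z *
        tangentialCoeff (φ ∘ e.symm) ((φ ∘ e.symm) z - x₀) z i) y
        (EuclideanSpace.single i (1 : ℝ)) =
      n * gramDensity (φ ∘ e.symm) y * minkowskiIntegrand g δ φ ν x₀ (e.symm y) := by
  have hn' : (n : ℝ) ≠ 0 := Nat.cast_ne_zero.2 hn
  have hpush : ∀ z ∈ e.target, ∀ i, partialDeriv (φ ∘ e.symm) z i =
      pushforward φ (e.symm z) (chartSymmDeriv e z (EuclideanSpace.single i (1 : ℝ))) :=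
    fun z hz i => (pushforward_chartSymmDeriv he hz (h.mdifferentiableAt _) _).symm
  rw [divergence_tangentialCoeff (ν := ν ∘ e.symm) (δ := δ) x₀ (h.contDiffAt he hy)
    (contDiffAt_comp_chart_symm he hy (hν.contMDiff _)) (h.linearIndependent he hy)
    (hν.norm_eq_one _), minkowskiIntegrand,
    h.meanCurvature_eq he hy ((hν.contMDiff _).mdifferentiableAt (by simp))]
  · simp only [Function.comp_apply]
    field_simp
  · filter_upwards [e.open_target.mem_nhds hy] with z hz i
    rw [hpush z hz]
    exact hν.inner_pushforward _ _
  · intro h0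
    refine ⟨(hν.sphere h0 _).1, (hν.sphere h0 _).2, ?_⟩
    filter_upwards [e.open_target.mem_nhds hy] with z hz i
    have hc : ∀ᶠ w in nhds z, ‖(φ ∘ e.symm) w - 0‖ = √δ⁻¹ := Filter.Eventually.of_forall fun w => by
      rw [sub_zero, ← eq_inv_of_mul_eq_one_right (hν.sphere h0 (e.symm w)).1,
        real_inner_self_eq_norm_sq, Real.sqrt_sq (norm_nonneg _)]
      rfl
    have h1 := inner_fderiv_eq_zero_of_norm_eq
      ((h.contDiffAt he hz).differentiableAt (by simp)) hc (EuclideanSpace.single i (1 : ℝ))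
    rwa [sub_zero, real_inner_comm] at h1
  · intro z hz hzν hzφ
    refine hν.eq_zero (e.symm y) z (fun u => ?_) hzν hzφ
    obtain ⟨v, rfl⟩ := chartSymmDeriv_surjective he hy u
    rw [pushforward_chartSymmDeriv he hy (h.mdifferentiableAt _),
      EuclideanSpace.eq_sum_smul_single v, map_sum, inner_sum]
    refine Finset.sum_eq_zero fun i _ => ?_
    rw [map_smul, inner_smul_right]
    exact mul_eq_zero_of_right _ (hz i)

theorem IsUnitNormal.continuous_meanCurvature (hν : IsUnitNormal n δ φ ν)
    (h : IsIsometricImmersion g φ) : Continuous (meanCurvature g φ ν) := by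
  refine continuous_iff_continuousAt.2 fun x => ?_
  set e := chartAt (EuclideanSpace ℝ (Fin n)) x with he
  have hmem : e ∈ IsManifold.maximalAtlas (𝓡 n) ∞ M := IsManifold.chart_mem_maximalAtlas x
  have hx : x ∈ e.source := mem_chart_source _ x
  refine continuousAt_of_comp_chart_symm hx ?_
  have hy := e.map_source hx
  have hψ := h.contDiffAt hmem hy
  have hχ : ContDiffAt ℝ ∞ (ν ∘ e.symm) (e x) :=
    contDiffAt_comp_chart_symm hmem hy (hν.contMDiff _)
  have hc : ContinuousAt (fun y => (1 / (n : ℝ)) *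
      ((pairingMatrix (φ ∘ e.symm) (φ ∘ e.symm) y)⁻¹ *
        pairingMatrix (φ ∘ e.symm) (ν ∘ e.symm) y).trace) (e x) := by
    simp only [Matrix.trace, Matrix.diag, Matrix.mul_apply]
    refine continuousAt_const.mul (tendsto_finsetSum _ fun i _ => tendsto_finsetSum _
      fun j _ => Filter.Tendsto.mul ?_ ?_)
    · exact (ContDiffAt.matrix_inv (contDiffAt_pairingMatrix hψ hψ)
        (pairingMatrix_self_det_pos (h.linearIndependent hmem hy)).ne' i j).continuousAt
    · exact (contDiffAt_pairingMatrix hψ hχ j i).continuousAt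
  refine hc.congr ?_
  filter_upwards [e.open_target.mem_nhds hy] with z hz
  exact (h.meanCurvature_eq hmem hz ((hν.contMDiff _).mdifferentiableAt (by simp))).symm

theorem IsUnitNormal.continuous_minkowskiIntegrand (hν : IsUnitNormal n δ φ ν)
    (h : IsIsometricImmersion g φ) (x₀ : V) : Continuous (minkowskiIntegrand g δ φ ν x₀) := by
  have h1 := hν.continuous_meanCurvature h
  have h2 := h.contMDiff.continuous
  have h3 := hν.contMDiff.continuous
  unfold minkowskiIntegrand
  fun_prop

/-- The coefficients solve the normal equations for the orthogonal projection of `X` to the tangent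
space. -/
theorem inner_fderiv_tangentialCoeff {ψ : EuclideanSpace ℝ (Fin n) → V}
    {y : EuclideanSpace ℝ (Fin n)} (hli : LinearIndependent ℝ (partialDeriv ψ y)) (X : V)
    (u : EuclideanSpace ℝ (Fin n)) :
    inner ℝ (fderiv ℝ ψ y (∑ i, tangentialCoeff ψ X y i • EuclideanSpace.single i (1 : ℝ)))
      (fderiv ℝ ψ y u) = inner ℝ X (fderiv ℝ ψ y u) := by
  have hdet := pairingMatrix_self_det_pos hli
  have hGP := Matrix.mul_nonsing_inv _ (isUnit_iff_ne_zero.2 hdet.ne')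
  have key : ∀ k, inner ℝ (fderiv ℝ ψ y (∑ i, tangentialCoeff ψ X y i •
      EuclideanSpace.single i (1 : ℝ))) (partialDeriv ψ y k) = inner ℝ X (partialDeriv ψ y k) := by
    intro k
    rw [map_sum, sum_inner]
    simp only [map_smul, inner_smul_left, conj_trivial, tangentialCoeff, Finset.sum_mul]
    rw [Finset.sum_comm]
    have h1 : ∀ j, ∑ i, pairingMatrix ψ ψ y k i * (pairingMatrix ψ ψ y)⁻¹ i j =
        if k = j then 1 else 0 := fun j => by
      rw [← Matrix.mul_apply, hGP, Matrix.one_apply]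
    calc _ = ∑ j, (∑ i, pairingMatrix ψ ψ y k i * (pairingMatrix ψ ψ y)⁻¹ i j) *
          inner ℝ (partialDeriv ψ y j) X := by
          refine Finset.sum_congr rfl fun j _ => ?_
          rw [Finset.sum_mul]
          refine Finset.sum_congr rfl fun i _ => ?_
          have : pairingMatrix ψ ψ y k i = inner ℝ (fderiv ℝ ψ y (EuclideanSpace.single i 1))
            (partialDeriv ψ y k) := real_inner_comm _ _
          rw [this]
          ring
      _ = _ := by
          simp [h1, real_inner_comm X]
  generalize (∑ i, tangentialCoeff ψ X y i • EuclideanSpace.single i (1 : ℝ)) = w at key ⊢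
  conv_lhs => rw [EuclideanSpace.eq_sum_smul_single u]
  conv_rhs => rw [EuclideanSpace.eq_sum_smul_single u]
  simp only [map_sum, inner_sum, map_smul, inner_smul_right]
  exact Finset.sum_congr rfl fun k _ => congrArg _ (key k)

variable (n) in
/-- The tangential component of the position vector `φ - x₀`. -/
def tangentialPart (φ : M → V) (x₀ : V) (x : M) : TangentSpace (𝓡 n) x :=
  chartSymmDeriv (chartAt (EuclideanSpace ℝ (Fin n)) x)
    (chartAt (EuclideanSpace ℝ (Fin n)) x x)
    (∑ i, tangentialCoeff (φ ∘ (chartAt (EuclideanSpace ℝ (Fin n)) x).symm) (φ x - x₀)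
      (chartAt (EuclideanSpace ℝ (Fin n)) x x) i • EuclideanSpace.single i (1 : ℝ))

theorem IsIsometricImmersion.inner_pushforward_chartSymmDeriv (h : IsIsometricImmersion g φ)
    (he : e ∈ IsManifold.maximalAtlas (𝓡 n) ∞ M) {y : EuclideanSpace ℝ (Fin n)}
    (hy : y ∈ e.target) (X : V) (u : TangentSpace (𝓡 n) (e.symm y)) :
    inner ℝ (pushforward φ (e.symm y) (chartSymmDeriv e y
      (∑ i, tangentialCoeff (φ ∘ e.symm) X y i • EuclideanSpace.single i (1 : ℝ))))
      (pushforward φ (e.symm y) u) = inner ℝ X (pushforward φ (e.symm y) u) := by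
  obtain ⟨v, rfl⟩ := chartSymmDeriv_surjective he hy u
  rw [pushforward_chartSymmDeriv he hy (h.mdifferentiableAt _),
    pushforward_chartSymmDeriv he hy (h.mdifferentiableAt _)]
  exact inner_fderiv_tangentialCoeff (h.linearIndependent he hy) X v

theorem IsIsometricImmersion.inner_pushforward_tangentialPart (h : IsIsometricImmersion g φ)
    (x₀ : V) (x : M) (u : TangentSpace (𝓡 n) x) :
    inner ℝ (pushforward φ x (tangentialPart n φ x₀ x)) (pushforward φ x u) =
      inner ℝ (φ x - x₀) (pushforward φ x u) := by
  have hx : x ∈ (chartAt (EuclideanSpace ℝ (Fin n)) x).source := mem_chart_source _ x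
  have hl := (chartAt (EuclideanSpace ℝ (Fin n)) x).left_inv hx
  have := h.inner_pushforward_chartSymmDeriv (IsManifold.chart_mem_maximalAtlas x)
    ((chartAt (EuclideanSpace ℝ (Fin n)) x).map_source hx) (φ x - x₀)
  rw [hl] at this
  exact this u

/-- The definition uses the preferred chart at each point, but the vector is determined by its inner
products with tangent vectors, so every chart yields the same one. -/
theorem IsIsometricImmersion.tangentialPart_eq (h : IsIsometricImmersion g φ)
    (he : e ∈ IsManifold.maximalAtlas (𝓡 n) ∞ M) {y : EuclideanSpace ℝ (Fin n)}
    (hy : y ∈ e.target) (x₀ : V) :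
    tangentialPart n φ x₀ (e.symm y) = chartSymmDeriv e y
      (∑ i, tangentialCoeff (φ ∘ e.symm) ((φ ∘ e.symm) y - x₀) y i •
        EuclideanSpace.single i (1 : ℝ)) := by
  let w : TangentSpace (𝓡 n) (e.symm y) := chartSymmDeriv e y
    (∑ i, tangentialCoeff (φ ∘ e.symm) ((φ ∘ e.symm) y - x₀) y i •
      EuclideanSpace.single i (1 : ℝ))
  have hw : ∀ u, inner ℝ (pushforward φ (e.symm y) w) (pushforward φ (e.symm y) u) =
      inner ℝ ((φ ∘ e.symm) y - x₀) (pushforward φ (e.symm y) u) :=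
    h.inner_pushforward_chartSymmDeriv he hy _
  have hsub : pushforward φ (e.symm y) (tangentialPart n φ x₀ (e.symm y) - w) =
      pushforward φ (e.symm y) (tangentialPart n φ x₀ (e.symm y)) -
        pushforward φ (e.symm y) w := map_sub (mfderiv (𝓡 n) 𝓘(ℝ, V) φ (e.symm y)) _ _
  refine eq_of_sub_eq_zero (h.pushforward_injective (e.symm y) ?_ :
    tangentialPart n φ x₀ (e.symm y) - w = 0)
  rw [← inner_self_eq_zero (𝕜 := ℝ)]
  nth_rewrite 1 [hsub]
  rw [inner_sub_left, h.inner_pushforward_tangentialPart, hw]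
  exact sub_self _

theorem IsIsometricImmersion.pushforward_tangentialPart (h : IsIsometricImmersion g φ)
    (he : e ∈ IsManifold.maximalAtlas (𝓡 n) ∞ M) {y : EuclideanSpace ℝ (Fin n)}
    (hy : y ∈ e.target) (x₀ : V) {η : M → ℝ} (hη : ContMDiff (𝓡 n) 𝓘(ℝ, ℝ) ∞ η) :
    pushforward η (e.symm y) (tangentialPart n φ x₀ (e.symm y)) =
      ∑ i, tangentialCoeff (φ ∘ e.symm) ((φ ∘ e.symm) y - x₀) y i *
        fderiv ℝ (η ∘ e.symm) y (EuclideanSpace.single i (1 : ℝ)) := by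
  rw [h.tangentialPart_eq he hy,
    pushforward_chartSymmDeriv he hy ((hη _).mdifferentiableAt (by simp)), map_sum]
  simp only [map_smul, smul_eq_mul]

theorem IsIsometricImmersion.continuous_pushforward_tangentialPart
    (h : IsIsometricImmersion g φ) (x₀ : V) {η : M → ℝ} (hη : ContMDiff (𝓡 n) 𝓘(ℝ, ℝ) ∞ η) :
    Continuous fun x => pushforward η x (tangentialPart n φ x₀ x) := by
  refine continuous_iff_continuousAt.2 fun x => ?_
  set e := chartAt (EuclideanSpace ℝ (Fin n)) x with he
  have hmem : e ∈ IsManifold.maximalAtlas (𝓡 n) ∞ M := IsManifold.chart_mem_maximalAtlas x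
  have hx : x ∈ e.source := mem_chart_source _ x
  refine continuousAt_of_comp_chart_symm hx ?_
  have hy := e.map_source hx
  have hψ := h.contDiffAt hmem hy
  have hη' : ContDiffAt ℝ ∞ (η ∘ e.symm) (e x) := contDiffAt_comp_chart_symm hmem hy (hη _)
  have hc : ContinuousAt (fun y => ∑ i, tangentialCoeff (φ ∘ e.symm) ((φ ∘ e.symm) y - x₀) y i *
        fderiv ℝ (η ∘ e.symm) y (EuclideanSpace.single i (1 : ℝ))) (e x) :=
    tendsto_finsetSum _ fun i _ => Filter.Tendsto.mul
      (contDiffAt_tangentialCoeff hψ (hψ.sub contDiffAt_const)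
        (h.linearIndependent hmem hy) i).continuousAt
      (contDiffAt_partialDeriv hη' i).continuousAt
  refine hc.congr ?_
  filter_upwards [e.open_target.mem_nhds hy] with z hz
  exact (h.pushforward_tangentialPart hmem hz x₀ hη).symm

end UnitNormal

/-! ### Integration of the divergence over the closed manifold. -/

section Minkowski

/-- Integration by parts against the constant 1. -/
theorem integral_fderiv_eq_zero {n : ℕ} {f : EuclideanSpace ℝ (Fin n) → ℝ}
    (hf : ContDiff ℝ ∞ f) (hc : HasCompactSupport f) (v : EuclideanSpace ℝ (Fin n)) :
    ∫ y, fderiv ℝ f y v = 0 := by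
  have hcont : Continuous fun y => fderiv ℝ f y v :=
    (hf.continuous_fderiv (by simp)).clm_apply continuous_const
  have hcs : HasCompactSupport fun y => fderiv ℝ f y v :=
    (hc.fderiv (𝕜 := ℝ)).comp_left (g := fun L : EuclideanSpace ℝ (Fin n) →L[ℝ] ℝ => L v) rfl
  have h := integral_mul_fderiv_eq_neg_fderiv_mul_of_integrable (μ := volume)
    (f := fun _ : EuclideanSpace ℝ (Fin n) => (1 : ℝ)) (g := f) (v := v)
    (by simp) (by simpa using hcont.integrable_of_hasCompactSupport hcs)
    (by simpa using hf.continuous.integrable_of_hasCompactSupport hc)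
    (fun _ _ => differentiableAt_const _)
    (fun x _ => (hf.differentiable (by simp)) x)
  simpa using h

variable {n : ℕ} {M : Type*} [TopologicalSpace M] [CompactSpace M]
  [ChartedSpace (EuclideanSpace ℝ (Fin n)) M]
  [IsManifold (𝓡 n) ∞ M]
  {V : Type*} [NormedAddCommGroup V] [InnerProductSpace ℝ V]
  {e : OpenPartialHomeomorph M (EuclideanSpace ℝ (Fin n))}
  {g : Bundle.ContMDiffRiemannianMetric (𝓡 n) ∞ (EuclideanSpace ℝ (Fin n))
      (TangentSpace (𝓡 n) : M → Type _)} {φ ν : M → V} {δ : ℝ}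

/-- Functions supported in the domain of a chart have integral zero divergence. -/
theorem integral_fderiv_chart_eq_zero (he : e ∈ IsManifold.maximalAtlas (𝓡 n) ∞ M) {η : M → ℝ}
    (hη : ContMDiff (𝓡 n) 𝓘(ℝ, ℝ) ∞ η) (hsupp : tsupport η ⊆ e.source)
    {F : EuclideanSpace ℝ (Fin n) → ℝ} (hF : ∀ y ∈ e.target, ContDiffAt ℝ ∞ F y)
    (v : EuclideanSpace ℝ (Fin n)) :
    IntegrableOn (fun y => fderiv ℝ (fun z => (η ∘ e.symm) z * F z) y v) e.target ∧
      ∫ y in e.target, fderiv ℝ (fun z => (η ∘ e.symm) z * F z) y v = 0 := by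
  classical
  -- The extension by zero is smooth on all of ℝⁿ because the support of `η` is a compact subset of
  -- the chart domain.
  set f : EuclideanSpace ℝ (Fin n) → ℝ := e.target.indicator fun z => (η ∘ e.symm) z * F z with hf
  have hK : IsCompact (e '' tsupport η) :=
    (isClosed_tsupport η).isCompact.image_of_continuousOn (e.continuousOn.mono hsupp)
  have hKt : e '' tsupport η ⊆ e.target := by
    rintro _ ⟨x, hx, rfl⟩
    exact e.map_source (hsupp hx)
  have hf0 : ∀ y ∉ e '' tsupport η, f y = 0 := by
    intro y hy
    by_cases hyt : y ∈ e.target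
    · have : e.symm y ∉ tsupport η := fun hmem => hy ⟨_, hmem, e.right_inv hyt⟩
      simp [hf, Set.indicator_of_mem hyt, image_eq_zero_of_notMem_tsupport this]
    · exact Set.indicator_of_notMem hyt _
  have hev : ∀ y ∈ e.target, f =ᶠ[nhds y] fun z => (η ∘ e.symm) z * F z := fun y hy => by
    filter_upwards [e.open_target.mem_nhds hy] with z hz using Set.indicator_of_mem hz _
  have hev0 : ∀ y ∉ e '' tsupport η, f =ᶠ[nhds y] fun _ => 0 := fun y hy => by
    filter_upwards [hK.isClosed.isOpen_compl.mem_nhds hy] with z hz using hf0 z hz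
  have hsm : ContDiff ℝ ∞ f := contDiff_iff_contDiffAt.2 fun y => by
    by_cases hyt : y ∈ e.target
    · exact ((contDiffAt_comp_chart_symm he hyt (hη _)).mul (hF y hyt)).congr_of_eventuallyEq
        (hev y hyt)
    · exact contDiffAt_const.congr_of_eventuallyEq (hev0 y fun hmem => hyt (hKt hmem))
  have hcs : HasCompactSupport f := HasCompactSupport.intro hK hf0
  have hcont : Continuous fun y => fderiv ℝ f y v :=
    (hsm.continuous_fderiv (by simp)).clm_apply continuous_const
  have hcs' : HasCompactSupport fun y => fderiv ℝ f y v :=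
    (hcs.fderiv (𝕜 := ℝ)).comp_left (g := fun L : EuclideanSpace ℝ (Fin n) →L[ℝ] ℝ => L v) rfl
  have hint := hcont.integrable_of_hasCompactSupport (μ := volume) hcs'
  have heq : Set.EqOn (fun y => fderiv ℝ f y v)
      (fun y => fderiv ℝ (fun z => (η ∘ e.symm) z * F z) y v) e.target := fun y hy => by
    simp only [(hev y hy).fderiv_eq]
  refine ⟨hint.integrableOn.congr_fun heq e.open_target.measurableSet, ?_⟩
  rw [← setIntegral_congr_fun e.open_target.measurableSet heq,
    setIntegral_eq_integral_of_forall_compl_eq_zero, integral_fderiv_eq_zero hsm hcs]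
  intro y hy
  rw [(hev0 y fun hmem => hy (hKt hmem)).fderiv_eq]
  simp

variable [MeasurableSpace M] [BorelSpace M]

/-- The integrand is div(η Xᵀ) = η div Xᵀ + dη(Xᵀ), where Xᵀ is the tangential part of φ - x₀ and η
Xᵀ is supported in one chart. -/
theorem IsUnitNormal.integral_mul_minkowskiIntegrand (hν : IsUnitNormal n δ φ ν)
    (h : IsIsometricImmersion g φ) (hn : n ≠ 0) (x₀ : V) (x : M) {η : M → ℝ}
    (hη : ContMDiff (𝓡 n) 𝓘(ℝ, ℝ) ∞ η)
    (hsupp : tsupport η ⊆ (chartAt (EuclideanSpace ℝ (Fin n)) x).source) :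
    ∫ y, (n * (η y * minkowskiIntegrand g δ φ ν x₀ y) + pushforward η y (tangentialPart n φ x₀ y))
      ∂(riemannianVolume g) = 0 := by
  set e := chartAt (EuclideanSpace ℝ (Fin n)) x with hedef
  have he : e ∈ IsManifold.maximalAtlas (𝓡 n) ∞ M := IsManifold.chart_mem_maximalAtlas x
  have hcont : Continuous fun y => n * (η y * minkowskiIntegrand g δ φ ν x₀ y) +
      pushforward η y (tangentialPart n φ x₀ y) :=
    (continuous_const.mul (hη.continuous.mul (hν.continuous_minkowskiIntegrand h x₀))).add
      (h.continuous_pushforward_tangentialPart x₀ hη)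
  have hzero : ∀ y ∉ e.source, n * (η y * minkowskiIntegrand g δ φ ν x₀ y) +
      pushforward η y (tangentialPart n φ x₀ y) = 0 := by
    intro y hy
    have hy' : y ∉ tsupport η := fun hmem => hy (hsupp hmem)
    have h1 : η =ᶠ[nhds y] fun _ => (0 : ℝ) := notMem_tsupport_iff_eventuallyEq.1 hy'
    have h2 : pushforward η y (tangentialPart n φ x₀ y) = 0 := by
      simp only [pushforward]
      rw [h1.mfderiv_eq, mfderiv_const]
      rfl
    rw [h2, h1.self_of_nhds]
    simp
  rw [h.integral_eq x hcont.aestronglyMeasurable hzero]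
  have hF : ∀ i, ∀ y ∈ e.target, ContDiffAt ℝ ∞ (fun z => gramDensity (φ ∘ e.symm) z *
      tangentialCoeff (φ ∘ e.symm) ((φ ∘ e.symm) z - x₀) z i) y := fun i y hy =>
    (contDiffAt_gramDensity (h.contDiffAt he hy) (h.linearIndependent he hy)).mul
      (contDiffAt_tangentialCoeff (h.contDiffAt he hy)
        ((h.contDiffAt he hy).sub contDiffAt_const) (h.linearIndependent he hy) i)
  have hpt : Set.EqOn (fun y => gramDensity (φ ∘ e.symm) y *
      (n * (η (e.symm y) * minkowskiIntegrand g δ φ ν x₀ (e.symm y)) +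
        pushforward η (e.symm y) (tangentialPart n φ x₀ (e.symm y))))
      (fun y => ∑ i, fderiv ℝ (fun z => (η ∘ e.symm) z * (gramDensity (φ ∘ e.symm) z *
        tangentialCoeff (φ ∘ e.symm) ((φ ∘ e.symm) z - x₀) z i)) y
          (EuclideanSpace.single i (1 : ℝ))) e.target := by
    intro y hy
    have hηd : DifferentiableAt ℝ (η ∘ e.symm) y :=
      (contDiffAt_comp_chart_symm he hy (hη _)).differentiableAt (by simp)
    have hterm : ∀ i, fderiv ℝ (fun z => (η ∘ e.symm) z * (gramDensity (φ ∘ e.symm) z *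
        tangentialCoeff (φ ∘ e.symm) ((φ ∘ e.symm) z - x₀) z i)) y
          (EuclideanSpace.single i (1 : ℝ)) =
        η (e.symm y) * fderiv ℝ (fun z => gramDensity (φ ∘ e.symm) z *
          tangentialCoeff (φ ∘ e.symm) ((φ ∘ e.symm) z - x₀) z i) y
            (EuclideanSpace.single i (1 : ℝ)) +
        gramDensity (φ ∘ e.symm) y * (tangentialCoeff (φ ∘ e.symm) ((φ ∘ e.symm) y - x₀) y i *
          fderiv ℝ (η ∘ e.symm) y (EuclideanSpace.single i (1 : ℝ))) := fun i => by
      rw [fderiv_fun_mul hηd ((hF i y hy).differentiableAt (by simp)), add_apply, smul_apply,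
        smul_apply]
      simp only [smul_eq_mul, Function.comp_apply]
      ring
    simp only [hterm]
    rw [Finset.sum_add_distrib, ← Finset.mul_sum, ← Finset.mul_sum, hν.divergence h hn he hy,
      h.pushforward_tangentialPart he hy x₀ hη]
    ring
  rw [setIntegral_congr_fun e.open_target.measurableSet hpt, integral_finsetSum]
  · exact Finset.sum_eq_zero fun i _ =>
      (integral_fderiv_chart_eq_zero he hη hsupp (hF i) _).2
  · exact fun i _ => (integral_fderiv_chart_eq_zero he hη hsupp (hF i) _).1

/-- The Minkowski formula. -/
theorem IsUnitNormal.integral_minkowskiIntegrand [T2Space M] (hν : IsUnitNormal n δ φ ν)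
    (h : IsIsometricImmersion g φ) (hn : n ≠ 0) (x₀ : V) :
    ∫ y, minkowskiIntegrand g δ φ ν x₀ y ∂(riemannianVolume g) = 0 := by
  have := h.isFiniteMeasure
  obtain ⟨t, ht⟩ := isCompact_univ.elim_finite_subcover
    (fun x : M => (chartAt (EuclideanSpace ℝ (Fin n)) x).source)
    (fun x => (chartAt (EuclideanSpace ℝ (Fin n)) x).open_source)
    (fun x _ => Set.mem_iUnion.2 ⟨x, mem_chart_source _ x⟩)
  obtain ⟨ρ, hρ⟩ := SmoothPartitionOfUnity.exists_isSubordinate (𝓡 n) (isClosed_univ (X := M))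
    (fun x : t => (chartAt (EuclideanSpace ℝ (Fin n)) (x : M)).source)
    (fun x => (chartAt (EuclideanSpace ℝ (Fin n)) (x : M)).open_source)
    (fun x hx => by
      obtain ⟨i, hi⟩ := Set.mem_iUnion.1 (ht hx)
      obtain ⟨hit, hxi⟩ := Set.mem_iUnion.1 hi
      exact Set.mem_iUnion.2 ⟨⟨i, hit⟩, hxi⟩)
  have hη : ∀ k, ContMDiff (𝓡 n) 𝓘(ℝ, ℝ) ∞ (ρ k) := fun k => (ρ k).contMDiff
  have hsum : ∀ x, ∑ k, ρ k x = 1 := fun x => by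
    rw [← finsum_eq_sum_of_fintype]
    exact ρ.sum_eq_one (Set.mem_univ x)
  -- The functions of the partition sum to 1, so the terms with their differentials cancel.
  have hgrad : ∀ x, ∑ k, pushforward (ρ k) x (tangentialPart n φ x₀ x) = 0 := by
    intro x
    set e := chartAt (EuclideanSpace ℝ (Fin n)) x with hedef
    have he : e ∈ IsManifold.maximalAtlas (𝓡 n) ∞ M := IsManifold.chart_mem_maximalAtlas x
    have hx : x ∈ e.source := mem_chart_source _ x
    have hy := e.map_source hx
    have hd : ∀ k, DifferentiableAt ℝ (ρ k ∘ e.symm) (e x) := fun k =>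
      (contDiffAt_comp_chart_symm he hy ((hη k) _)).differentiableAt (by simp)
    have hk : ∀ k, pushforward (ρ k) x (tangentialPart n φ x₀ x) =
        ∑ i, tangentialCoeff (φ ∘ e.symm) ((φ ∘ e.symm) (e x) - x₀) (e x) i *
          fderiv ℝ (ρ k ∘ e.symm) (e x) (EuclideanSpace.single i (1 : ℝ)) := fun k => by
      have := h.pushforward_tangentialPart he hy x₀ (hη k)
      rwa [e.left_inv hx] at this
    simp only [hk]
    rw [Finset.sum_comm]
    refine Finset.sum_eq_zero fun i _ => ?_
    rw [← Finset.mul_sum, ← sum_apply, ← fderiv_fun_sum fun k _ => hd k]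
    have : (fun y => ∑ k, (ρ k ∘ e.symm) y) = fun _ => (1 : ℝ) := funext fun y => hsum _
    rw [this]
    simp
  have hm := hν.continuous_minkowskiIntegrand h x₀
  have hn' : (n : ℝ) ≠ 0 := Nat.cast_ne_zero.2 hn
  have hpt : ∀ x, n * minkowskiIntegrand g δ φ ν x₀ x =
      ∑ k, (n * (ρ k x * minkowskiIntegrand g δ φ ν x₀ x) +
        pushforward (ρ k) x (tangentialPart n φ x₀ x)) := fun x => by
    rw [Finset.sum_add_distrib, hgrad, ← Finset.mul_sum, ← Finset.sum_mul, hsum]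
    ring
  have hzero : ∫ y, n * minkowskiIntegrand g δ φ ν x₀ y ∂(riemannianVolume g) = 0 := by
    simp only [hpt]
    rw [integral_finsetSum]
    · exact Finset.sum_eq_zero fun k _ =>
        hν.integral_mul_minkowskiIntegrand h hn x₀ k (hη k) (hρ k)
    · intro k _
      refine Continuous.integrable_of_hasCompactSupport ?_ (HasCompactSupport.of_compactSpace _)
      exact (continuous_const.mul ((hη k).continuous.mul hm)).add
        (h.continuous_pushforward_tangentialPart x₀ (hη k))
  rw [integral_const_mul] at hzero
  exact (mul_eq_zero.1 hzero).resolve_left hn'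

/-- Where the distance of the hypersurface from `x₀` is locally constant, the integrand of the
Minkowski formula vanishes. -/
theorem IsUnitNormal.minkowskiIntegrand_eq_zero (hν : IsUnitNormal n δ φ ν)
    (h : IsIsometricImmersion g φ) (hn : n ≠ 0) {x₀ : V} {x : M} {r : ℝ}
    (hr : ∀ᶠ y in nhds x, ‖φ y - x₀‖ = r) : minkowskiIntegrand g δ φ ν x₀ x = 0 := by
  set e := chartAt (EuclideanSpace ℝ (Fin n)) x with hedef
  have he : e ∈ IsManifold.maximalAtlas (𝓡 n) ∞ M := IsManifold.chart_mem_maximalAtlas x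
  have hx : x ∈ e.source := mem_chart_source _ x
  have hy := e.map_source hx
  have hr' : ∀ᶠ z in nhds (e x), ‖(φ ∘ e.symm) z - x₀‖ = r := by
    have hc : Filter.Tendsto e.symm (nhds (e x)) (nhds x) := by
      have := e.continuousAt_symm hy
      rwa [ContinuousAt, e.left_inv hx] at this
    exact hc.eventually hr
  -- Constant distance makes φ - x₀ normal near the point, so the tangential field is zero there.
  -- Its divergence is a nonzero multiple of the integrand.
  have hF : ∀ i, (fun z => gramDensity (φ ∘ e.symm) z *
      tangentialCoeff (φ ∘ e.symm) ((φ ∘ e.symm) z - x₀) z i) =ᶠ[nhds (e x)] fun _ => 0 := by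
    intro i
    filter_upwards [hr'.eventually_nhds, e.open_target.mem_nhds hy] with z hz hzt
    have hj : ∀ j, inner ℝ (partialDeriv (φ ∘ e.symm) z j) ((φ ∘ e.symm) z - x₀) = 0 := fun j =>
      inner_fderiv_eq_zero_of_norm_eq ((h.contDiffAt he hzt).differentiableAt (by simp)) hz _
    simp only [tangentialCoeff, hj, mul_zero, Finset.sum_const_zero]
  have hdiv := hν.divergence h hn he hy x₀
  have hzero : ∀ i, fderiv ℝ (fun z => gramDensity (φ ∘ e.symm) z *
      tangentialCoeff (φ ∘ e.symm) ((φ ∘ e.symm) z - x₀) z i) (e x)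
        (EuclideanSpace.single i (1 : ℝ)) = 0 := fun i => by
    rw [(hF i).fderiv_eq]
    simp
  simp only [hzero, Finset.sum_const_zero, e.left_inv hx] at hdiv
  have hW := (gramDensity_pos (h.linearIndependent he hy)).ne'
  have hn' : (n : ℝ) ≠ 0 := Nat.cast_ne_zero.2 hn
  exact (mul_eq_zero.1 hdiv.symm).resolve_left (mul_ne_zero hn' hW)

end Minkowski

end

/-! ### Immersions into a round sphere of the same dimension. -/

section SphereCovering

/-- The complement of a countable set in ℝⁿ is connected for n ≥ 2, so small neighbourhoods in `M`
stay connected without `s`. A separation of `sᶜ` would therefore extend to one of `M`. -/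
theorem isPreconnected_compl_of_countable {n : ℕ} (hn : 2 ≤ n) {M : Type*} [TopologicalSpace M]
    [PreconnectedSpace M] [ChartedSpace (EuclideanSpace ℝ (Fin n)) M] {s : Set M}
    (hs : s.Countable) : IsPreconnected sᶜ := by
  have hrank : 1 < Module.rank ℝ (EuclideanSpace ℝ (Fin n)) := by
    apply Module.one_lt_rank_of_one_lt_finrank
    rw [finrank_euclideanSpace_fin]
    omega
  have hlocal : ∀ (x : M), ∀ N ∈ nhds x, ∃ B ∈ nhds x, B ⊆ N ∧ IsConnected (B ∩ sᶜ) := by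
    intro x N hN
    set e := chartAt (EuclideanSpace ℝ (Fin n)) x with hedef
    have hx : x ∈ e.source := mem_chart_source _ x
    have hNe : e.target ∩ e.symm ⁻¹' N ∈ nhds (e x) := by
      refine Filter.inter_mem (e.open_target.mem_nhds (e.map_source hx)) ?_
      apply e.continuousAt_symm (e.map_source hx)
      rwa [e.left_inv hx]
    obtain ⟨r, hr, hball⟩ := Metric.mem_nhds_iff.1 hNe
    refine ⟨e.source ∩ e ⁻¹' Metric.ball (e x) r,
      (e.isOpen_inter_preimage Metric.isOpen_ball).mem_nhds ⟨hx, Metric.mem_ball_self hr⟩,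
      fun z hz => ?_, ?_⟩
    · have := (hball hz.2).2
      rwa [Set.mem_preimage, e.left_inv hz.1] at this
    -- `j` identifies the whole of ℝⁿ with the ball, so the result for countable sets in ℝⁿ applies.
    · set j := OpenPartialHomeomorph.univBall (e x) r with hj
      have hjt : j.target = Metric.ball (e x) r := OpenPartialHomeomorph.univBall_target _ hr
      have hjs : j.source = Set.univ := OpenPartialHomeomorph.univBall_source _ _
      have hjmem : ∀ z, j z ∈ Metric.ball (e x) r := fun z =>
        hjt ▸ j.map_source (hjs ▸ Set.mem_univ z)
      have hinj : Function.Injective (e.symm ∘ j) := fun a b hab =>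
        j.injOn (hjs ▸ Set.mem_univ a) (hjs ▸ Set.mem_univ b)
          (e.symm.injOn (hball (hjmem a)).1 (hball (hjmem b)).1 hab)
      have hcont : Continuous (e.symm ∘ j) :=
        e.continuousOn_symm.comp_continuous (OpenPartialHomeomorph.continuous_univBall _ _)
          fun z => (hball (hjmem z)).1
      have hc := (Set.Countable.isConnected_compl_of_one_lt_rank hrank
        (hs.preimage hinj)).image _ hcont.continuousOn
      convert! hc
      ext z
      constructor
      · rintro ⟨⟨hz1, hz2⟩, hz3⟩
        have hz4 : e z ∈ j.target := hjt ▸ hz2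
        have hz5 : (e.symm ∘ j) (j.symm (e z)) = z := by
          rw [Function.comp_apply, j.right_inv hz4, e.left_inv hz1]
        refine ⟨j.symm (e z), ?_, hz5⟩
        rw [Set.mem_compl_iff, Set.mem_preimage, hz5]
        exact hz3
      · rintro ⟨w, hw, rfl⟩
        refine ⟨⟨e.map_target (hball (hjmem w)).1, ?_⟩, hw⟩
        rw [Set.mem_preimage, Function.comp_apply, e.right_inv (hball (hjmem w)).1]
        exact hjmem w
  rw [isPreconnected_iff_subset_of_disjoint]
  intro u v hu hv huv hdisj
  -- The points near which `sᶜ` lies in `u`, respectively in `v`, form open sets. They cover `M`,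
  -- and they are disjoint because no neighbourhood is contained in `s`.
  have hU : IsOpen {p : M | ∀ᶠ y in nhds p, y ∈ sᶜ → y ∈ u} := isOpen_setOfPred_eventually_nhds
  have hV : IsOpen {p : M | ∀ᶠ y in nhds p, y ∈ sᶜ → y ∈ v} := isOpen_setOfPred_eventually_nhds
  have hcover : (Set.univ : Set M) ⊆ {p : M | ∀ᶠ y in nhds p, y ∈ sᶜ → y ∈ u} ∪
      {p : M | ∀ᶠ y in nhds p, y ∈ sᶜ → y ∈ v} := by
    intro p _
    obtain ⟨B, hB, -, hBc⟩ := hlocal p Set.univ Filter.univ_mem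
    have := isPreconnected_iff_subset_of_disjoint.1 hBc.isPreconnected u v hu hv
      (Set.inter_subset_right.trans huv)
      (Set.subset_eq_empty (Set.inter_subset_inter_left _ Set.inter_subset_right) hdisj)
    rcases this with h | h
    · exact Or.inl (Filter.mem_of_superset hB fun y hy hys => h ⟨hy, hys⟩)
    · exact Or.inr (Filter.mem_of_superset hB fun y hy hys => h ⟨hy, hys⟩)
  have hempty : (Set.univ : Set M) ∩ ({p : M | ∀ᶠ y in nhds p, y ∈ sᶜ → y ∈ u} ∩
      {p : M | ∀ᶠ y in nhds p, y ∈ sᶜ → y ∈ v}) = ∅ := by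
    rw [Set.eq_empty_iff_forall_notMem]
    rintro p ⟨-, hpu, hpv⟩
    obtain ⟨B, hB, hBN, hBc⟩ := hlocal p _ (Filter.inter_mem hpu hpv)
    obtain ⟨y, hyB, hys⟩ := hBc.nonempty
    have : y ∈ sᶜ ∩ (u ∩ v) := ⟨hys, (hBN hyB).1 hys, (hBN hyB).2 hys⟩
    rw [hdisj] at this
    exact this
  rcases isPreconnected_iff_subset_of_disjoint.1 isPreconnected_univ _ _ hU hV hcover hempty
    with h | h
  · exact Or.inl fun p hp => (h (Set.mem_univ p)).self_of_nhds hp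
  · exact Or.inr fun p hp => (h (Set.mem_univ p)).self_of_nhds hp

variable {W : Type*} [NormedAddCommGroup W] [InnerProductSpace ℝ W]

/-- A local homeomorphism from a compact connected manifold of dimension at least two to a
round sphere is injective. -/
theorem IsLocalHomeomorph.injective_of_sphere {n : ℕ} (hn : 2 ≤ n) {M : Type*}
    [TopologicalSpace M] [T2Space M] [CompactSpace M] [PreconnectedSpace M]
    [ChartedSpace (EuclideanSpace ℝ (Fin n)) M] {F : M → Metric.sphere (0 : W) 1}
    (hF : IsLocalHomeomorph F) : Function.Injective F := by
  -- By compactness `F` is a covering. Let `v` be the antipode of `F x`. The sphere without `v` is a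
  -- vector space by stereographic projection, so maps from it lift through `F`. The ranges of the
  -- lifts are open, pairwise equal or disjoint, and cover the complement of the finite fibre over
  -- `v`. That complement is connected, so one sheet is all of it, and `F` is injective on a sheet.
  have cov : IsCoveringMap F := isLocalHomeomorph_iff_isCoveringMap.1 hF
  intro x y hxy
  set v : Metric.sphere (0 : W) 1 := -F x with hv
  have hv1 : ‖(v : W)‖ = 1 := norm_eq_of_mem_sphere v
  have hxv : F x ≠ v := ne_neg_of_mem_unit_sphere ℝ (F x)
  have hfin : (F ⁻¹' {v}).Finite :=
    (isClosed_singleton.preimage hF.continuous).isCompact.finite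
      (.of_openPartialHomeomorph F subset_rfl fun e _ => by
        obtain ⟨φ, h1, h2⟩ := hF e
        exact ⟨φ, h1, h2.symm⟩)
  have hN : IsPreconnected (F ⁻¹' {v})ᶜ := isPreconnected_compl_of_countable hn hfin.countable
  set σ := stereographic hv1 with hσ
  have hemb : Topology.IsOpenEmbedding σ.symm := isOpenEmbedding_stereographic_symm hv1
  let j : C((ℝ ∙ (v : W))ᗮ, Metric.sphere (0 : W) 1) := ⟨σ.symm, hemb.continuous⟩
  have hlift : ∀ z : M, ∃ L : C((ℝ ∙ (v : W))ᗮ, M), F z ≠ v → L (σ (F z)) = z ∧ F ∘ L = j := by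
    intro z
    -- The constant map is a filler; every use of `L z` has `F z ≠ v`.
    by_cases hz : F z = v
    · exact ⟨ContinuousMap.const _ z, fun h => absurd hz h⟩
    · have hz' : F z = j (σ (F z)) := (σ.left_inv (by simpa [hσ] using hz)).symm
      obtain ⟨L, hL, -⟩ := cov.existsUnique_continuousMap_lifts j (σ (F z)) z hz'
      exact ⟨L, fun _ => hL⟩
  choose L hL using hlift
  have hopen : ∀ z, F z ≠ v → IsOpen (Set.range (L z)) := fun z hz => by
    have hcomp : IsLocalHomeomorph (F ∘ L z) := by
      rw [(hL z hz).2]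
      exact hemb.isLocalHomeomorph
    exact (IsLocalHomeomorph.of_comp hcomp hF (L z).continuous).isOpenMap.isOpen_range
  have hself : ∀ z, F z ≠ v → z ∈ Set.range (L z) := fun z hz => ⟨_, (hL z hz).1⟩
  -- Lifts whose ranges meet agree at a point, as `j` is injective, and then everywhere by
  -- uniqueness of lifts.
  have hmeet : ∀ z w a b, F z ≠ v → F w ≠ v → L z a = L w b → L z = L w := by
    intro z w a b hz hw hab
    have hzF := congrFun (hL z hz).2
    have hwF := congrFun (hL w hw).2
    have hjab : j a = j b := by
      rw [← hzF, ← hwF, Function.comp_apply, Function.comp_apply, hab]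
    have hab' : a = b := hemb.injective hjab
    subst hab'
    exact (cov.existsUnique_continuousMap_lifts j a (L z a) (hzF a)).unique
      ⟨rfl, (hL z hz).2⟩ ⟨hab.symm, (hL w hw).2⟩
  set T : Set M := ⋃ z ∈ {z | F z ≠ v ∧ z ∉ Set.range (L x)}, Set.range (L z) with hT
  have hTd : ∀ w ∈ Set.range (L x), w ∉ T := by
    rintro w ⟨a, rfl⟩ hw
    obtain ⟨z, ⟨hzv, hz⟩, b, hb⟩ := Set.mem_iUnion₂.1 hw
    exact hz (hmeet z x b a hzv hxv hb ▸ hself z hzv)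
  have hTo : IsOpen T := isOpen_biUnion fun z hz => hopen z hz.1
  have hsub := isPreconnected_iff_subset_of_disjoint.1 hN (Set.range (L x)) T (hopen x hxv) hTo
    (fun z hz => by
      by_cases hzr : z ∈ Set.range (L x)
      · exact Or.inl hzr
      · exact Or.inr (Set.mem_biUnion (show z ∈ {z | F z ≠ v ∧ z ∉ Set.range (L x)} from
          ⟨hz, hzr⟩) (hself z hz)))
    (by
      rw [Set.eq_empty_iff_forall_notMem]
      exact fun z hz => hTd z hz.2.1 hz.2.2)
  have hyv : F y ≠ v := hxy ▸ hxv
  rcases hsub with h | h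
  · obtain ⟨b, hb⟩ := h (show y ∈ (F ⁻¹' {v})ᶜ from hyv)
    have h1 : j b = F y := by rw [← hb]; exact (congrFun (hL x hxv).2 b).symm
    have h2 : j (σ (F x)) = F x := σ.left_inv (by simpa [hσ] using hxv)
    have h3 : b = σ (F x) := hemb.injective (by
      change j b = j (σ (F x))
      rw [h1, h2, hxy])
    rw [← hb, h3, (hL x hxv).1]
  · exact absurd (h (show x ∈ (F ⁻¹' {v})ᶜ from hxv)) (hTd x (hself x hxv))

variable {n : ℕ} {M : Type*} [TopologicalSpace M] [ChartedSpace (EuclideanSpace ℝ (Fin n)) M]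
  [IsManifold (𝓡 n) ∞ M]

/-- A smooth map of an `n`-dimensional manifold to an `n`-dimensional sphere whose differential is
injective is a local homeomorphism. -/
theorem isLocalHomeomorph_of_immersion_sphere [Fact (Module.finrank ℝ W = n + 1)]
    {F : M → Metric.sphere (0 : W) 1}
    (hF : ContMDiff (𝓡 n) (𝓡 n) ∞ F)
    (hinj : ∀ (e : OpenPartialHomeomorph M (EuclideanSpace ℝ (Fin n))),
      e ∈ IsManifold.maximalAtlas (𝓡 n) ∞ M → ∀ y ∈ e.target, ∀ u,
        fderiv ℝ (fun z => (F (e.symm z) : W)) y u = 0 → u = 0) : IsLocalHomeomorph F := by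
  have : IsManifold (𝓡 n) ∞ (Metric.sphere (0 : W) 1) :=
    IsManifold.of_le (n := ω) le_top
  refine IsLocalHomeomorph.mk F fun x => ?_
  set e := chartAt (EuclideanSpace ℝ (Fin n)) x with hedef
  have he : e ∈ IsManifold.maximalAtlas (𝓡 n) ∞ M := IsManifold.chart_mem_maximalAtlas x
  have hx : x ∈ e.source := mem_chart_source _ x
  have hy := e.map_source hx
  set c := chartAt (EuclideanSpace ℝ (Fin n)) (F x) with hcdef
  have hc : c ∈ IsManifold.maximalAtlas (𝓡 n) ∞ (Metric.sphere (0 : W) 1) :=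
    IsManifold.chart_mem_maximalAtlas (F x)
  have hFx : F x ∈ c.source := mem_chart_source _ (F x)
  have hψ : ContDiffAt ℝ ∞ ((c ∘ F) ∘ e.symm) (e x) := by
    refine contDiffAt_comp_chart_symm he hy ?_
    rw [e.left_inv hx]
    exact ((contMDiffOn_of_mem_maximalAtlas hc).contMDiffAt
      (c.open_source.mem_nhds hFx)).comp x (hF x)
  have hψx : ((c ∘ F) ∘ e.symm) (e x) = c (F x) := by
    simp only [Function.comp_apply, e.left_inv hx]
  have hcoe : DifferentiableAt ℝ (((↑) : Metric.sphere (0 : W) 1 → W) ∘ c.symm)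
      (((c ∘ F) ∘ e.symm) (e x)) := by
    rw [hψx]
    exact (contDiffAt_comp_chart_symm hc (c.map_source hFx)
      (contMDiff_coe_sphere _)).differentiableAt (by simp)
  have hψd : DifferentiableAt ℝ ((c ∘ F) ∘ e.symm) (e x) := hψ.differentiableAt (by simp)
  have hev : (fun z => (F (e.symm z) : W)) =ᶠ[nhds (e x)]
      (((↑) : Metric.sphere (0 : W) 1 → W) ∘ c.symm) ∘ ((c ∘ F) ∘ e.symm) := by
    have hcont : ContinuousAt (F ∘ e.symm) (e x) :=
      hF.continuous.continuousAt.comp (e.continuousAt_symm hy)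
    have : c.source ∈ nhds ((F ∘ e.symm) (e x)) := by
      rw [Function.comp_apply, e.left_inv hx]
      exact c.open_source.mem_nhds hFx
    filter_upwards [hcont.preimage_mem_nhds this] with z hz
    exact congrArg _ (c.left_inv hz).symm
  -- Composing the chart expression of `F` with the inclusion of the sphere gives back the ambient
  -- map, whose differential is injective. The dimensions agree, so the inverse function theorem
  -- applies.
  have hker : Function.Injective (fderiv ℝ ((c ∘ F) ∘ e.symm) (e x)) := by
    rw [injective_iff_map_eq_zero]
    intro u hu
    refine hinj e he (e x) hy u ?_
    rw [hev.fderiv_eq, fderiv_comp _ hcoe hψd, ContinuousLinearMap.comp_apply, hu, map_zero]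
  let D : EuclideanSpace ℝ (Fin n) ≃L[ℝ] EuclideanSpace ℝ (Fin n) :=
    (LinearEquiv.ofInjectiveEndo (fderiv ℝ ((c ∘ F) ∘ e.symm) (e x) :
      EuclideanSpace ℝ (Fin n) →ₗ[ℝ] EuclideanSpace ℝ (Fin n)) hker).toContinuousLinearEquiv
  have hD : HasFDerivAt ((c ∘ F) ∘ e.symm)
      (D : EuclideanSpace ℝ (Fin n) →L[ℝ] EuclideanSpace ℝ (Fin n)) (e x) := by
    convert! hψd.hasFDerivAt
  let k := hψ.toOpenPartialHomeomorph _ hD (by simp)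
  have hkx : e x ∈ k.source := hψ.mem_toOpenPartialHomeomorph_source hD (by simp)
  have hk : ∀ z, k z = ((c ∘ F) ∘ e.symm) z := fun z => by
    exact congrFun (hψ.toOpenPartialHomeomorph_coe hD (by simp)) z
  -- The restriction keeps the values of `F` in the domain of `c`, where `c.symm` inverts `c`.
  let e₀ := e.restrOpen (F ⁻¹' c.source) (c.open_source.preimage hF.continuous)
  refine ⟨(e₀.trans k).trans c.symm, ?_, ?_⟩
  · simp only [OpenPartialHomeomorph.trans_source, Set.mem_inter_iff, Set.mem_preimage]
    refine ⟨⟨⟨hx, hFx⟩, hkx⟩, ?_⟩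
    change k (e x) ∈ c.target
    rw [hk, hψx]
    exact c.map_source hFx
  · intro z hz
    simp only [OpenPartialHomeomorph.trans_source, Set.mem_inter_iff, Set.mem_preimage] at hz
    obtain ⟨⟨⟨hz1, hz2⟩, -⟩, -⟩ := hz
    change F z = c.symm (k (e z))
    rw [hk]
    simp only [Function.comp_apply]
    rw [e.left_inv hz1, c.left_inv hz2]

/-- Rescaled to the unit sphere, `f` is a local homeomorphism, hence injective; its image is open
and compact in a connected sphere, hence everything. -/
theorem injective_and_range_eq_sphere [T2Space M] [CompactSpace M] [ConnectedSpace M]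
    (hn : 2 ≤ n) (hW : Module.finrank ℝ W = n + 1) {f : M → W}
    (hf : ContMDiff (𝓡 n) 𝓘(ℝ, W) ∞ f)
    (hinj : ∀ (e : OpenPartialHomeomorph M (EuclideanSpace ℝ (Fin n))),
      e ∈ IsManifold.maximalAtlas (𝓡 n) ∞ M → ∀ y ∈ e.target, ∀ u,
        fderiv ℝ (f ∘ e.symm) y u = 0 → u = 0)
    {c : W} {r : ℝ} (hr : 0 < r) (hfr : ∀ x, ‖f x - c‖ = r) :
    Function.Injective f ∧ Set.range f = Metric.sphere c r := by
  have : Fact (Module.finrank ℝ W = n + 1) := ⟨hW⟩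
  have : FiniteDimensional ℝ W := Module.finite_of_finrank_pos (by omega)
  have hmem : ∀ x, r⁻¹ • (f x - c) ∈ Metric.sphere (0 : W) 1 := fun x => by
    rw [mem_sphere_zero_iff_norm, norm_smul, hfr, norm_inv, Real.norm_of_nonneg hr.le,
      inv_mul_cancel₀ hr.ne']
  set F : M → Metric.sphere (0 : W) 1 := Set.codRestrict _ _ hmem with hFdef
  have hsm : ContMDiff (𝓡 n) (𝓡 n) ∞ F := by
    refine ContMDiff.codRestrict_sphere ?_ hmem
    exact (contDiff_const_smul r⁻¹).contMDiff.comp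
      ((contDiff_id.sub contDiff_const).contMDiff.comp hf)
  have hloc : IsLocalHomeomorph F := by
    refine isLocalHomeomorph_of_immersion_sphere hsm fun e he y hy u hu => ?_
    refine hinj e he y hy u ?_
    have hd : DifferentiableAt ℝ (f ∘ e.symm) y :=
      (contDiffAt_comp_chart_symm he hy (hf _)).differentiableAt (by simp)
    have : fderiv ℝ (fun z => (F (e.symm z) : W)) y = r⁻¹ • fderiv ℝ (f ∘ e.symm) y := by
      change fderiv ℝ (fun z => r⁻¹ • ((f ∘ e.symm) z - c)) y = _
      rw [fderiv_fun_const_smul (hd.sub_const c), fderiv_sub_const]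
    rw [this, smul_apply, smul_eq_zero] at hu
    exact hu.resolve_left (inv_ne_zero hr.ne')
  have hFinj := hloc.injective_of_sphere hn
  refine ⟨fun x y hxy => hFinj (Subtype.ext ?_), Set.Subset.antisymm ?_ ?_⟩
  · change r⁻¹ • (f x - c) = r⁻¹ • (f y - c)
    rw [hxy]
  · rintro _ ⟨x, rfl⟩
    rw [mem_sphere_iff_norm]
    exact hfr x
  · intro w hw
    have hrank : 1 < Module.rank ℝ W := by
      apply Module.one_lt_rank_of_one_lt_finrank
      omega
    have : PreconnectedSpace (Metric.sphere (0 : W) 1) :=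
      isPreconnected_iff_preconnectedSpace.1 (isPreconnected_sphere hrank 0 1)
    have huniv : Set.range F = Set.univ :=
      IsClopen.eq_univ ⟨(isCompact_range hloc.continuous).isClosed, hloc.isOpenMap.isOpen_range⟩
        (Set.range_nonempty F)
    have hw' : r⁻¹ • (w - c) ∈ Metric.sphere (0 : W) 1 := by
      rw [mem_sphere_zero_iff_norm, norm_smul, mem_sphere_iff_norm.1 hw, norm_inv,
        Real.norm_of_nonneg hr.le, inv_mul_cancel₀ hr.ne']
    obtain ⟨x, hx⟩ : (⟨_, hw'⟩ : Metric.sphere (0 : W) 1) ∈ Set.range F := by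
      rw [huniv]; trivial
    refine ⟨x, ?_⟩
    have h1 : r⁻¹ • (f x - c) = r⁻¹ • (w - c) := congrArg Subtype.val hx
    exact sub_left_injective (smul_right_injective W (inv_ne_zero hr.ne') h1)

end SphereCovering

noncomputable section

/-! ### The two unit normal fields, and Pythagoras in the normal space. -/

section Normals

theorem norm_inv_smul_smul_of_pos {V : Type*} [NormedAddCommGroup V] [NormedSpace ℝ V] {a : ℝ}
    (ha : 0 < a) (v : V) : ‖a • v‖⁻¹ • a • v = ‖v‖⁻¹ • v := by
  rw [norm_smul, Real.norm_of_nonneg ha.le, smul_smul, mul_inv, mul_right_comm,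
    inv_mul_cancel₀ ha.ne', one_mul]

variable {n : ℕ} {M : Type*} [TopologicalSpace M] [ChartedSpace (EuclideanSpace ℝ (Fin n)) M]
  [IsManifold (𝓡 n) ∞ M]
  {V : Type*} [NormedAddCommGroup V] [InnerProductSpace ℝ V]
  {e : OpenPartialHomeomorph M (EuclideanSpace ℝ (Fin n))}
  {g : Bundle.ContMDiffRiemannianMetric (𝓡 n) ∞ (EuclideanSpace ℝ (Fin n))
      (TangentSpace (𝓡 n) : M → Type _)} {φ ν : M → V} {δ : ℝ}

theorem IsIsometricImmersion.forall_pushforward_iff (h : IsIsometricImmersion g φ)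
    (he : e ∈ IsManifold.maximalAtlas (𝓡 n) ∞ M) {x : M} (hx : x ∈ e.source) (P : V → Prop) :
    (∀ u : TangentSpace (𝓡 n) x, P (pushforward φ x u)) ↔
      ∀ v, P (fderiv ℝ (φ ∘ e.symm) (e x) v) := by
  have key : ∀ y ∈ e.target, (∀ u : TangentSpace (𝓡 n) (e.symm y),
      P (pushforward φ (e.symm y) u)) ↔ ∀ v, P (fderiv ℝ (φ ∘ e.symm) y v) := by
    intro y hy
    constructor
    · intro H v
      rw [← pushforward_chartSymmDeriv he hy (h.mdifferentiableAt _)]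
      exact H _
    · intro H u
      obtain ⟨v, rfl⟩ := chartSymmDeriv_surjective he hy u
      rw [pushforward_chartSymmDeriv he hy (h.mdifferentiableAt _)]
      exact H v
  have := key (e x) (e.map_source hx)
  rwa [e.left_inv hx] at this

theorem IsIsometricImmersion.forall_inner_pushforward_eq_zero_iff (h : IsIsometricImmersion g φ)
    (he : e ∈ IsManifold.maximalAtlas (𝓡 n) ∞ M) {x : M} (hx : x ∈ e.source) (z : V) :
    (∀ u : TangentSpace (𝓡 n) x, inner ℝ z (pushforward φ x u) = 0) ↔
      ∀ i, inner ℝ z (partialDeriv (φ ∘ e.symm) (e x) i) = 0 := by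
  rw [h.forall_pushforward_iff he hx (fun w => inner ℝ z w = 0)]
  refine ⟨fun H i => H _, fun H v => ?_⟩
  rw [EuclideanSpace.eq_sum_smul_single v, map_sum, inner_sum]
  refine Finset.sum_eq_zero fun i _ => ?_
  rw [map_smul, inner_smul_right]
  exact mul_eq_zero_of_right _ (H i)

theorem IsIsometricImmersion.inner_pushforward_eq_zero (h : IsIsometricImmersion g φ) {x₀ : V}
    {x : M} {r : ℝ} (hr : ∀ᶠ y in nhds x, ‖φ y - x₀‖ = r) (u : TangentSpace (𝓡 n) x) :
    inner ℝ (φ x - x₀) (pushforward φ x u) = 0 := by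
  set e := chartAt (EuclideanSpace ℝ (Fin n)) x with hedef
  have he : e ∈ IsManifold.maximalAtlas (𝓡 n) ∞ M := IsManifold.chart_mem_maximalAtlas x
  have hx : x ∈ e.source := mem_chart_source _ x
  have hy := e.map_source hx
  refine (h.forall_pushforward_iff he hx fun w => inner ℝ (φ x - x₀) w = 0).2 (fun v => ?_) u
  have hc : Filter.Tendsto e.symm (nhds (e x)) (nhds x) := by
    have := e.continuousAt_symm hy
    rwa [ContinuousAt, e.left_inv hx] at this
  have := inner_fderiv_eq_zero_of_norm_eq
    ((h.contDiffAt he hy).differentiableAt (by simp)) (hc.eventually hr) v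
  rwa [Function.comp_apply, e.left_inv hx, real_inner_comm] at this

/-- `A` is the transposed Jacobian of the transition map, and `det_pos` gives its sign. -/
theorem OrientationAtlas.exists_frameImage_eq (o : OrientationAtlas n M)
    (h : IsIsometricImmersion g φ) {x z : M} (hz : z ∈ (o.chart x).source) :
    ∃ A : Matrix (Fin n) (Fin n) ℝ, 0 < A.det ∧ o.frameImage φ z = fun i =>
      ∑ j, A i j • partialDeriv (φ ∘ (o.chart x).symm) (o.chart x z) j := by
  set e := o.chart x
  set e' := o.chart z
  have hz' : z ∈ e'.source := o.mem_source z
  have hy := e'.map_source hz'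
  refine ⟨(standardMatrix (fderiv ℝ (e ∘ e'.symm) (e' z))).transpose, ?_, ?_⟩
  · rw [Matrix.det_transpose, standardMatrix_det]
    exact o.det_pos z x z hz' hz
  · ext i : 1
    have hc : φ ∘ e'.symm =ᶠ[nhds (e' z)] (φ ∘ e.symm) ∘ (e ∘ e'.symm) := by
      have hcont : ContinuousAt e'.symm (e' z) := e'.continuousAt_symm hy
      have hmem : e.source ∈ nhds (e'.symm (e' z)) := by
        rw [e'.left_inv hz']
        exact e.open_source.mem_nhds hz
      filter_upwards [hcont.preimage_mem_nhds hmem] with w hw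
      simp only [Function.comp_apply]
      rw [e.left_inv hw]
    have hez : (e ∘ e'.symm) (e' z) = e z := by
      rw [Function.comp_apply, e'.left_inv hz']
    have hψ : DifferentiableAt ℝ (φ ∘ e.symm) ((e ∘ e'.symm) (e' z)) := by
      rw [hez]
      exact (h.contDiffAt (o.chart_mem x) (e.map_source hz)).differentiableAt (by simp)
    have hτ : DifferentiableAt ℝ (e ∘ e'.symm) (e' z) :=
      (contDiffAt_chart_transition (o.chart_mem x) (o.chart_mem z) hy
        (by rwa [e'.left_inv hz'])).differentiableAt (by simp)
    change fderiv ℝ (φ ∘ e'.symm) (e' z) _ = _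
    rw [hc.fderiv_eq, fderiv_comp _ hψ hτ, ContinuousLinearMap.comp_apply, map_standardMatrix, hez]
    rfl

theorem contMDiffAt_of_eventuallyEq_comp_chart {F : Type*} [NormedAddCommGroup F]
    [NormedSpace ℝ F] {f : M → F} {N : EuclideanSpace ℝ (Fin n) → F}
    (he : e ∈ IsManifold.maximalAtlas (𝓡 n) ∞ M) {x : M} (hx : x ∈ e.source)
    (hN : ContDiffAt ℝ ∞ N (e x)) (hf : ∀ z ∈ e.source, f z = N (e z)) :
    ContMDiffAt (𝓡 n) 𝓘(ℝ, F) ∞ f x := by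
  have h1 : ContMDiffAt (𝓡 n) 𝓘(ℝ, F) ∞ (N ∘ e) x :=
    hN.contMDiffAt.comp x
      ((contMDiffOn_of_mem_maximalAtlas he).contMDiffAt (e.open_source.mem_nhds hx))
  refine h1.congr_of_eventuallyEq ?_
  filter_upwards [e.open_source.mem_nhds hx] with z hz using hf z hz

theorem ContDiffAt.norm_inv_smul {E : Type*} [NormedAddCommGroup E] [NormedSpace ℝ E]
    {f : E → V} {y : E} (hf : ContDiffAt ℝ ∞ f y) (h0 : f y ≠ 0) :
    ContDiffAt ℝ ∞ (fun z => ‖f z‖⁻¹ • f z) y :=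
  ((hf.norm ℝ h0).inv (norm_ne_zero_iff.2 h0)).smul hf

/-- The field is defined with a different chart at each point. As changes of frame have positive
determinant, near `x` it can be computed in the single chart at `x`, where it is smooth. -/
theorem isUnitNormal_euclideanUnitNormal {φ : M → EuclideanSpace ℝ (Fin (n + 1))}
    (h : IsIsometricImmersion g φ) (o : OrientationAtlas n M) :
    IsUnitNormal n 0 φ (euclideanUnitNormal o φ) := by
  have hli : ∀ x, LinearIndependent ℝ (o.frameImage φ x) := fun x =>
    h.linearIndependent (o.chart_mem x) ((o.chart x).map_source (o.mem_source x))
  have hne : ∀ x, vectorProduct (o.frameImage φ x) ≠ 0 := fun x => vectorProduct_ne_zero (hli x)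
  have horth : ∀ x i, inner ℝ (vectorProduct (o.frameImage φ x)) (o.frameImage φ x i) = 0 :=
    fun x i => by rw [real_inner_comm, inner_vectorProduct_self]
  refine ⟨fun x => ?_, fun x => ?_, fun x => ?_, fun h0 => absurd rfl h0, fun x z hz hzν _ => ?_⟩
  · have hy := (o.chart x).map_source (o.mem_source x)
    refine contMDiffAt_of_eventuallyEq_comp_chart (o.chart_mem x) (o.mem_source x)
      (N := fun y => ‖vectorProduct (partialDeriv (φ ∘ (o.chart x).symm) y)‖⁻¹ •
        vectorProduct (partialDeriv (φ ∘ (o.chart x).symm) y)) ?_ fun z hz => ?_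
    · exact (ContDiffAt.vectorProduct fun i => contDiffAt_partialDeriv
        (h.contDiffAt (o.chart_mem x) hy) i).norm_inv_smul (hne x)
    · obtain ⟨A, hA, hAz⟩ := o.exists_frameImage_eq h hz
      rw [euclideanUnitNormal, hAz, vectorProduct_sum_smul, norm_inv_smul_smul_of_pos hA]
  · exact norm_smul_inv_norm (𝕜 := ℝ) (hne x)
  · rw [h.forall_inner_pushforward_eq_zero_iff (o.chart_mem x) (o.mem_source x)]
    intro i
    rw [euclideanUnitNormal, inner_smul_left]
    exact mul_eq_zero_of_right _ (horth x i)
  · rw [h.forall_inner_pushforward_eq_zero_iff (o.chart_mem x) (o.mem_source x)] at hz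
    rw [euclideanUnitNormal, inner_smul_right] at hzν
    exact eq_zero_of_inner_vectorProduct_eq_zero (hli x)
      ((mul_eq_zero.1 hzν).resolve_left (inv_ne_zero (norm_ne_zero_iff.2 (hne x)))) hz

theorem norm_of_mem_curvatureSphere {δ : ℝ} {x : EuclideanSpace ℝ (Fin (n + 2))}
    (hx : x ∈ curvatureSphere n δ) : ‖x‖ = 1 / √δ := by
  simpa [curvatureSphere] using hx

theorem mul_inner_self_of_mem_curvatureSphere {δ : ℝ} (hδ : 0 < δ)
    {x : EuclideanSpace ℝ (Fin (n + 2))} (hx : x ∈ curvatureSphere n δ) :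
    δ * inner ℝ x x = 1 := by
  rw [real_inner_self_eq_norm_sq, norm_of_mem_curvatureSphere hx, div_pow, Real.sq_sqrt hδ.le]
  field_simp

/-- The Euclidean argument with `φ x` as an additional frame vector; it is independent of the others
because the constant norm of `φ` makes it orthogonal to them. -/
theorem isUnitNormal_sphericalUnitNormal {φ : M → EuclideanSpace ℝ (Fin (n + 2))}
    (h : IsIsometricImmersion g φ) (o : OrientationAtlas n M) (hδ : 0 < δ)
    (hφ : ∀ x, φ x ∈ curvatureSphere n δ) :
    IsUnitNormal n δ φ (sphericalUnitNormal o φ) := by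
  have hself : ∀ x, inner ℝ (φ x) (φ x) ≠ (0 : ℝ) := fun x h0 => by
    have := mul_inner_self_of_mem_curvatureSphere hδ (hφ x)
    rw [h0, mul_zero] at this
    exact zero_ne_one this
  have hφt : ∀ (x : M) (u : TangentSpace (𝓡 n) x), inner ℝ (φ x) (pushforward φ x u) = 0 := by
    intro x u
    have := h.inner_pushforward_eq_zero (x₀ := 0) (x := x) (r := 1 / √δ)
      (Filter.Eventually.of_forall fun y => by
        rw [sub_zero, norm_of_mem_curvatureSphere (hφ y)]) u
    rwa [sub_zero] at this
  have hφf : ∀ x i, inner ℝ (φ x) (o.frameImage φ x i) = 0 := fun x =>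
    (h.forall_inner_pushforward_eq_zero_iff (o.chart_mem x) (o.mem_source x) _).1 (hφt x)
  have hli : ∀ x, LinearIndependent ℝ
      (Fin.cons (φ x) (o.frameImage φ x) : Fin (n + 1) → EuclideanSpace ℝ (Fin (n + 2))) := by
    intro x
    refine linearIndependent_finCons.2 ⟨h.linearIndependent (o.chart_mem x)
      ((o.chart x).map_source (o.mem_source x)), fun hmem => ?_⟩
    have hle : Submodule.span ℝ (Set.range (o.frameImage φ x)) ≤ (ℝ ∙ φ x)ᗮ := by
      rw [Submodule.span_le]
      rintro _ ⟨i, rfl⟩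
      exact Submodule.mem_orthogonal_singleton_iff_inner_right.2 (hφf x i)
    exact hself x (Submodule.mem_orthogonal_singleton_iff_inner_right.1 (hle hmem))
  have hne : ∀ x, vectorProduct (Fin.cons (φ x) (o.frameImage φ x)) ≠ 0 := fun x =>
    vectorProduct_ne_zero (hli x)
  have horth : ∀ x i, inner ℝ (vectorProduct (Fin.cons (φ x) (o.frameImage φ x)))
      (o.frameImage φ x i) = 0 := fun x i => by
    rw [real_inner_comm]
    exact inner_vectorProduct_self
      (Fin.cons (φ x) (o.frameImage φ x) : Fin (n + 1) → EuclideanSpace ℝ (Fin (n + 2))) i.succ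
  refine ⟨fun x => ?_, fun x => ?_, fun x => ?_, fun _ x => ⟨?_, ?_⟩, fun x z hz hzν hzφ => ?_⟩
  · have hx := o.mem_source x
    have hy := (o.chart x).map_source hx
    refine contMDiffAt_of_eventuallyEq_comp_chart (o.chart_mem x) hx
      (N := fun y => ‖vectorProduct (Fin.cons ((φ ∘ (o.chart x).symm) y)
          (partialDeriv (φ ∘ (o.chart x).symm) y))‖⁻¹ •
        vectorProduct (Fin.cons ((φ ∘ (o.chart x).symm) y)
          (partialDeriv (φ ∘ (o.chart x).symm) y))) ?_ fun z hz => ?_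
    · refine (ContDiffAt.vectorProduct fun i => ?_).norm_inv_smul ?_
      · refine Fin.cases ?_ (fun i => ?_) i
        · exact h.contDiffAt (o.chart_mem x) hy
        · exact contDiffAt_partialDeriv (h.contDiffAt (o.chart_mem x) hy) i
      · rw [Function.comp_apply, (o.chart x).left_inv hx]
        exact hne x
    · obtain ⟨A, hA, hAz⟩ := o.exists_frameImage_eq h hz
      rw [sphericalUnitNormal, hAz, vectorProduct_cons_sum_smul, norm_inv_smul_smul_of_pos hA,
        Function.comp_apply, (o.chart x).left_inv hz]
  · exact norm_smul_inv_norm (𝕜 := ℝ) (hne x)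
  · rw [h.forall_inner_pushforward_eq_zero_iff (o.chart_mem x) (o.mem_source x)]
    intro i
    rw [sphericalUnitNormal, inner_smul_left]
    exact mul_eq_zero_of_right _ (horth x i)
  · exact mul_inner_self_of_mem_curvatureSphere hδ (hφ x)
  · rw [sphericalUnitNormal, inner_smul_right]
    exact mul_eq_zero_of_right _ (inner_vectorProduct_self
      (Fin.cons (φ x) (o.frameImage φ x) : Fin (n + 1) → EuclideanSpace ℝ (Fin (n + 2))) 0)
  · rw [h.forall_inner_pushforward_eq_zero_iff (o.chart_mem x) (o.mem_source x)] at hz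
    rw [sphericalUnitNormal, inner_smul_right] at hzν
    refine eq_zero_of_inner_vectorProduct_eq_zero (hli x)
      ((mul_eq_zero.1 hzν).resolve_left (inv_ne_zero (norm_ne_zero_iff.2 (hne x)))) fun i => ?_
    refine Fin.cases ?_ (fun i => ?_) i
    · exact hzφ hδ.ne'
    · exact hz i

/-- Pythagoras: ν and, if δ ≠ 0, √δ φ are orthonormal, and the difference on the left is the
tangential part of `X`. -/
theorem IsUnitNormal.norm_sub_smul_sq (hν : IsUnitNormal n δ φ ν) (x : M) (X : V) :
    ‖X - inner ℝ (ν x) X • ν x - (δ * inner ℝ (φ x) X) • φ x‖ ^ 2 =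
      ‖X‖ ^ 2 - inner ℝ (ν x) X ^ 2 - δ * inner ℝ (φ x) X ^ 2 := by
  have h1 : inner ℝ (ν x) (ν x) = (1 : ℝ) := by
    rw [real_inner_self_eq_norm_sq, hν.norm_eq_one, one_pow]
  have h2 : δ * inner ℝ (φ x) (ν x) = 0 := by
    by_cases h : δ = 0
    · simp [h]
    · rw [(hν.sphere h x).2, mul_zero]
  have h3 : δ * δ * inner ℝ (φ x) (φ x) = δ := by
    by_cases h : δ = 0
    · simp [h]
    · rw [mul_assoc, (hν.sphere h x).1, mul_one]
  rw [← real_inner_self_eq_norm_sq, ← real_inner_self_eq_norm_sq]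
  simp only [inner_sub_left, inner_sub_right, inner_smul_left, inner_smul_right, conj_trivial]
  rw [real_inner_comm (ν x) X, real_inner_comm (φ x) X, real_inner_comm (φ x) (ν x), h1]
  linear_combination (inner ℝ (φ x) X) ^ 2 * h3 +
    2 * inner ℝ (φ x) X * inner ℝ (ν x) X * h2

theorem IsUnitNormal.inner_sq_add_le (hν : IsUnitNormal n δ φ ν) (x : M) (X : V) :
    inner ℝ (ν x) X ^ 2 + δ * inner ℝ (φ x) X ^ 2 ≤ ‖X‖ ^ 2 := by
  have := hν.norm_sub_smul_sq x X
  have h0 := sq_nonneg ‖X - inner ℝ (ν x) X • ν x - (δ * inner ℝ (φ x) X) • φ x‖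
  linarith

/-- At constant distance from `x₀` the vector φ - x₀ has no tangential part. -/
theorem IsUnitNormal.inner_sq_add_eq (hν : IsUnitNormal n δ φ ν) (h : IsIsometricImmersion g φ)
    {x : M} {x₀ : V} {r : ℝ} (hr : ∀ y, ‖φ y - x₀‖ = r) :
    inner ℝ (ν x) (φ x - x₀) ^ 2 + δ * inner ℝ (φ x) (φ x - x₀) ^ 2 = ‖φ x - x₀‖ ^ 2 := by
  have hsq := hν.norm_sub_smul_sq x (φ x - x₀)
  have hzero : φ x - x₀ - inner ℝ (ν x) (φ x - x₀) • ν x -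
      (δ * inner ℝ (φ x) (φ x - x₀)) • φ x = 0 := by
    have hνν : inner ℝ (ν x) (ν x) = (1 : ℝ) := by
      rw [real_inner_self_eq_norm_sq, hν.norm_eq_one, one_pow]
    refine hν.eq_zero x _ (fun u => ?_) ?_ fun h0 => ?_
    · have h1 := h.inner_pushforward_eq_zero (Filter.Eventually.of_forall hr) u
      have h2 : δ * inner ℝ (φ x) (pushforward φ x u) = 0 := by
        by_cases h0 : δ = 0
        · simp [h0]
        · have := h.inner_pushforward_eq_zero (x₀ := 0) (x := x) (r := √δ⁻¹)
            (Filter.Eventually.of_forall fun y => by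
              rw [sub_zero, ← eq_inv_of_mul_eq_one_right (hν.sphere h0 y).1,
                real_inner_self_eq_norm_sq, Real.sqrt_sq (norm_nonneg _)]) u
          rw [sub_zero] at this
          rw [this, mul_zero]
      rw [inner_sub_left, inner_sub_left, h1, inner_smul_left, inner_smul_left,
        hν.inner_pushforward]
      simp only [conj_trivial]
      linear_combination -(inner ℝ (φ x) (φ x - x₀)) * h2
    · have h2 : δ * inner ℝ (φ x) (ν x) = 0 := by
        by_cases h0 : δ = 0
        · simp [h0]
        · rw [(hν.sphere h0 x).2, mul_zero]
      rw [inner_sub_left, inner_sub_left, inner_smul_left, inner_smul_left, hνν,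
        real_inner_comm (ν x)]
      simp only [conj_trivial]
      linear_combination -(inner ℝ (φ x) (φ x - x₀)) * h2
    · obtain ⟨h1, h2⟩ := hν.sphere h0 x
      rw [inner_sub_left, inner_sub_left, inner_smul_left, inner_smul_left,
        real_inner_comm (φ x) (ν x), h2, real_inner_comm (φ x) (φ x - x₀)]
      simp only [conj_trivial]
      linear_combination -(inner ℝ (φ x) (φ x - x₀)) * h1
  rw [hzero] at hsq
  simp only [norm_zero] at hsq
  linarith

end Normals

/-! ### The extrinsic radius and its centre. -/

section ExtrinsicRadius

variable {M V : Type*} {X : Set V} {d : V → V → ℝ} {φ : M → V}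

theorem extrinsicRadius_nonneg : 0 ≤ extrinsicRadius X d φ :=
  Real.sInf_nonneg fun _ hr => hr.1.le

/-- The largest distance is attained, so a radius smaller than `r` suffices. Nonemptiness is
recorded because `sInf ∅ = 0`. -/
theorem extrinsicRadius_lt [TopologicalSpace M] [CompactSpace M] [Nonempty M] {q : V} (hq : q ∈ X)
    (hd : Continuous fun y => d q (φ y)) {r : ℝ} (h0 : 0 < r) (hr : ∀ y, d q (φ y) < r) :
    {r : ℝ | 0 < r ∧ ∃ x ∈ X, ∀ y : M, d x (φ y) < r}.Nonempty ∧ extrinsicRadius X d φ < r := by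
  obtain ⟨y, -, hy⟩ := isCompact_univ.exists_isMaxOn Set.univ_nonempty hd.continuousOn
  -- The maximum with 0 keeps the new radius positive.
  obtain ⟨s, hs, hsr⟩ := exists_between (max_lt (hr y) h0)
  have hmem : s ∈ {r : ℝ | 0 < r ∧ ∃ x ∈ X, ∀ y : M, d x (φ y) < r} :=
    ⟨(le_max_right _ _).trans_lt hs, q, hq, fun z =>
      ((hy (Set.mem_univ z)).trans (le_max_left _ _)).trans_lt hs⟩
  exact ⟨⟨s, hmem⟩, (csInf_le ⟨0, fun _ hr => hr.1.le⟩ hmem).trans_lt hsr⟩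

/-- The centres of closed balls of radius R + 1/(k+1) containing the image form a decreasing
sequence of nonempty compact sets. -/
theorem exists_forall_le_extrinsicRadius [TopologicalSpace V] [T2Space V] [Nonempty M]
    (hc : ∀ y r, IsCompact {x | x ∈ X ∧ d x (φ y) ≤ r})
    (hne : {r : ℝ | 0 < r ∧ ∃ x ∈ X, ∀ y : M, d x (φ y) < r}.Nonempty) :
    ∃ x ∈ X, ∀ y, d x (φ y) ≤ extrinsicRadius X d φ := by
  have hpos : ∀ k : ℕ, (0 : ℝ) < 1 / (k + 1) := fun k => by positivity
  have hcl : ∀ k : ℕ, IsClosed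
      (⋂ y, {x | x ∈ X ∧ d x (φ y) ≤ extrinsicRadius X d φ + 1 / (k + 1)}) :=
    fun k => isClosed_iInter fun y => (hc y _).isClosed
  have hcomp : IsCompact
      (⋂ y, {x | x ∈ X ∧ d x (φ y) ≤ extrinsicRadius X d φ + 1 / ((0 : ℕ) + 1)}) :=
    (hc (Classical.arbitrary M) _).of_isClosed_subset (hcl 0) (Set.iInter_subset _ _)
  obtain ⟨x, hx⟩ := IsCompact.nonempty_iInter_of_sequence_nonempty_isCompact_isClosed
    (fun k : ℕ => ⋂ y, {x | x ∈ X ∧ d x (φ y) ≤ extrinsicRadius X d φ + 1 / (k + 1)})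
    (fun k => Set.iInter_mono fun y x hx => ⟨hx.1, hx.2.trans (by
      push_cast
      gcongr
      linarith)⟩)
    (fun k => by
      obtain ⟨r, ⟨-, x, hxX, hx⟩, hr⟩ :=
        exists_lt_of_csInf_lt hne (lt_add_of_pos_right (extrinsicRadius X d φ) (hpos k))
      exact ⟨x, Set.mem_iInter.2 fun y => ⟨hxX, ((hx y).trans hr).le⟩⟩)
    hcomp hcl
  have hx' : ∀ (k : ℕ) y, x ∈ X ∧ d x (φ y) ≤ extrinsicRadius X d φ + 1 / (k + 1) :=
    fun k y => Set.mem_iInter.1 (Set.mem_iInter.1 hx k) y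
  refine ⟨x, (hx' 0 (Classical.arbitrary M)).1, fun y => ?_⟩
  have hlim := (tendsto_one_div_add_atTop_nhds_zero_nat (𝕜 := ℝ)).const_add
    (extrinsicRadius X d φ)
  rw [add_zero] at hlim
  exact ge_of_tendsto' hlim fun k => (hx' k y).2

end ExtrinsicRadius

/-! ### Hölder's inequality and its equality case. -/

section LpNorm

variable {M : Type*} [TopologicalSpace M] [CompactSpace M] [MeasurableSpace M]
  [OpensMeasurableSpace M] {μ : Measure M} [IsFiniteMeasure μ]

theorem Continuous.integrable_of_compactSpace {h : M → ℝ} (hh : Continuous h) : Integrable h μ :=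
  hh.integrable_of_hasCompactSupport (HasCompactSupport.of_compactSpace h)

/-- Hölder against the constant 1; `p = 1` is separate because it has no finite conjugate exponent.
-/
theorem integral_abs_le_realLpNorm_mul {h : M → ℝ} (hh : Continuous h) {p : ℝ} (hp : 1 ≤ p) :
    ∫ x, |h x| ∂μ ≤ realLpNorm μ p h * μ.real Set.univ ^ (1 - 1 / p) := by
  rcases hp.eq_or_lt with rfl | hp
  · simp [realLpNorm]
  · have hpq : p.HolderConjugate (p / (p - 1)) := Real.HolderConjugate.conjExponent hp
    have hmem : ∀ (q : ENNReal) (f : M → ℝ), Continuous f → MemLp f q μ := fun q f hf => by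
      obtain ⟨C, hC⟩ := isCompact_univ.exists_bound_of_continuousOn hf.continuousOn
      exact MemLp.of_bound hf.measurable.aestronglyMeasurable C
        (Filter.Eventually.of_forall fun x => hC x (Set.mem_univ x))
    have := integral_mul_le_Lp_mul_Lq_of_nonneg hpq
      (Filter.Eventually.of_forall fun x => abs_nonneg (h x))
      (Filter.Eventually.of_forall fun _ => zero_le_one) (hmem _ _ hh.abs)
      (hmem _ _ (continuous_const (y := (1 : ℝ))))
    have he : 1 / (p / (p - 1)) = 1 - 1 / p := by
      rw [one_div_div, sub_div, div_self (by linarith)]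
    simpa [realLpNorm, he] using this

/-- `T` will be t_δ(R). The chain V ≤ T ∫ |h| ≤ T ‖h‖_p V^(1-1/p) collapses if its ends agree, and
they do agree when |h| is the constant 1/T. -/
theorem realLpNorm_bound {h : M → ℝ} (hh : Continuous h) {p T : ℝ} (hp : 1 ≤ p)
    (hV : 0 < μ.real Set.univ) (hT0 : 0 ≤ T) (hT : μ.real Set.univ ≤ T * ∫ x, |h x| ∂μ) :
    0 < realLpNorm μ p h ∧ T ≥ μ.real Set.univ ^ (1 / p) / realLpNorm μ p h ∧
      (T = μ.real Set.univ ^ (1 / p) / realLpNorm μ p h →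
        μ.real Set.univ = T * ∫ x, |h x| ∂μ) ∧
      ((∀ x, T * |h x| = 1) → T = μ.real Set.univ ^ (1 / p) / realLpNorm μ p h) := by
  have hI := integral_abs_le_realLpNorm_mul (μ := μ) hh hp
  have hI0 : 0 ≤ ∫ x, |h x| ∂μ := integral_nonneg fun x => abs_nonneg _
  have hT' : 0 < T := hT0.lt_of_ne fun h0 => by
    rw [← h0, zero_mul] at hT
    exact hT.not_gt hV
  have hI' : 0 < ∫ x, |h x| ∂μ := hI0.lt_of_ne fun h0 => by
    rw [← h0, mul_zero] at hT
    exact hT.not_gt hV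
  have hVp : 0 < μ.real Set.univ ^ (1 - 1 / p) := Real.rpow_pos_of_pos hV _
  have hN : 0 < realLpNorm μ p h := pos_of_mul_pos_left (hI'.trans_le hI) hVp.le
  have hmul : μ.real Set.univ ^ (1 / p) * μ.real Set.univ ^ (1 - 1 / p) = μ.real Set.univ := by
    rw [← Real.rpow_add hV, add_sub_cancel, Real.rpow_one]
  refine ⟨hN, ?_, fun he => ?_, fun he => ?_⟩
  · rw [ge_iff_le, div_le_iff₀ hN]
    refine le_of_mul_le_mul_right ?_ hVp
    rw [hmul, mul_assoc]
    exact hT.trans (mul_le_mul_of_nonneg_left hI hT'.le)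
  · rw [eq_div_iff hN.ne'] at he
    refine hT.antisymm ((mul_le_mul_of_nonneg_left hI hT'.le).trans ?_)
    rw [← mul_assoc, he, hmul]
  · have hp0 : p ≠ 0 := by linarith
    have hval : ∀ x, |h x| = T⁻¹ := fun x => eq_inv_of_mul_eq_one_right (he x)
    have hNv : realLpNorm μ p h = μ.real Set.univ ^ (1 / p) * T⁻¹ := by
      simp only [realLpNorm, hval, integral_const, smul_eq_mul]
      rw [Real.mul_rpow hV.le (by positivity), ← Real.rpow_mul (by positivity),
        mul_one_div_cancel hp0, Real.rpow_one]
    rw [hNv]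
    have := (Real.rpow_pos_of_pos hV (1 / p)).ne'
    field_simp

theorem eq_of_integral_le [μ.IsOpenPosMeasure] {f h : M → ℝ} (hf : Continuous f)
    (hh : Continuous h) (hle : ∀ x, f x ≤ h x) (hint : ∫ x, h x ∂μ ≤ ∫ x, f x ∂μ) : f = h := by
  have h0 : ∫ x, (h x - f x) ∂μ = 0 := by
    refine le_antisymm ?_ (integral_nonneg fun x => sub_nonneg.2 (hle x))
    rw [integral_sub hh.integrable_of_compactSpace hf.integrable_of_compactSpace]
    linarith
  rw [integral_eq_zero_iff_of_nonneg (fun x => sub_nonneg.2 (hle x))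
    (hh.sub hf).integrable_of_compactSpace] at h0
  have := (Continuous.ae_eq_iff_eq μ (hh.sub hf) continuous_zero).1 h0
  exact funext fun x => (sub_eq_zero.1 (congrFun this x)).symm

end LpNorm

/-! ### The bound V ≤ t_δ(R) ∫ |H| and its equality case. -/

section Comparison

variable {n : ℕ} {M : Type*} [TopologicalSpace M] [T2Space M] [CompactSpace M] [ConnectedSpace M]
  [ChartedSpace (EuclideanSpace ℝ (Fin n)) M] [IsManifold (𝓡 n) ∞ M]
  [MeasurableSpace M] [BorelSpace M]
  {g : Bundle.ContMDiffRiemannianMetric (𝓡 n) ∞ (EuclideanSpace ℝ (Fin n))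
      (TangentSpace (𝓡 n) : M → Type _)}
  {V : Type*} [NormedAddCommGroup V] [InnerProductSpace ℝ V]

theorem IsIsometricImmersion.volume_univ_pos {φ : M → V} (h : IsIsometricImmersion g φ) :
    0 < (riemannianVolume g).real Set.univ := by
  have := h.isFiniteMeasure
  have := h.isOpenPosMeasure
  exact measureReal_univ_pos

section Euclidean

variable {φ ν : M → V}

theorem IsUnitNormal.integral_meanCurvature_mul_inner (hν : IsUnitNormal n 0 φ ν)
    (h : IsIsometricImmersion g φ) (hn : n ≠ 0) (x₀ : V) :
    ∫ x, meanCurvature g φ ν x * inner ℝ (ν x) (φ x - x₀) ∂(riemannianVolume g) =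
      (riemannianVolume g).real Set.univ := by
  have := h.isFiniteMeasure
  have hc : Continuous fun x => meanCurvature g φ ν x * inner ℝ (ν x) (φ x - x₀) :=
    (hν.continuous_meanCurvature h).mul
      (hν.contMDiff.continuous.inner (h.contMDiff.continuous.sub continuous_const))
  have hint := hν.integral_minkowskiIntegrand h hn x₀
  simp only [minkowskiIntegrand, zero_mul, sub_zero] at hint
  rw [integral_sub (integrable_const _) hc.integrable_of_compactSpace] at hint
  simp only [integral_const, smul_eq_mul, mul_one] at hint
  linarith

theorem IsUnitNormal.abs_inner_le (hν : IsUnitNormal n 0 φ ν) (x : M) (X : V) :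
    |inner ℝ (ν x) X| ≤ ‖X‖ := by
  simpa [hν.norm_eq_one] using abs_real_inner_le_norm (ν x) X

theorem IsUnitNormal.meanCurvature_mul_inner_le (hν : IsUnitNormal n 0 φ ν) {x₀ : V} {R : ℝ}
    {x : M} (hR : ‖φ x - x₀‖ ≤ R) :
    meanCurvature g φ ν x * inner ℝ (ν x) (φ x - x₀) ≤ R * |meanCurvature g φ ν x| := by
  refine (le_abs_self _).trans ?_
  rw [abs_mul, mul_comm]
  exact mul_le_mul_of_nonneg_right ((hν.abs_inner_le x _).trans hR) (abs_nonneg _)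

theorem IsUnitNormal.volume_le (hν : IsUnitNormal n 0 φ ν)
    (h : IsIsometricImmersion g φ) (hn : n ≠ 0) {x₀ : V} {R : ℝ} (hR : ∀ x, ‖φ x - x₀‖ ≤ R) :
    (riemannianVolume g).real Set.univ ≤
      R * ∫ x, |meanCurvature g φ ν x| ∂(riemannianVolume g) := by
  have := h.isFiniteMeasure
  have hH := hν.continuous_meanCurvature h
  rw [← hν.integral_meanCurvature_mul_inner h hn x₀, ← integral_const_mul]
  refine integral_mono (Continuous.integrable_of_compactSpace (hH.mul
    (hν.contMDiff.continuous.inner (h.contMDiff.continuous.sub continuous_const))))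
    (Continuous.integrable_of_compactSpace (continuous_const.mul hH.abs)) fun x =>
    hν.meanCurvature_mul_inner_le (hR x)

/-- Equality of the integrals gives H⟨ν, φ - x₀⟩ = R|H| pointwise, so points with H ≠ 0 have
distance R. Near such a point the distance is constant, the Minkowski integrand vanishes, and R|H| =
1. Thus {H ≠ 0} = {R|H| = 1} is open and closed, and it is not empty since V > 0. -/
theorem IsUnitNormal.norm_sub_eq_of_volume_eq (hν : IsUnitNormal n 0 φ ν)
    (h : IsIsometricImmersion g φ) (hn : n ≠ 0) {x₀ : V} {R : ℝ} (hR : ∀ x, ‖φ x - x₀‖ ≤ R)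
    (heq : (riemannianVolume g).real Set.univ =
      R * ∫ x, |meanCurvature g φ ν x| ∂(riemannianVolume g)) (x : M) : ‖φ x - x₀‖ = R := by
  have := h.isFiniteMeasure
  have := h.isOpenPosMeasure
  have hH := hν.continuous_meanCurvature h
  have hpt := congrFun (eq_of_integral_le (μ := riemannianVolume g)
    (f := fun x => meanCurvature g φ ν x * inner ℝ (ν x) (φ x - x₀))
    (h := fun x => R * |meanCurvature g φ ν x|) (hH.mul
    (hν.contMDiff.continuous.inner (h.contMDiff.continuous.sub (continuous_const (y := x₀)))))
    (continuous_const.mul hH.abs) (fun x => hν.meanCurvature_mul_inner_le (hR x)) (by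
      rw [integral_const_mul, ← heq, hν.integral_meanCurvature_mul_inner h hn x₀]))
  have hdist : ∀ x, meanCurvature g φ ν x ≠ 0 → ‖φ x - x₀‖ = R := fun x hx =>
    (hR x).antisymm <| le_of_mul_le_mul_right
      ((hpt x).symm.le.trans (hν.meanCurvature_mul_inner_le le_rfl)) (abs_pos.2 hx)
  have hone : ∀ x, meanCurvature g φ ν x ≠ 0 → R * |meanCurvature g φ ν x| = 1 := by
    intro x hx
    have := hν.minkowskiIntegrand_eq_zero h hn (x₀ := x₀) (x := x) (r := R)
      ((hH.continuousAt.eventually_ne hx).mono hdist)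
    simp only [minkowskiIntegrand, zero_mul, sub_zero] at this
    exact (hpt x).symm.trans (sub_eq_zero.1 this).symm
  have hset : {x | meanCurvature g φ ν x ≠ 0} = {x | R * |meanCurvature g φ ν x| = 1} := by
    ext x
    refine ⟨hone x, fun hx h0 => ?_⟩
    rw [Set.mem_ofPred_eq, h0] at hx
    simp at hx
  have hclopen : IsClopen {x | meanCurvature g φ ν x ≠ 0} := by
    refine ⟨?_, isOpen_ne_fun hH continuous_const⟩
    rw [hset]
    exact isClosed_eq (continuous_const.mul hH.abs) continuous_const
  refine hdist x ?_
  rcases isClopen_iff.1 hclopen with h0 | h0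
  · have hz : ∀ x, meanCurvature g φ ν x = 0 := fun x => by
      by_contra hx
      exact (Set.eq_empty_iff_forall_notMem.1 h0 x) hx
    have := h.volume_univ_pos
    simp [heq, hz] at this
  · exact Set.eq_univ_iff_forall.1 h0 x

theorem IsUnitNormal.mul_abs_meanCurvature_eq_one (hν : IsUnitNormal n 0 φ ν)
    (h : IsIsometricImmersion g φ) (hn : n ≠ 0) {x₀ : V} {R : ℝ} (hR : ∀ x, ‖φ x - x₀‖ = R)
    (x : M) : R * |meanCurvature g φ ν x| = 1 := by
  have h1 := hν.minkowskiIntegrand_eq_zero h hn (Filter.Eventually.of_forall hR : ∀ᶠ y in nhds x, _)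
  have h2 := hν.inner_sq_add_eq h hR (x := x)
  simp only [minkowskiIntegrand, zero_mul, sub_zero, add_zero] at h1 h2
  rw [← abs_norm, hR, sq_eq_sq_iff_abs_eq_abs, abs_abs] at h2
  rw [← abs_of_nonneg ((norm_nonneg _).trans (hR x).le), ← h2, ← abs_mul, mul_comm,
    ← sub_eq_zero.1 h1, abs_one]

end Euclidean

section Spherical

variable {δ c s : ℝ} {φ ν : M → EuclideanSpace ℝ (Fin (n + 2))}
  {x₀ : EuclideanSpace ℝ (Fin (n + 2))}

theorem IsUnitNormal.minkowskiIntegrand_eq (hν : IsUnitNormal n δ φ ν) (hδ : 0 < δ) (x : M) :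
    minkowskiIntegrand g δ φ ν x₀ x =
      δ * inner ℝ (φ x) x₀ + meanCurvature g φ ν x * inner ℝ (ν x) x₀ := by
  obtain ⟨h1, h2⟩ := hν.sphere hδ.ne' x
  rw [minkowskiIntegrand, inner_sub_right, inner_sub_right, real_inner_comm (φ x) (ν x), h2]
  linear_combination -h1

/-- Bessel's inequality: of the squared length 1/δ of `x₀`, at least c²/δ lies along `φ`. -/
theorem IsUnitNormal.abs_inner_le_of_sphere (hν : IsUnitNormal n δ φ ν) (hδ : 0 < δ)
    (hx₀ : x₀ ∈ curvatureSphere n δ) (hcs : s ^ 2 + c ^ 2 = 1) (hs : 0 ≤ s) (hc : 0 < c) {x : M}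
    (hx : c ≤ δ * inner ℝ (φ x) x₀) : |inner ℝ (ν x) x₀| ≤ s / √δ := by
  have h1 := hν.inner_sq_add_le x x₀
  have h2 := mul_inner_self_of_mem_curvatureSphere hδ hx₀
  rw [← real_inner_self_eq_norm_sq] at h1
  refine abs_le_of_sq_le_sq ?_ (by positivity)
  rw [div_pow, Real.sq_sqrt hδ.le, le_div_iff₀ hδ]
  have h3 : c ^ 2 ≤ (δ * inner ℝ (φ x) x₀) ^ 2 := pow_le_pow_left₀ hc.le hx 2
  have h4 := mul_le_mul_of_nonneg_left h1 hδ.le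
  linarith

theorem IsUnitNormal.integral_inner_of_sphere (hν : IsUnitNormal n δ φ ν)
    (h : IsIsometricImmersion g φ) (hn : n ≠ 0) (hδ : 0 < δ) :
    ∫ x, δ * inner ℝ (φ x) x₀ ∂(riemannianVolume g) =
      ∫ x, -(meanCurvature g φ ν x * inner ℝ (ν x) x₀) ∂(riemannianVolume g) := by
  have := h.isFiniteMeasure
  have hint := hν.integral_minkowskiIntegrand h hn x₀
  simp only [hν.minkowskiIntegrand_eq hδ] at hint
  have h1 : Continuous fun x => δ * inner ℝ (φ x) x₀ :=
    continuous_const.mul (h.contMDiff.continuous.inner continuous_const)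
  have h2 : Continuous fun x => meanCurvature g φ ν x * inner ℝ (ν x) x₀ :=
    (hν.continuous_meanCurvature h).mul (hν.contMDiff.continuous.inner continuous_const)
  rw [integral_add h1.integrable_of_compactSpace h2.integrable_of_compactSpace] at hint
  rw [integral_neg]
  linarith

theorem IsUnitNormal.integral_inner_le_of_sphere (hν : IsUnitNormal n δ φ ν)
    (h : IsIsometricImmersion g φ) (hn : n ≠ 0) (hδ : 0 < δ)
    (hx₀ : x₀ ∈ curvatureSphere n δ) (hcs : s ^ 2 + c ^ 2 = 1) (hs : 0 ≤ s) (hc : 0 < c)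
    (hx : ∀ x, c ≤ δ * inner ℝ (φ x) x₀) :
    ∫ x, δ * inner ℝ (φ x) x₀ ∂(riemannianVolume g) ≤
      s / √δ * ∫ x, |meanCurvature g φ ν x| ∂(riemannianVolume g) := by
  have := h.isFiniteMeasure
  have hH := hν.continuous_meanCurvature h
  rw [hν.integral_inner_of_sphere h hn hδ, ← integral_const_mul]
  refine integral_mono (Continuous.integrable_of_compactSpace (hH.mul
    (hν.contMDiff.continuous.inner continuous_const)).neg)
    (Continuous.integrable_of_compactSpace (continuous_const.mul hH.abs)) fun x => ?_
  refine (neg_le_abs _).trans ?_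
  rw [abs_mul, mul_comm]
  exact mul_le_mul_of_nonneg_right
    (hν.abs_inner_le_of_sphere hδ hx₀ hcs hs hc (hx x)) (abs_nonneg _)

theorem IsIsometricImmersion.mul_volume_le_integral_inner (h : IsIsometricImmersion g φ)
    (hx : ∀ x, c ≤ δ * inner ℝ (φ x) x₀) :
    c * (riemannianVolume g).real Set.univ ≤ ∫ x, δ * inner ℝ (φ x) x₀ ∂(riemannianVolume g) := by
  have := h.isFiniteMeasure
  have : ∫ _, c ∂(riemannianVolume g) = c * (riemannianVolume g).real Set.univ := by
    rw [integral_const, smul_eq_mul, mul_comm]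
  rw [← this]
  exact integral_mono (integrable_const _) (Continuous.integrable_of_compactSpace
    (continuous_const.mul (h.contMDiff.continuous.inner continuous_const))) hx

theorem IsUnitNormal.volume_le_of_sphere (hν : IsUnitNormal n δ φ ν)
    (h : IsIsometricImmersion g φ) (hn : n ≠ 0) (hδ : 0 < δ)
    (hx₀ : x₀ ∈ curvatureSphere n δ) (hcs : s ^ 2 + c ^ 2 = 1) (hs : 0 ≤ s) (hc : 0 < c)
    (hx : ∀ x, c ≤ δ * inner ℝ (φ x) x₀) :
    (riemannianVolume g).real Set.univ ≤
      s / √δ / c * ∫ x, |meanCurvature g φ ν x| ∂(riemannianVolume g) := by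
  have := (h.mul_volume_le_integral_inner hx).trans
    (hν.integral_inner_le_of_sphere h hn hδ hx₀ hcs hs hc hx)
  rwa [div_mul_eq_mul_div, le_div_iff₀ hc, mul_comm]

/-- Here equality already forces cV = ∫ δ⟨φ, x₀⟩, which fixes the distance; zeros of H need no
separate treatment. -/
theorem IsUnitNormal.inner_eq_of_volume_eq (hν : IsUnitNormal n δ φ ν)
    (h : IsIsometricImmersion g φ) (hn : n ≠ 0) (hδ : 0 < δ)
    (hx₀ : x₀ ∈ curvatureSphere n δ) (hcs : s ^ 2 + c ^ 2 = 1) (hs : 0 ≤ s) (hc : 0 < c)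
    (hx : ∀ x, c ≤ δ * inner ℝ (φ x) x₀)
    (heq : (riemannianVolume g).real Set.univ =
      s / √δ / c * ∫ x, |meanCurvature g φ ν x| ∂(riemannianVolume g)) (x : M) :
    δ * inner ℝ (φ x) x₀ = c := by
  have := h.isFiniteMeasure
  have := h.isOpenPosMeasure
  have hle := hν.integral_inner_le_of_sphere h hn hδ hx₀ hcs hs hc hx
  rw [div_mul_eq_mul_div, eq_div_iff hc.ne'] at heq
  refine (congrFun (eq_of_integral_le (μ := riemannianVolume g) (f := fun _ => c)
    (h := fun x => δ * inner ℝ (φ x) x₀) continuous_const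
    (continuous_const.mul (h.contMDiff.continuous.inner continuous_const)) hx ?_) x).symm
  rw [integral_const, smul_eq_mul, heq]
  exact hle

theorem IsUnitNormal.mul_abs_meanCurvature_eq_one_of_sphere (hν : IsUnitNormal n δ φ ν)
    (h : IsIsometricImmersion g φ) (hn : n ≠ 0) (hδ : 0 < δ)
    (hx₀ : x₀ ∈ curvatureSphere n δ) (hcs : s ^ 2 + c ^ 2 = 1) (hs : 0 ≤ s) (hc : 0 < c)
    (hx : ∀ x, δ * inner ℝ (φ x) x₀ = c) (x : M) :
    s / √δ / c * |meanCurvature g φ ν x| = 1 := by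
  have h2 := mul_inner_self_of_mem_curvatureSphere hδ hx₀
  -- A constant angle to `x₀` means a constant chord ‖φ - x₀‖, so the results on constant distance
  -- in the vector space apply.
  have hsq : ∀ y, δ * ‖φ y - x₀‖ ^ 2 = 2 - 2 * c := fun y => by
    rw [norm_sub_sq_real, ← real_inner_self_eq_norm_sq, ← real_inner_self_eq_norm_sq]
    linear_combination (hν.sphere hδ.ne' y).1 + h2 - 2 * hx y
  have hr : ∀ y, ‖φ y - x₀‖ = √((2 - 2 * c) / δ) := fun y => by
    rw [← hsq y, mul_div_cancel_left₀ _ hδ.ne', Real.sqrt_sq (norm_nonneg _)]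
  have h1 := hν.minkowskiIntegrand_eq_zero h hn
    (Filter.Eventually.of_forall hr : ∀ᶠ y in nhds x, _)
  have h3 := hν.inner_sq_add_eq h hr (x := x)
  obtain ⟨hφφ, hφν⟩ := hν.sphere hδ.ne' x
  rw [hν.minkowskiIntegrand_eq hδ, hx] at h1
  rw [inner_sub_right, inner_sub_right, real_inner_comm (φ x) (ν x), hφν] at h3
  have h4 : |inner ℝ (ν x) x₀| = s / √δ := by
    rw [← abs_of_nonneg (show 0 ≤ s / √δ by positivity), ← sq_eq_sq_iff_abs_eq_abs, div_pow,
      Real.sq_sqrt hδ.le, eq_div_iff hδ.ne']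
    have h5 : δ * inner ℝ (φ x) (φ x) - δ * inner ℝ (φ x) x₀ = 1 - c := by rw [hφφ, hx]
    linear_combination δ * h3 + hsq x - hcs -
      (δ * inner ℝ (φ x) (φ x) - δ * inner ℝ (φ x) x₀ + 1 - c) * h5
  rw [← h4, div_mul_eq_mul_div, ← abs_mul, mul_comm, eq_neg_of_add_eq_zero_right h1, abs_neg,
    abs_of_pos hc, div_self hc.ne']

/-- A sphere about `x₀` is a section by a hyperplane orthogonal to `x₀`. On it, projection to the
complement of `x₀` is translation by `-c • x₀`, onto a round sphere of radius s/√δ about 0 in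
dimension n + 1. -/
theorem IsIsometricImmersion.injective_and_range_eq_of_sphere (h : IsIsometricImmersion g φ)
    (hn : 2 ≤ n) (hδ : 0 < δ) (hφ : ∀ x, φ x ∈ curvatureSphere n δ)
    (hx₀ : x₀ ∈ curvatureSphere n δ) (hcs : s ^ 2 + c ^ 2 = 1) (hs : 0 < s)
    (hx : ∀ x, δ * inner ℝ (φ x) x₀ = c) :
    Function.Injective φ ∧
      Set.range φ = {y | y ∈ curvatureSphere n δ ∧ δ * inner ℝ y x₀ = c} := by
  have h2 := mul_inner_self_of_mem_curvatureSphere hδ hx₀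
  have hne : x₀ ≠ 0 := by
    rintro rfl
    simp at h2
  set W : Submodule ℝ (EuclideanSpace ℝ (Fin (n + 2))) := (ℝ ∙ x₀)ᗮ with hWdef
  have hW : Module.finrank ℝ W = n + 1 := by
    have : Fact (Module.finrank ℝ (EuclideanSpace ℝ (Fin (n + 2))) = n + 1 + 1) := ⟨by simp⟩
    exact Submodule.finrank_orthogonal_span_singleton hne
  have hmem : ∀ y, δ * inner ℝ y x₀ = c → y - c • x₀ ∈ W := fun y hy => by
    rw [hWdef, Submodule.mem_orthogonal_singleton_iff_inner_left, inner_sub_left,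
      inner_smul_left, conj_trivial]
    have : δ * (inner ℝ y x₀ - c * inner ℝ x₀ x₀) = 0 := by linear_combination hy - c * h2
    exact (mul_eq_zero.1 this).resolve_left hδ.ne'
  have hproj : ∀ y, δ * inner ℝ y x₀ = c → (W.orthogonalProjectionOnto y : EuclideanSpace ℝ _) =
      y - c • x₀ := fun y hy => by
    have h0 : W.orthogonalProjectionOnto (c • x₀) = 0 := by
      rw [Submodule.orthogonalProjectionOnto_eq_zero_iff, hWdef]
      exact Submodule.le_orthogonal_orthogonal _
        (Submodule.smul_mem _ _ (Submodule.mem_span_singleton_self x₀))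
    have h1 := Submodule.orthogonalProjectionOnto_mem_subspace_eq_self (K := W) ⟨_, hmem y hy⟩
    rw [map_sub, h0, sub_zero] at h1
    rw [h1]
  have hnorm : ∀ y ∈ curvatureSphere n δ, δ * inner ℝ y x₀ = c →
      ‖W.orthogonalProjectionOnto y‖ = s / √δ := fun y hy hyc => by
    rw [show ‖W.orthogonalProjectionOnto y‖ = ‖y - c • x₀‖ by rw [← hproj y hyc]; rfl, ← abs_norm,
      ← abs_of_nonneg (show 0 ≤ s / √δ by positivity), ← sq_eq_sq_iff_abs_eq_abs, div_pow,
      Real.sq_sqrt hδ.le, eq_div_iff hδ.ne', norm_sub_sq_real, ← real_inner_self_eq_norm_sq,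
      ← real_inner_self_eq_norm_sq, inner_smul_left, inner_smul_right, inner_smul_right,
      conj_trivial]
    linear_combination mul_inner_self_of_mem_curvatureSphere hδ hy + c ^ 2 * h2 - 2 * c * hyc - hcs
  obtain ⟨hinj, hrange⟩ := injective_and_range_eq_sphere hn hW
    (f := fun x => W.orthogonalProjectionOnto (φ x)) (c := 0) (r := s / √δ)
    (W.orthogonalProjectionOnto.contDiff.contMDiff.comp h.contMDiff) (fun e he y hy u hu => by
      refine h.fderiv_injective he hy ?_
      have hd : DifferentiableAt ℝ (φ ∘ e.symm) y :=
        (h.contDiffAt he hy).differentiableAt (by simp)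
      have hd' := (W.subtypeL.comp W.orthogonalProjectionOnto).hasFDerivAt.comp y hd.hasFDerivAt
      have he' : φ ∘ e.symm = fun z => ((W.subtypeL.comp W.orthogonalProjectionOnto) ∘
          (φ ∘ e.symm)) z + c • x₀ := by
        funext z
        simp [hproj _ (hx _)]
      have hu' : W.orthogonalProjectionOnto (fderiv ℝ (φ ∘ e.symm) y u) = 0 := by
        rw [← hu]
        exact (congrArg (fun A => A u)
          (W.orthogonalProjectionOnto.hasFDerivAt.comp y hd.hasFDerivAt).fderiv).symm
      have := (hd'.add_const (c • x₀)).fderiv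
      rw [← he'] at this
      rw [this]
      simp [hu'])
    (by positivity) fun x => by rw [sub_zero, hnorm _ (hφ x) (hx x)]
  refine ⟨fun x y hxy => hinj (congrArg W.orthogonalProjectionOnto hxy), ?_⟩
  ext y
  refine ⟨?_, fun ⟨hy, hyc⟩ => ?_⟩
  · rintro ⟨x, rfl⟩
    exact ⟨hφ x, hx x⟩
  · have : W.orthogonalProjectionOnto y ∈ Metric.sphere (0 : W) (s / √δ) := by
      rw [mem_sphere_zero_iff_norm, hnorm y hy hyc]
    rw [← hrange] at this
    obtain ⟨x, hxy⟩ := this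
    refine ⟨x, ?_⟩
    have := congrArg (Subtype.val) hxy
    simp only [hproj _ (hx x), hproj _ hyc] at this
    exact sub_left_injective this

end Spherical

end Comparison

/-! ### Distances and angles in the curvature sphere. -/

section CurvatureSphere

variable {n : ℕ} {δ : ℝ} {x y : EuclideanSpace ℝ (Fin (n + 2))}

theorem cos_angle_of_mem_curvatureSphere (hδ : 0 < δ) (hx : x ∈ curvatureSphere n δ)
    (hy : y ∈ curvatureSphere n δ) :
    Real.cos (InnerProductGeometry.angle x y) = δ * inner ℝ x y := by
  rw [← InnerProductGeometry.cos_angle_mul_norm_mul_norm, norm_of_mem_curvatureSphere hx,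
    norm_of_mem_curvatureSphere hy, div_mul_div_comm, Real.mul_self_sqrt hδ.le]
  field_simp

theorem curvatureSphereDist_eq_arccos (hδ : 0 < δ) (hx : x ∈ curvatureSphere n δ)
    (hy : y ∈ curvatureSphere n δ) :
    curvatureSphereDist δ x y = Real.arccos (δ * inner ℝ x y) / √δ := by
  rw [curvatureSphereDist, ← cos_angle_of_mem_curvatureSphere hδ hx hy,
    Real.arccos_cos (InnerProductGeometry.angle_nonneg _ _) (InnerProductGeometry.angle_le_pi _ _)]

theorem curvatureSphereDist_le_iff (hδ : 0 < δ) {r : ℝ} :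
    curvatureSphereDist δ x y ≤ r ↔ InnerProductGeometry.angle x y ≤ √δ * r := by
  rw [curvatureSphereDist, div_le_iff₀ (Real.sqrt_pos.2 hδ), mul_comm]

theorem isCompact_curvatureSphereDist_le (hδ : 0 < δ) (hy : y ∈ curvatureSphere n δ) (r : ℝ) :
    IsCompact {x | x ∈ curvatureSphere n δ ∧ curvatureSphereDist δ x y ≤ r} := by
  -- The `arccos` expression is continuous on the whole space, whereas the angle is not continuous
  -- at 0.
  have hset : {x | x ∈ curvatureSphere n δ ∧ curvatureSphereDist δ x y ≤ r} =
      curvatureSphere n δ ∩ {x | Real.arccos (δ * inner ℝ x y) / √δ ≤ r} := by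
    ext x
    refine and_congr_right fun hx => ?_
    rw [curvatureSphereDist_eq_arccos hδ hx hy]
    rfl
  rw [hset]
  refine (isCompact_sphere _ _).inter_right (isClosed_le ?_ continuous_const)
  exact (Real.continuous_arccos.comp
    (continuous_const.mul (continuous_id.inner continuous_const))).div_const _

theorem curvatureSphereDist_eq_iff (hδ : 0 < δ) (hx : x ∈ curvatureSphere n δ)
    (hy : y ∈ curvatureSphere n δ) {r : ℝ} (h0 : 0 ≤ r) (hr : √δ * r ≤ Real.pi) :
    curvatureSphereDist δ x y = r ↔ δ * inner ℝ y x = Real.cos (√δ * r) := by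
  rw [real_inner_comm, ← cos_angle_of_mem_curvatureSphere hδ hx hy, curvatureSphereDist,
    div_eq_iff (Real.sqrt_pos.2 hδ).ne', mul_comm r]
  refine ⟨fun h => by rw [h], fun h => Real.injOn_cos ?_ ⟨by positivity, hr⟩ h⟩
  exact ⟨InnerProductGeometry.angle_nonneg _ _, InnerProductGeometry.angle_le_pi _ _⟩

end CurvatureSphere

end

/-! ### The two cases assembled. -/

theorem mainTheorem5 {n : ℕ} (hn : 2 ≤ n)
    {M : Type*} [TopologicalSpace M] [T2Space M] [CompactSpace M] [ConnectedSpace M]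
    [ChartedSpace (EuclideanSpace ℝ (Fin n)) M] [IsManifold (𝓡 n) ∞ M]
    [MeasurableSpace M] [BorelSpace M]
    (g : Bundle.ContMDiffRiemannianMetric (𝓡 n) ∞ (EuclideanSpace ℝ (Fin n))
      (TangentSpace (𝓡 n) : M → Type _))
    (o : OrientationAtlas n M) (p : ℝ) (hp : 1 ≤ p) :
    -- hypersurfaces of the Euclidean space
    (∀ φ : M → EuclideanSpace ℝ (Fin (n + 1)), IsIsometricImmersion g φ →
      let vol : Measure M := riemannianVolume g
      let V : ℝ := vol.real Set.univ
      let normH : ℝ := realLpNorm vol p (meanCurvature g φ (euclideanUnitNormal o φ))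
      let R : ℝ := extrinsicRadius Set.univ dist φ
      0 < V ∧ 0 < normH ∧ tDelta 0 R ≥ V ^ (1 / p) / normH ∧
        (tDelta 0 R = V ^ (1 / p) / normH ↔ IsGeodesicHypersphere Set.univ dist φ R)) ∧
    -- hypersurfaces of an open hemisphere of the sphere of curvature `δ`
    (∀ δ : ℝ, 0 < δ → ∀ φ : M → EuclideanSpace ℝ (Fin (n + 2)), IsIsometricImmersion g φ →
      (∀ x, φ x ∈ curvatureSphere n δ) →
      (∃ q ∈ curvatureSphere n δ, ∀ x, curvatureSphereDist δ q (φ x) < Real.pi / (2 * √δ)) →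
      let vol : Measure M := riemannianVolume g
      let V : ℝ := vol.real Set.univ
      let normH : ℝ := realLpNorm vol p (meanCurvature g φ (sphericalUnitNormal o φ))
      let R : ℝ := extrinsicRadius (curvatureSphere n δ) (curvatureSphereDist δ) φ
      0 < V ∧ 0 < normH ∧ tDelta δ R ≥ V ^ (1 / p) / normH ∧
        (tDelta δ R = V ^ (1 / p) / normH ↔
          IsGeodesicHypersphere (curvatureSphere n δ) (curvatureSphereDist δ) φ R)) := by
  have hn0 : n ≠ 0 := by omega
  refine ⟨fun φ h => ?_, fun δ hδ φ h hφ hq => ?_⟩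
  · intro vol V normH R
    have hν := isUnitNormal_euclideanUnitNormal h o
    have := h.isFiniteMeasure
    have ht : tDelta 0 R = R := by simp [tDelta, sDelta, cDelta]
    have hV : 0 < V := h.volume_univ_pos
    have hR0 : 0 ≤ R := extrinsicRadius_nonneg
    have hdc : Continuous fun y => dist (0 : EuclideanSpace ℝ (Fin (n + 1))) (φ y) :=
      continuous_const.dist h.contMDiff.continuous
    obtain ⟨C, hC⟩ := isCompact_univ.exists_bound_of_continuousOn hdc.continuousOn
    have hne := (extrinsicRadius_lt (r := max C 0 + 1) (Set.mem_univ _) hdc (by positivity)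
      fun y => ((le_abs_self _).trans (hC y (Set.mem_univ y))).trans_lt
        ((le_max_left _ _).trans_lt (lt_add_one _))).1
    obtain ⟨x₀, -, hx₀⟩ := exists_forall_le_extrinsicRadius (fun y r => by
      have hb : {x | x ∈ Set.univ ∧ dist x (φ y) ≤ r} = Metric.closedBall (φ y) r := by
        ext x
        simp
      rw [hb]
      exact isCompact_closedBall _ _) hne
    have hle : ∀ y, ‖φ y - x₀‖ ≤ R := fun y => by
      rw [← dist_eq_norm, dist_comm]
      exact hx₀ y
    obtain ⟨hN, hge, heq, hconst⟩ := realLpNorm_bound (hν.continuous_meanCurvature h) hp hV hR0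
      (hν.volume_le h hn0 hle)
    rw [ht]
    refine ⟨hV, hN, hge, fun he => ?_, fun ⟨_, x, _, hx⟩ => hconst ?_⟩
    · have hr := hν.norm_sub_eq_of_volume_eq h hn0 hle (heq he)
      have hRpos : 0 < R := (div_pos (Real.rpow_pos_of_pos hV _) hN).trans_le hge
      obtain ⟨hinj, hrange⟩ := injective_and_range_eq_sphere hn (by simp) h.contMDiff
        (fun e he y hy u => h.fderiv_injective he hy) hRpos hr
      refine ⟨hinj, x₀, Set.mem_univ _, hrange.trans ?_⟩
      ext y
      rw [mem_sphere_iff_norm, ← dist_eq_norm, dist_comm]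
      exact (and_iff_right (Set.mem_univ y)).symm
    -- The centre `x` of the given hypersphere is used here; it need not be compared with `x₀`.
    · refine hν.mul_abs_meanCurvature_eq_one h hn0 (x₀ := x) fun y => ?_
      have : φ y ∈ Set.range φ := ⟨y, rfl⟩
      rw [hx] at this
      rw [← dist_eq_norm, dist_comm]
      exact this.2
  · intro vol V normH R
    have hν := isUnitNormal_sphericalUnitNormal h o hδ hφ
    have := h.isFiniteMeasure
    have hδ' := Real.sqrt_pos.2 hδ
    have ht : tDelta δ R = Real.sin (√δ * R) / √δ / Real.cos (√δ * R) := by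
      simp [tDelta, sDelta, cDelta, hδ]
    have hV : 0 < V := h.volume_univ_pos
    have hR0 : 0 ≤ R := extrinsicRadius_nonneg
    obtain ⟨q, hqS, hq⟩ := hq
    have hdc : Continuous fun y => curvatureSphereDist δ q (φ y) := by
      simp only [fun y => curvatureSphereDist_eq_arccos hδ hqS (hφ y)]
      exact (Real.continuous_arccos.comp (continuous_const.mul
        (continuous_const.inner h.contMDiff.continuous))).div_const _
    -- The hemisphere is open and `M` compact, so R < π/(2√δ) strictly; this makes the cosine
    -- positive below.
    obtain ⟨hne, hRlt⟩ := extrinsicRadius_lt hqS hdc (by positivity) hq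
    have hα0 : 0 ≤ √δ * R := by positivity
    have hα : √δ * R < Real.pi / 2 := by
      have := mul_lt_mul_of_pos_left hRlt hδ'
      rwa [← div_div, mul_div_cancel₀ _ hδ'.ne'] at this
    have hαpi : √δ * R ≤ Real.pi := by linarith [Real.pi_pos]
    have hs := Real.sin_nonneg_of_nonneg_of_le_pi hα0 hαpi
    have hc := Real.cos_pos_of_mem_Ioo ⟨by linarith [Real.pi_pos], hα⟩
    obtain ⟨x₀, hx₀S, hx₀⟩ := exists_forall_le_extrinsicRadius
      (fun y r => isCompact_curvatureSphereDist_le hδ (hφ y) r) hne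
    have hle : ∀ y, Real.cos (√δ * R) ≤ δ * inner ℝ (φ y) x₀ := fun y => by
      rw [real_inner_comm, ← cos_angle_of_mem_curvatureSphere hδ hx₀S (hφ y)]
      exact Real.cos_le_cos_of_nonneg_of_le_pi (InnerProductGeometry.angle_nonneg _ _) hαpi
        ((curvatureSphereDist_le_iff hδ).1 (hx₀ y))
    have hcs := Real.sin_sq_add_cos_sq (√δ * R)
    obtain ⟨hN, hge, heq, hconst⟩ := realLpNorm_bound (hν.continuous_meanCurvature h) hp hV
      (show 0 ≤ Real.sin (√δ * R) / √δ / Real.cos (√δ * R) by positivity)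
      (hν.volume_le_of_sphere h hn0 hδ hx₀S hcs hs hc hle)
    rw [ht]
    refine ⟨hV, hN, hge, fun he => ?_, fun ⟨_, x, hxS, hx⟩ => hconst ?_⟩
    · have hr := hν.inner_eq_of_volume_eq h hn0 hδ hx₀S hcs hs hc hle (heq he)
      -- The inequality already proved bounds t_δ(R) below by a positive number.
      have hspos : 0 < Real.sin (√δ * R) := hs.lt_of_ne fun h0 => by
        have := (div_pos (Real.rpow_pos_of_pos hV (1 / p)) hN).trans_le hge
        simp [← h0] at this
      obtain ⟨hinj, hrange⟩ :=
        h.injective_and_range_eq_of_sphere hn hδ hφ hx₀S hcs hspos hr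
      refine ⟨hinj, x₀, hx₀S, hrange.trans ?_⟩
      ext y
      exact and_congr_right fun hy => (curvatureSphereDist_eq_iff hδ hx₀S hy hR0 hαpi).symm
    · refine hν.mul_abs_meanCurvature_eq_one_of_sphere h hn0 hδ hxS hcs hs hc fun y => ?_
      have : φ y ∈ Set.range φ := ⟨y, rfl⟩
      rw [hx] at this
      exact (curvatureSphereDist_eq_iff hδ hxS (hφ y) hR0 hαpi).1 this.2
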